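/- **Conventions.** Graphs are finite, nonempty and simple; $v(G)$ is the number of nodes of $G$. A pair $(G,d)$ is *admissible* if $d\ge 1$ is real and all degrees of $G$ are at most $d$. For a connected graph $F$, let $$t(F,G,d)=\frac{\hom(F,G)}{v(G)\,d^{\,v(F)-1}},\qquad t_{\mathrm{inj}}(F,G,d)=\frac{\mathrm{inj}(F,G)}{v(G)\,d\,(d-1)^{v(F)-2}}\quad(v(F)\ge 2),$$ where $\hom$ and $\mathrm{inj}$ count homomorphisms and injective homomorphisms (and $0/0=0$). A sequence $(G_n,d_n)$ of admissible pairs is *$\alpha$-regular* if the degree of a uniform random node of $G_n$, divided by $d_n$, tends to $\alpha$ in probability. It has *large essential girth* if $t_{\mathrm{inj}}(C_k,G_n,d_n)\to 0$ for every $k\ge 3$. A *graphoning* is a tuple $\mathbf G=(X,\mathcal B,\lambda,\mu,W)$, where $(X,\mathcal B,\lambda)$ is a probability space, $\mu:\mathcal B\to[0,\infty]$ is a measure, and $W:X^2\to[0,1]$ is symmetric and $(\mathcal B\otimes\mathcal B)$-measurable, such that, with $\deg_A(x)=\int_A W(x,y)\,d\mu(y)$, we have $\deg_X(x)\le 1$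 for all $x\in X$, the function $\deg_A$ is measurable for all $A\in\mathcal B$, and $\int_A\deg_B\,d\lambda=\int_B\deg_A\,d\lambda$ for all $A,B\in\mathcal B$. For a connected graph $F$, label its nodes by $0,\dots,m=v(F)-1$ so that for every $1\le i\le v(F)$ the nodes with labels less than $i$ span a connected subgraph, and put $$t(F,\mathbf G)=\int_X\int_X\cdots\int_X\ \prod_{kl\in E(F)}W(x_k,x_l)\ d\mu(x_m)\cdots d\mu(x_1)\,d\lambda(x_0);$$ this does not depend on the labeling. A *gauge function* is a function $h\ge 0$ that is nondecreasing and right-continuous on a right neighborhood $[0,\varepsilon)$ of $0$. The Hausdorff measure with gauge function $h$ is $$\mu(B)=\lim_{\delta\to 0}\inf\Big\{\sum_i h(\operatorname{diam} I_i):\ (I_i)\text{ a countable cover of } B \text{ by nonempty sets},\ \operatorname{diam} I_i<\delta \text{ for all } i\Big\}.$$ A *Hausdorff graphoning* with gauge function $h$ is a graphoning $(X,\mathcal B,\lambda,\mu,W)$, where $X$ is a metric space, $\mathcal B$ is its Borel $\sigma$-algebra, $\lambda$ is 1-dimensional Hausdorff measure, and $\mu$ is the Hausdorff measure with gauge function $h$;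 it is *Euclidean* if $X=[0,1]$ with the Euclidean metric. It is a *Hausdorff* (resp. *Euclidean*) *limit* of $(G_n,d_n)$ if $h(1/v(G_n))\sim 1/d_n$ as $n\to\infty$ and $t(F,G_n,d_n)\to t(F,\mathbf G)$ for all connected graphs $F$. **Theorem.** Let $0\le\alpha\le 1$, and let $(G_n,d_n)$ be an $\alpha$-regular sequence of admissible pairs with large essential girth such that $v(G_n)<v(G_{n+1})$ and $d_n\le d_{n+1}$ for all $n$. Then (a) $(G_n,d_n)$ has a Hausdorff limit such that $W$ is $\{0,1\}$-valued. (b) If, in addition, the function $1/v(G_n)\mapsto 1/d_n$ is concave on the set $\{1/v(G_n)\}$ (that is, $a/v(G_i)+b/v(G_k)=1/v(G_j)$ with $a,b\ge 0$, $a+b=1$ implies $a/d_i+b/d_k\le 1/d_j$), then $(G_n,d_n)$ has a Euclidean limit such that $W$ is $\{0,1\}$-valued. -/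

import Mathlib

open MeasureTheory Filter Topology Asymptotics
open scoped ENNReal

/-! ### Admissible pairs and homomorphism densities -/

open Classical in
/-- `(G, d)` is an admissible pair: `d ≥ 1` and all degrees of `G` are at most `d`. -/
def IsAdmissible {V : Type*} [Fintype V] (G : SimpleGraph V) (d : ℝ) : Prop :=
  1 ≤ d ∧ ∀ v : V, (G.degree v : ℝ) ≤ d

/-- The homomorphism density `t(F, G, d) = hom(F, G) / (v(G) d ^ (v(F) - 1))`
of a connected graph `F`. -/
noncomputable def homDensity {U V : Type*} [Fintype U] [Fintype V]
    (F : SimpleGraph U) (G : SimpleGraph V) (d : ℝ) : ℝ :=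
  (Nat.card (F →g G) : ℝ) / ((Fintype.card V : ℝ) * d ^ (Fintype.card U - 1))

/-- The injective homomorphism density
`t_inj(F, G, d) = inj(F, G) / (v(G) d (d - 1) ^ (v(F) - 2))`
of a connected graph `F` with at least two nodes. -/
noncomputable def injDensity {U V : Type*} [Fintype U] [Fintype V]
    (F : SimpleGraph U) (G : SimpleGraph V) (d : ℝ) : ℝ :=
  (Nat.card {f : F →g G // Function.Injective f} : ℝ) /
    ((Fintype.card V : ℝ) * d * (d - 1) ^ (Fintype.card U - 2))

open Classical in
/-- `α`-regularity: the degree of a uniform random node of `G n`, divided by `d n`,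
tends to `α` in probability. -/
def IsRegularSeq {V : ℕ → Type*} [∀ n, Fintype (V n)] (G : ∀ n, SimpleGraph (V n))
    (d : ℕ → ℝ) (α : ℝ) : Prop :=
  ∀ ε : ℝ, 0 < ε →
    Tendsto
      (fun n => ((Finset.univ.filter
          (fun v : V n => ε < |((G n).degree v : ℝ) / d n - α|)).card : ℝ) /
        (Fintype.card (V n) : ℝ))
      atTop (𝓝 0)

/-- Large essential girth: `t_inj(C_k, G n, d n) → 0` for all `k ≥ 3`. -/
def HasLargeEssentialGirth {V : ℕ → Type*} [∀ n, Fintype (V n)]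
    (G : ∀ n, SimpleGraph (V n)) (d : ℕ → ℝ) : Prop :=
  ∀ k : ℕ, 3 ≤ k →
    Tendsto (fun n => injDensity (SimpleGraph.cycleGraph k) (G n) (d n)) atTop (𝓝 0)

/-! ### Graphonings and their homomorphism densities -/

/-- `(X, lam, mu, W)` is a graphoning. The values of `W` lie in `[0, 1]`, seen inside `ℝ≥0∞`. -/
structure IsGraphoning {X : Type*} [MeasurableSpace X] (lam mu : Measure X)
    (W : X → X → ℝ≥0∞) : Prop where
  isProbabilityMeasure : IsProbabilityMeasure lam
  le_one : ∀ x y, W x y ≤ 1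
  symm : ∀ x y, W x y = W y x
  measurable : Measurable (Function.uncurry W)
  degree_bound : ∀ x, ∫⁻ y, W x y ∂mu ≤ 1
  degree_measurable : ∀ A : Set X, MeasurableSet A →
    Measurable (fun x => ∫⁻ y in A, W x y ∂mu)
  measure_preserving : ∀ A B : Set X, MeasurableSet A → MeasurableSet B →
    ∫⁻ x in A, (∫⁻ y in B, W x y ∂mu) ∂lam = ∫⁻ x in B, (∫⁻ y in A, W x y ∂mu) ∂lam

/-- A labelling of the nodes of `F` by `0, …, m` is admissible if for every `1 ≤ i ≤ m + 1`
the nodes with labels less than `i` span a connected subgraph. -/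
def IsAdmissibleLabelling {U : Type*} (F : SimpleGraph U) {m : ℕ} (φ : U ≃ Fin (m + 1)) : Prop :=
  ∀ i : ℕ, 1 ≤ i → i ≤ m + 1 → (F.induce {u : U | (φ u : ℕ) < i}).Connected

/-- Every connected graph has an admissible labelling. -/
theorem exists_isAdmissibleLabelling (m : ℕ) : ∀ (U : Type) [Fintype U] (F : SimpleGraph U), F.Connected →
    Fintype.card U = m + 1 → ∃ φ : U ≃ Fin (m + 1), IsAdmissibleLabelling F φ := by
  classical
  induction m with
  | zero =>
    intro U _ F hF hc
    refine ⟨Fintype.equivFinOfCardEq hc, fun i h1 h2 => ?_⟩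
    have : {u : U | ((Fintype.equivFinOfCardEq hc) u : ℕ) < i} = Set.univ := by
      ext u; simp; omega
    rw [this]
    exact (SimpleGraph.induceUnivIso F).connected_iff.2 hF
  | succ m ih =>
    intro U _ F hF hc
    have : Nontrivial U := Fintype.one_lt_card_iff_nontrivial.1 (by omega)
    obtain ⟨v, hv⟩ := hF.exists_connected_induce_compl_singleton_of_finite_nontrivial
    obtain ⟨φ, hφ⟩ := ih {u // u ≠ v} (F.induce {u | u ≠ v}) hv (by
      simp [hc])
    let ψ : U ≃ Fin (m + 2) := (Equiv.optionSubtypeNe v).symm.trans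
      ((Equiv.optionCongr φ).trans finSuccEquivLast.symm)
    have h1 : ψ v = Fin.last _ := by simp [ψ]
    have h2 : ∀ u (h : u ≠ v), ψ u = (φ ⟨u, h⟩).castSucc := by
      intro u h; simp [ψ, Equiv.optionSubtypeNe_symm_of_ne h]
    refine ⟨ψ, fun i hi hi' => ?_⟩
    rcases Nat.lt_or_ge i (m + 2) with hlt | hge
    · have key := hφ i hi (by omega)
      have hne : ∀ u, (ψ u : ℕ) < i → u ≠ v := by
        rintro u hu rfl; rw [h1] at hu; simp at hu; omega
      let e : ((F.induce {u | u ≠ v}).induce {u | (φ u : ℕ) < i}) ≃g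
          (F.induce {u : U | (ψ u : ℕ) < i}) :=
        { toFun := fun x => ⟨x.1.1, by
            have := x.2; simp only [Set.mem_ofPred_eq] at this ⊢; rw [h2 _ x.1.2]; simpa using this⟩
          invFun := fun x => ⟨⟨x.1, hne _ x.2⟩, by
            have := x.2; simp only [Set.mem_ofPred_eq] at this ⊢; rw [h2 _ (hne _ x.2)] at this; simpa using this⟩
          left_inv := fun x => rfl
          right_inv := fun x => rfl
          map_rel_iff' := by intro a b; rfl }
      exact e.connected_iff.1 key
    · have : {u : U | (ψ u : ℕ) < i} = Set.univ := by
        ext u; simp; omega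
      rw [this]
      exact (SimpleGraph.induceUnivIso F).connected_iff.2 hF

/-- The iterated integral `∫ ⋯ ∫ f (x₀, …, x_{n-1}) dμ(x_{n-1}) ⋯ dμ(x₀)`, with the last variable
integrated first. -/
noncomputable def iteratedLIntegral {X : Type*} [MeasurableSpace X] (mu : Measure X) :
    (n : ℕ) → ((Fin n → X) → ℝ≥0∞) → ℝ≥0∞
  | 0, f => f Fin.elim0
  | n + 1, f => ∫⁻ x, iteratedLIntegral mu n (fun y => f (Fin.cons x y)) ∂mu

open Classical in
/-- The homomorphism density of a connected graph `F` with an admissible labelling `φ` by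
`0, …, m` in a graphoning `(X, lam, mu, W)`:
`∫ ∫ ⋯ ∫ ∏_{kl ∈ E(F)} W(x_k, x_l) dμ(x_m) ⋯ dμ(x_1) dλ(x_0)`. -/
noncomputable def graphoningDensity {X : Type*} [MeasurableSpace X] (lam mu : Measure X)
    (W : X → X → ℝ≥0∞) {U : Type*} (F : SimpleGraph U) {m : ℕ} (φ : U ≃ Fin (m + 1)) : ℝ≥0∞ :=
  ∫⁻ x₀, iteratedLIntegral mu m (fun y =>
    ∏ p : Fin (m + 1) × Fin (m + 1) with p.1 < p.2 ∧ F.Adj (φ.symm p.1) (φ.symm p.2),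
      W (Fin.cons (α := fun _ => X) x₀ y p.1) (Fin.cons (α := fun _ => X) x₀ y p.2)) ∂lam

/-! ### Hausdorff graphonings and Hausdorff limits -/

/-- A gauge function: nonnegative, nondecreasing and right-continuous on a right
neighbourhood `[0, ε)` of `0`. The values elsewhere are irrelevant. -/
def IsGauge (h : ℝ → ℝ) : Prop :=
  ∃ ε : ℝ, 0 < ε ∧ (∀ x ∈ Set.Ico 0 ε, 0 ≤ h x) ∧ MonotoneOn h (Set.Ico 0 ε) ∧
    ∀ x ∈ Set.Ico 0 ε, ContinuousWithinAt h (Set.Ici x) x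

/-- The Hausdorff measure with gauge function `h`; empty sets in a cover contribute `0`. -/
noncomputable def gaugeMeasure (X : Type*) [MetricSpace X] [MeasurableSpace X] [BorelSpace X]
    (h : ℝ → ℝ) : Measure X :=
  Measure.mkMetric (fun r : ℝ≥0∞ => ENNReal.ofReal (h r.toReal))

/-- The metric space `X`, the gauge function `h` and the function `W` form a Hausdorff graphoning
`(X, Borel sets, 1-dimensional Hausdorff measure, Hausdorff measure with gauge h, W)`. -/
def IsHausdorffGraphoning (X : Type*) [MetricSpace X] [MeasurableSpace X] [BorelSpace X]
    (h : ℝ → ℝ) (W : X → X → ℝ≥0∞) : Prop :=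
  IsGauge h ∧ IsGraphoning (Measure.hausdorffMeasure 1 : Measure X) (gaugeMeasure X h) W

/-- The Hausdorff graphoning `(X, h, W)` is a Hausdorff limit of `(G n, d n)`: it satisfies
`h(1 / v(G n)) ∼ 1 / d n`, and `t(F, G n, d n)` converges to its homomorphism density of `F`
for every connected graph `F`, the latter being computed with any admissible labelling of `F`. -/
structure IsHausdorffLimit {V : ℕ → Type*} [∀ n, Fintype (V n)] (G : ∀ n, SimpleGraph (V n))
    (d : ℕ → ℝ) (X : Type*) [MetricSpace X] [MeasurableSpace X] [BorelSpace X]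
    (h : ℝ → ℝ) (W : X → X → ℝ≥0∞) : Prop where
  isHausdorffGraphoning : IsHausdorffGraphoning X h W
  growth : (fun n => h (1 / (Fintype.card (V n) : ℝ))) ~[atTop] (fun n => 1 / d n)
  tendsto : ∀ (U : Type) [Fintype U] (F : SimpleGraph U), F.Connected →
    ∀ (m : ℕ) (φ : U ≃ Fin (m + 1)), IsAdmissibleLabelling F φ →
      Tendsto (fun n => ENNReal.ofReal (homDensity F (G n) (d n))) atTop
        (𝓝 (graphoningDensity (Measure.hausdorffMeasure 1) (gaugeMeasure X h) W F φ))

/-- The function `1 / v n ↦ 1 / d n`, defined on the set of all `1 / v n`, is concave. -/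
def ReciprocalConcave (v d : ℕ → ℝ) : Prop :=
  ∀ (i j k : ℕ) (a b : ℝ), 0 ≤ a → 0 ≤ b → a + b = 1 →
    a * (1 / v i) + b * (1 / v k) = 1 / v j → a * (1 / d i) + b * (1 / d k) ≤ 1 / d j

/-! The sequence `1 / d n` is nonincreasing, so it has a limit `δ`. The step function `stepGauge`
interpolates the data exactly: its value at `1 / v n` is `1 / d n`, and its value at `0` is `δ`.
With this gauge a graphoning on `[0,1]` is built whose densities are the limits of `homDensity`; it
serves both parts of the theorem.

The asymptotics rest on `tendsto_injRatio_add_leaf`: attaching a leaf at the node `u` of a tree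
multiplies the normalized number of injective homomorphisms by `α - deg u / d n`, up to `o(1)`.
Indeed almost all degrees are close to `α * d n`, and any further adjacency would close a cycle,
which is rare. Arbitrary homomorphisms are sorted by their kernels (`card_homMaps_eq_sum`).

Case `δ = 0`. Nontrivial kernels are negligible, so trees have limit density `α ^ (v(F) - 1)` and
all other connected graphs have limit density `0`. If `α > 0`, comparing paths with 4-cycles gives
`d n / v n → 0` (`tendsto_div_card`), which means `h x / x → ∞` at `0`. This leaves room for a
Cantor set of positive finite gauge measure in which `a - b - c + e ∈ ℤ` has only trivial solutions
(`CantorData.sidon`); an initial piece `S` has measure `α`. Join `x` to `y` when `x + y` lies in `S`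
modulo `1`. Every leaf integrates to `α`, while two distinct points have codegree `0` (apart from
the endpoint `1`, which duplicates `0`), so cycles have density `0`. If `α = 0`, the empty graph
does.

Case `δ > 0`. Now `d n → 1 / δ`, and `k = α / δ` is an integer because degrees are integers. The
limit densities count rooted homomorphisms into a `k`-regular acyclic graph, with weight `δ ^ (v(F)
- 1)` (`exists_card_rootedHom`), and the gauge measure is `δ` times counting measure. The graph is
the Cayley graph of `k` involutions that generate a free product inside a compact group; Haar
measure supplies the invariance, and an almost everywhere injective map transports everything to
`[0,1]`. -/

/-! ### Counting homomorphisms into finite graphs -/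

section Counting

open Classical in
/-- The maps that are homomorphisms `F → G`. -/
noncomputable def homMaps {U V : Type*} [Fintype U] [Fintype V] (F : SimpleGraph U)
    (G : SimpleGraph V) : Finset (U → V) :=
  Finset.univ.filter fun f => ∀ a b, F.Adj a b → G.Adj (f a) (f b)

open Classical in
/-- The maps that are injective homomorphisms `F → G`. -/
noncomputable def injMaps {U V : Type*} [Fintype U] [Fintype V] (F : SimpleGraph U)
    (G : SimpleGraph V) : Finset (U → V) :=
  Finset.univ.filter fun f => Function.Injective f ∧ ∀ a b, F.Adj a b → G.Adj (f a) (f b)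

variable {U V : Type*} [Fintype U] [Fintype V] {F : SimpleGraph U} {G : SimpleGraph V}

theorem mem_homMaps {f : U → V} : f ∈ homMaps F G ↔ ∀ a b, F.Adj a b → G.Adj (f a) (f b) := by
  simp [homMaps]

theorem mem_injMaps {f : U → V} :
    f ∈ injMaps F G ↔ Function.Injective f ∧ ∀ a b, F.Adj a b → G.Adj (f a) (f b) := by
  simp [injMaps]

theorem injMaps_subset_homMaps : injMaps F G ⊆ homMaps F G := fun _ hf =>
  mem_homMaps.2 (mem_injMaps.1 hf).2

variable (F G) in
theorem card_homMaps : (homMaps F G).card = Nat.card (F →g G) := by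
  rw [← Fintype.card_coe, ← Nat.card_eq_fintype_card]
  refine Nat.card_congr ⟨fun f => ⟨f.1, fun h => mem_homMaps.1 f.2 _ _ h⟩,
    fun f => ⟨f, mem_homMaps.2 fun a b h => f.map_rel h⟩, fun _ => rfl, fun _ => rfl⟩

variable (F G) in
theorem card_injMaps :
    (injMaps F G).card = Nat.card {f : F →g G // Function.Injective f} := by
  rw [← Fintype.card_coe, ← Nat.card_eq_fintype_card]
  refine Nat.card_congr ⟨fun f => ⟨⟨f.1, fun {a b} h => (mem_injMaps.1 f.2).2 a b h⟩,
    (mem_injMaps.1 f.2).1⟩,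
    fun f => ⟨f.1, mem_injMaps.2 ⟨f.2, fun a b h => f.1.map_rel h⟩⟩, fun _ => rfl, fun _ => rfl⟩

open Classical in
/-- A family of homomorphisms of a connected graph into a graph of maximal degree at most `Δ` is
controlled by its restriction to a nonempty set of nodes. -/
theorem card_le_card_restrict_mul_pow (hF : F.Connected) {Δ : ℕ} (hΔ : ∀ v, G.degree v ≤ Δ)
    {S : Finset (U → V)} (hS : S ⊆ homMaps F G) (n : ℕ) :
    ∀ A : Finset U, A.Nonempty → Fintype.card U = A.card + n →
      S.card ≤ (S.image A.restrict).card * Δ ^ n := by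
  induction n with
  | zero =>
    intro A _ hA
    have : A = Finset.univ := (Finset.card_eq_iff_eq_univ A).1 (by omega)
    subst this
    rw [Finset.card_image_of_injective]
    · simp
    · intro f g h
      funext u
      exact congrFun h ⟨u, Finset.mem_univ u⟩
  | succ n ih =>
    intro A hA hcard
    obtain ⟨u₀, hu₀⟩ : ∃ u, u ∉ A := by
      by_contra! h
      rw [(Finset.eq_univ_iff_forall).2 h, Finset.card_univ] at hcard
      omega
    obtain ⟨a₀, ha₀⟩ := hA
    obtain ⟨p⟩ := hF.preconnected a₀ u₀
    -- An edge leaving `A` supplies the next node. Its image is a neighbour of an already known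
    -- node, so each restriction to `A` extends in at most `Δ` ways.
    obtain ⟨e, -, ha, hu⟩ := p.exists_boundary_dart (A : Set U) ha₀ hu₀
    have hu' : e.snd ∉ A := hu
    have ha' : e.fst ∈ A := ha
    have h1 := ih (insert e.snd A) (Finset.insert_nonempty _ _)
      (by rw [Finset.card_insert_of_notMem hu']; omega)
    refine h1.trans ?_
    have h2 : (S.image (insert e.snd A).restrict).card ≤ Δ * (S.image A.restrict).card := by
      refine Finset.card_le_mul_card_image_of_maps_to
        (f := Finset.restrict₂ (π := fun _ => V) (Finset.subset_insert e.snd A)) ?_ Δ ?_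
      · intro g hg
        obtain ⟨f, hf, rfl⟩ := Finset.mem_image.1 hg
        exact Finset.mem_image.2 ⟨f, hf, rfl⟩
      · intro g _
        refine le_trans ?_ (hΔ (g ⟨e.fst, ha'⟩))
        rw [← SimpleGraph.card_neighborFinset_eq_degree]
        refine Finset.card_le_card_of_injOn (fun f => f ⟨e.snd, Finset.mem_insert_self _ _⟩) ?_ ?_
        · intro k hk
          simp only [Finset.coe_filter, Finset.mem_image, Set.mem_ofPred_eq] at hk
          obtain ⟨⟨f, hf, rfl⟩, rfl⟩ := hk
          exact Finset.mem_coe.2 ((SimpleGraph.mem_neighborFinset _ _ _).2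
            (mem_homMaps.1 (hS hf) _ _ e.adj))
        · intro k hk k' hk' h
          simp only [Finset.coe_filter, Finset.mem_image, Set.mem_ofPred_eq] at hk hk'
          obtain ⟨⟨f, hf, rfl⟩, hg⟩ := hk
          obtain ⟨⟨f', hf', rfl⟩, hg'⟩ := hk'
          funext ⟨x, hx⟩
          rcases Finset.mem_insert.1 hx with rfl | hx'
          · exact h
          · exact congrFun (hg.trans hg'.symm) ⟨x, hx'⟩
    calc (S.image (insert e.snd A).restrict).card * Δ ^ n
        ≤ (Δ * (S.image A.restrict).card) * Δ ^ n := Nat.mul_le_mul_right _ h2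
      _ = _ := by ring

open Classical in
/-- The number of homomorphisms of a connected graph that send a given node into a given set. -/
theorem card_filter_mem_le (hF : F.Connected) {Δ : ℕ} (hΔ : ∀ v, G.degree v ≤ Δ)
    {S : Finset (U → V)} (hS : S ⊆ homMaps F G) (u : U) (B : Finset V) (hB : ∀ f ∈ S, f u ∈ B) :
    S.card ≤ B.card * Δ ^ (Fintype.card U - 1) := by
  have hc : 0 < Fintype.card U := Fintype.card_pos_iff.2 ⟨u⟩
  refine (card_le_card_restrict_mul_pow hF hΔ hS (Fintype.card U - 1) {u} (by simp)
    (by simp; omega)).trans (Nat.mul_le_mul_right _ ?_)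
  refine Finset.card_le_card_of_injOn (fun f => f ⟨u, by simp⟩) ?_ ?_
  · intro g hg
    simp only [Finset.coe_image, Set.mem_image] at hg
    obtain ⟨f, hf, rfl⟩ := hg
    exact hB f hf
  · intro g _ g' _ h
    funext ⟨x, hx⟩
    obtain rfl := Finset.mem_singleton.1 hx
    exact h

open Classical in
/-- If `F` contains an injective image of `C`, then homomorphisms `F → G` are controlled by those
of `C`. -/
theorem card_injMaps_le_of_subgraph (hF : F.Connected) {Δ : ℕ} (hΔ : ∀ v, G.degree v ≤ Δ)
    {T : Type*} [Fintype T] [Nonempty T] {C : SimpleGraph T} (i : C →g F)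
    (hi : Function.Injective i) :
    (injMaps F G).card ≤ (injMaps C G).card * Δ ^ (Fintype.card U - Fintype.card T) := by
  have hcard : (Finset.univ.image i).card = Fintype.card T := by
    rw [Finset.card_image_of_injective _ hi, Finset.card_univ]
  have hle := Fintype.card_le_of_injective i hi
  refine (card_le_card_restrict_mul_pow hF hΔ injMaps_subset_homMaps _ (Finset.univ.image i)
    (by simp) (by rw [hcard]; omega)).trans (Nat.mul_le_mul_right _ ?_)
  refine Finset.card_le_card_of_injOn (fun g t => g ⟨i t, by simp⟩) ?_ ?_
  · intro g hg
    simp only [Finset.coe_image, Set.mem_image, Finset.mem_coe] at hg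
    obtain ⟨f, hf, rfl⟩ := hg
    obtain ⟨h1, h2⟩ := mem_injMaps.1 hf
    exact mem_injMaps.2 ⟨fun a b h => hi (h1 h), fun a b h => h2 _ _ (i.map_rel h)⟩
  · intro g _ g' _ h
    funext ⟨x, hx⟩
    obtain ⟨t, -, rfl⟩ := Finset.mem_image.1 hx
    exact congrFun h t

end Counting

/-! ### Graphs with a connected ordering of the nodes -/

section Ordered

/-- Every node but the first is adjacent to an earlier one. -/
def OrdConn {m : ℕ} (F : SimpleGraph (Fin (m + 1))) : Prop :=
  ∀ i, i ≠ 0 → ∃ j < i, F.Adj j i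

/-- No node is adjacent to two earlier ones. -/
def UniqueParent {m : ℕ} (F : SimpleGraph (Fin (m + 1))) : Prop :=
  ∀ i j j', j < i → j' < i → F.Adj j i → F.Adj j' i → j = j'

variable {m : ℕ} {F : SimpleGraph (Fin (m + 1))}

theorem OrdConn.reachable_zero_of_lt {F' : SimpleGraph (Fin (m + 1))} (hF : OrdConn F)
    {n : Fin (m + 1)} (h : ∀ a b, a < n → b < n → F.Adj a b → F'.Adj a b) (i : Fin (m + 1))
    (hi : i < n) : F'.Reachable 0 i := by
  induction i using WellFoundedLT.induction with
  | ind i ih =>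
    rcases eq_or_ne i 0 with rfl | h0
    · rfl
    · obtain ⟨j, hj, hadj⟩ := hF i h0
      exact (ih j hj (hj.trans hi)).trans (h _ _ (hj.trans hi) hi hadj).reachable

theorem OrdConn.connected (hF : OrdConn F) : F.Connected := by
  have h : ∀ i, F.Reachable 0 i := by
    intro i
    induction i using WellFoundedLT.induction with
    | ind i ih =>
      rcases eq_or_ne i 0 with rfl | h0
      · rfl
      · obtain ⟨j, hj, hadj⟩ := hF i h0
        exact (ih j hj).trans hadj.reachable
  exact ⟨fun a b => (h a).symm.trans (h b)⟩

/-- The nodes before `i` are joined to `0` by edges among themselves, so with two earlier neighbours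
of `i` the edge `s(j, i)` could be bypassed; in an acyclic graph every edge is a bridge. -/
theorem OrdConn.uniqueParent (hF : OrdConn F) (hac : F.IsAcyclic) : UniqueParent F := by
  intro i j j' hj hj' hadj hadj'
  by_contra hne
  have hb := (SimpleGraph.isAcyclic_iff_forall_isBridge.1 hac) (e := s(j, i)) hadj
  rw [SimpleGraph.isBridge_iff] at hb
  apply hb
  have key : ∀ a b, a < i → b < i → F.Adj a b → (F.deleteEdges {s(j, i)}).Adj a b := by
    intro a b ha hb hab
    rw [SimpleGraph.deleteEdges_adj]
    refine ⟨hab, ?_⟩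
    simp only [Set.mem_singleton_iff, Sym2.eq_iff, not_or, not_and]
    exact ⟨fun _ => hb.ne, fun h => absurd h ha.ne⟩
  refine ((hF.reachable_zero_of_lt key j hj).symm.trans (hF.reachable_zero_of_lt key j' hj')).trans
    (SimpleGraph.Adj.reachable ?_)
  rw [SimpleGraph.deleteEdges_adj]
  refine ⟨hadj', ?_⟩
  simp only [Set.mem_singleton_iff, Sym2.eq_iff, not_or, not_and]
  exact ⟨fun h => absurd h.symm hne, fun h => absurd h hj'.ne⟩

/-- An edge is determined by its later endpoint, which is not `0`. So there are at most `m` edges,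
and a connected graph on `m + 1` nodes with so few edges is a tree. -/
theorem OrdConn.isAcyclic (hF : OrdConn F) (hu : UniqueParent F) : F.IsAcyclic := by
  classical
  have h1 : ∀ e : F.edgeSet, ∃ p : Fin (m + 1) × Fin (m + 1), p.1 < p.2 ∧ e.1 = s(p.1, p.2) := by
    rintro ⟨e, he⟩
    induction e using Sym2.ind with
    | _ a b =>
      rcases lt_or_gt_of_ne (SimpleGraph.Adj.ne he) with h | h
      · exact ⟨(a, b), h, rfl⟩
      · exact ⟨(b, a), h, Sym2.eq_swap⟩
  choose p hp1 hp2 using h1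
  have hinj : Function.Injective fun e : F.edgeSet => (⟨(p e).2, by
      have := hp1 e
      exact (lt_of_le_of_lt (Fin.zero_le _) this).ne'⟩ : {i : Fin (m + 1) // i ≠ 0}) := by
    intro e e' h
    have h2 : (p e).2 = (p e').2 := congrArg Subtype.val h
    have a1 : F.Adj (p e).1 (p e).2 := by
      have := e.2; rw [hp2 e] at this; exact this
    have a2 : F.Adj (p e').1 (p e').2 := by
      have := e'.2; rw [hp2 e'] at this; exact this
    have h3 : (p e).1 = (p e').1 :=
      hu _ _ _ (hp1 e) (h2 ▸ hp1 e') a1 (h2 ▸ a2)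
    exact Subtype.ext (by rw [hp2 e, hp2 e', h2, h3])
  have hle : Nat.card F.edgeSet ≤ m := by
    refine (Nat.card_le_card_of_injective _ hinj).trans ?_
    simp
  have hc := hF.connected
  have hge := hc.card_vert_le_card_edgeSet_add_one
  simp only [Nat.card_eq_fintype_card, Fintype.card_fin] at hge hle
  refine (SimpleGraph.isTree_iff_connected_and_card.2 ⟨hc, ?_⟩).isAcyclic
  simp only [Nat.card_eq_fintype_card, Fintype.card_fin]
  omega

theorem OrdConn.comap_castSucc {F : SimpleGraph (Fin (m + 1 + 1))} (hF : OrdConn F) :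
    OrdConn (F.comap Fin.castSucc : SimpleGraph (Fin (m + 1))) := by
  intro i hi
  obtain ⟨j, hj, hadj⟩ := hF i.castSucc (by simpa using hi)
  have hj' : j ≠ Fin.last _ := (hj.trans (Fin.castSucc_lt_last i)).ne
  refine ⟨j.castPred hj', ?_, ?_⟩
  · rwa [← Fin.castSucc_lt_castSucc_iff, Fin.castSucc_castPred]
  · simpa using hadj

theorem UniqueParent.comap_castSucc {F : SimpleGraph (Fin (m + 1 + 1))} (hF : UniqueParent F) :
    UniqueParent (F.comap Fin.castSucc : SimpleGraph (Fin (m + 1))) := by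
  intro i j j' hj hj' h h'
  exact Fin.castSucc_injective _ (hF i.castSucc j.castSucc j'.castSucc (by simpa using hj)
    (by simpa using hj') h h')

/-- The last node of an ordered graph is attached to some node. -/
theorem OrdConn.exists_adj_last {F : SimpleGraph (Fin (m + 1 + 1))} (hF : OrdConn F) :
    ∃ u : Fin (m + 1), F.Adj u.castSucc (Fin.last _) := by
  obtain ⟨j, hj, hadj⟩ := hF (Fin.last _) (by simp [Fin.ext_iff])
  exact ⟨j.castPred hj.ne, by simpa using hadj⟩

theorem UniqueParent.adj_last_iff {F : SimpleGraph (Fin (m + 1 + 1))} (hF : UniqueParent F)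
    {u : Fin (m + 1)} (hu : F.Adj u.castSucc (Fin.last _)) (v : Fin (m + 1)) :
    F.Adj v.castSucc (Fin.last _) ↔ v = u := by
  refine ⟨fun h => ?_, fun h => h ▸ hu⟩
  exact Fin.castSucc_injective _
    (hF _ _ _ (Fin.castSucc_lt_last _) (Fin.castSucc_lt_last _) h hu)

/-- A connected graph has a connected ordering that starts at a given node. -/
theorem exists_ordConn {U : Type*} [Fintype U] (F : SimpleGraph U) (hF : F.Connected) (r : U)
    (hc : Fintype.card U = m + 1) :
    ∃ φ : U ≃ Fin (m + 1), φ r = 0 ∧ OrdConn (F.comap φ.symm) := by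
  classical
  let e := Fintype.equivFinOfCardEq hc
  -- Nodes are sorted by distance from `r`: the next node on a shortest path to `r` is strictly
  -- closer, hence earlier.
  let f : Fin (m + 1) → ℕ := fun i => F.dist r (e.symm i)
  let σ := Tuple.sort f
  have hσ : Monotone (f ∘ σ) := Tuple.monotone_sort f
  let φ : U ≃ Fin (m + 1) := e.trans σ.symm
  have hφ : ∀ i, f (σ i) = F.dist r (φ.symm i) := fun i => rfl
  have hr : φ r = 0 := by
    have h0 : f (σ 0) ≤ f (σ (φ r)) := hσ (Fin.zero_le _)
    rw [hφ, hφ, Equiv.symm_apply_apply, SimpleGraph.dist_self, Nat.le_zero,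
      hF.dist_eq_zero_iff] at h0
    rw [h0, Equiv.apply_symm_apply]
  refine ⟨φ, hr, fun i hi => ?_⟩
  have hne : r ≠ φ.symm i := by
    rintro h
    apply hi
    rw [← hr, h, Equiv.apply_symm_apply]
  obtain ⟨w, hadj, hlt⟩ : ∃ w, F.Adj (φ.symm i) w ∧ F.dist r w < F.dist r (φ.symm i) := by
    generalize φ.symm i = x at hne
    obtain ⟨p, hp⟩ := hF.exists_walk_length_eq_dist x r
    cases p with
    | nil => exact absurd rfl hne
    | @cons _ w _ hadj q =>
      refine ⟨w, hadj, ?_⟩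
      rw [SimpleGraph.dist_comm, SimpleGraph.dist_comm (v := x), ← hp,
        SimpleGraph.Walk.length_cons]
      exact Nat.lt_succ_of_le (SimpleGraph.dist_le q)
  refine ⟨φ w, ?_, ?_⟩
  · by_contra! hle
    have := hσ hle
    simp only [Function.comp_apply, hφ, Equiv.symm_apply_apply] at this
    omega
  · simpa using hadj.symm

end Ordered

/-! ### Adding a leaf -/

section Leaf

variable {V : Type*} [Fintype V] {G : SimpleGraph V} {m : ℕ}

open Classical in
-- The leaf may be sent to any neighbour of `g u` outside the image of `g`; the neighbours inside
-- the image are what the second sum records.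
theorem card_injMaps_add_leaf {F : SimpleGraph (Fin (m + 1 + 1))} (hF : UniqueParent F)
    {F' : SimpleGraph (Fin (m + 1))} (hF' : F' = F.comap Fin.castSucc) {u : Fin (m + 1)} (hu : F.Adj u.castSucc (Fin.last _)) :
    (injMaps F G).card + ∑ u' : Fin (m + 1),
        ((injMaps F' G).filter fun g => G.Adj (g u) (g u')).card =
      ∑ g ∈ injMaps F' G, G.degree (g u) := by
  subst hF'
  set F' : SimpleGraph (Fin (m + 1)) := F.comap Fin.castSucc with hF'
  have hmaps : ∀ f ∈ injMaps F G, (Fin.init f : Fin (m + 1) → V) ∈ injMaps F' G := by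
    intro f hf
    obtain ⟨h1, h2⟩ := mem_injMaps.1 hf
    exact mem_injMaps.2 ⟨fun a b h => Fin.castSucc_injective _ (h1 h), fun a b h => h2 _ _ h⟩
  rw [Finset.card_eq_sum_card_fiberwise hmaps]
  simp_rw [Finset.card_filter (fun g : Fin (m + 1) → V => G.Adj (g u) (g _))]
  rw [Finset.sum_comm, ← Finset.sum_add_distrib]
  refine Finset.sum_congr rfl fun g hg => ?_
  obtain ⟨hg1, hg2⟩ := mem_injMaps.1 hg
  have h1 : ((injMaps F G).filter fun f => (Fin.init f : Fin (m + 1) → V) = g).card =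
      ((G.neighborFinset (g u)).filter fun w => w ∉ Set.range g).card := by
    refine Finset.card_bij (fun f _ => f (Fin.last _)) ?_ ?_ ?_
    · intro f hf
      simp only [Finset.mem_filter] at hf
      obtain ⟨hf, hfg⟩ := hf
      obtain ⟨h1, h2⟩ := mem_injMaps.1 hf
      simp only [Finset.mem_filter, SimpleGraph.mem_neighborFinset]
      rw [← hfg]
      refine ⟨h2 _ _ hu, ?_⟩
      rintro ⟨i, hi⟩
      exact (Fin.castSucc_lt_last i).ne (h1 hi)
    · intro f hf f' hf' h
      simp only [Finset.mem_filter] at hf hf'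
      rw [← Fin.snoc_init_self f, ← Fin.snoc_init_self f', hf.2, hf'.2, h]
    · intro w hw
      simp only [Finset.mem_filter, SimpleGraph.mem_neighborFinset] at hw
      obtain ⟨hw1, hw2⟩ := hw
      have hmem : (Fin.snoc g w : Fin (m + 1 + 1) → V) ∈ injMaps F G := ?_
      · refine ⟨Fin.snoc g w, ?_, by simp⟩
        simp only [Finset.mem_filter]
        exact ⟨hmem, by simp⟩
      refine mem_injMaps.2 ⟨?_, ?_⟩
      · exact Fin.snoc_injective_iff.2 ⟨hg1, hw2⟩
      · intro a b
        refine Fin.lastCases ?_ (fun a => ?_) a <;> refine Fin.lastCases ?_ (fun b => ?_) b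
        · intro h; exact absurd rfl h.ne
        · intro h
          obtain rfl := (hF.adj_last_iff hu b).1 h.symm
          simpa using hw1.symm
        · intro h
          obtain rfl := (hF.adj_last_iff hu a).1 h
          simpa using hw1
        · intro h
          simpa using hg2 a b h
  have h2 : (∑ i : Fin (m + 1), if G.Adj (g u) (g i) then 1 else 0) =
      ((G.neighborFinset (g u)).filter fun w => ¬ w ∉ Set.range g).card := by
    rw [← Finset.card_filter]
    refine Finset.card_bij (fun i _ => g i) ?_ (fun i _ j _ h => hg1 h) ?_
    · intro i hi
      refine Finset.mem_filter.2 ⟨(SimpleGraph.mem_neighborFinset _ _ _).2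
        (Finset.mem_filter.1 hi).2, ?_⟩
      simp
    · intro w hw
      obtain ⟨hw1, hw2⟩ := Finset.mem_filter.1 hw
      obtain ⟨i, rfl⟩ := not_not.1 hw2
      exact ⟨i, Finset.mem_filter.2 ⟨Finset.mem_univ _,
        (SimpleGraph.mem_neighborFinset _ _ _).1 hw1⟩, rfl⟩
  rw [h1, h2, Finset.card_filter_add_card_filter_not, SimpleGraph.card_neighborFinset_eq_degree]

open Classical in
-- Demanding one more adjacency amounts to adding an edge to `F`. When `F` is connected and the edge
-- is new this creates a cycle, so such terms will vanish in the limit.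
theorem card_filter_injMaps_adj {U : Type*} [Fintype U] {F : SimpleGraph U} {u u' : U} :
    ((injMaps F G).filter fun g => G.Adj (g u) (g u')).card =
      if F.Adj u u' then (injMaps F G).card else if u = u' then 0 else
        (injMaps (F ⊔ SimpleGraph.edge u u') G).card := by
  split_ifs with h1 h2
  · rw [Finset.filter_true_of_mem]
    intro g hg
    exact (mem_injMaps.1 hg).2 _ _ h1
  · subst h2
    simp
  · congr 1
    ext g
    simp only [Finset.mem_filter, mem_injMaps, SimpleGraph.sup_adj, SimpleGraph.edge_adj]
    constructor
    · rintro ⟨⟨hi, hadj⟩, h⟩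
      refine ⟨hi, fun a b hab => ?_⟩
      rcases hab with hab | ⟨⟨rfl, rfl⟩ | ⟨rfl, rfl⟩, -⟩
      · exact hadj _ _ hab
      · exact h
      · exact h.symm
    · rintro ⟨hi, h⟩
      exact ⟨⟨hi, fun a b hab => h _ _ (Or.inl hab)⟩, h _ _ (Or.inr ⟨Or.inl ⟨rfl, rfl⟩, h2⟩)⟩

/-- Adding an edge to a connected graph creates a cycle. -/
theorem not_isAcyclic_sup_edge {U : Type*} {F : SimpleGraph U} (hF : F.Connected) {u u' : U}
    (h : ¬ F.Adj u u') (hne : u ≠ u') : ¬ (F ⊔ SimpleGraph.edge u u').IsAcyclic := by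
  intro hac
  have hadj : (F ⊔ SimpleGraph.edge u u').Adj u u' :=
    Or.inr ((SimpleGraph.edge_adj ..).2 ⟨Or.inl ⟨rfl, rfl⟩, hne⟩)
  have hb := (SimpleGraph.isAcyclic_iff_forall_isBridge.1 hac) (e := s(u, u')) hadj
  rw [SimpleGraph.isBridge_iff] at hb
  refine hb ((hF.preconnected u u').mono ?_)
  intro a b hab
  rw [SimpleGraph.deleteEdges_adj]
  refine ⟨Or.inl hab, ?_⟩
  simp only [Set.mem_singleton_iff, Sym2.eq_iff]
  rintro (⟨rfl, rfl⟩ | ⟨rfl, rfl⟩)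
  · exact h hab
  · exact h hab.symm

end Leaf

/-! ### Injective densities along a sequence -/

/-- The number of injective homomorphisms, normalized as the homomorphism density. -/
noncomputable def injRatio {U V : Type*} [Fintype U] [Fintype V]
    (F : SimpleGraph U) (G : SimpleGraph V) (d : ℝ) : ℝ :=
  ((injMaps F G).card : ℝ) / ((Fintype.card V : ℝ) * d ^ (Fintype.card U - 1))

section Sequences

variable {U V : Type*} [Fintype U] [Fintype V] {F : SimpleGraph U} {G : SimpleGraph V} {d : ℝ}

theorem injRatio_nonneg (hd : 0 ≤ d) : 0 ≤ injRatio F G d := by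
  unfold injRatio; positivity

open Classical in
theorem IsAdmissible.degree_le_floor (h : IsAdmissible G d) (v : V) : G.degree v ≤ ⌊d⌋₊ :=
  Nat.le_floor (by convert h.2 v)

theorem IsAdmissible.floor_le (h : IsAdmissible G d) : (⌊d⌋₊ : ℝ) ≤ d :=
  Nat.floor_le (by linarith [h.1])

/-- Injective homomorphisms of a connected graph that send a node into a given set. -/
theorem card_filter_mem_div_le [DecidableEq V] (hF : F.Connected) [Nonempty V]
    (h : IsAdmissible G d) (u : U) (B : Finset V) :
    (((injMaps F G).filter fun f => f u ∈ B).card : ℝ) /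
      ((Fintype.card V : ℝ) * d ^ (Fintype.card U - 1)) ≤ B.card / Fintype.card V := by
  classical
  have hd : 0 < d := by linarith [h.1]
  have hV : (0 : ℝ) < Fintype.card V := by exact_mod_cast Fintype.card_pos
  have h1 := card_filter_mem_le hF h.degree_le_floor (u := u) (B := B)
    (S := (injMaps F G).filter fun f => f u ∈ B)
    ((Finset.filter_subset _ _).trans injMaps_subset_homMaps)
    (fun f hf => (Finset.mem_filter.1 hf).2)
  have h2 : (((injMaps F G).filter fun f => f u ∈ B).card : ℝ) ≤
      B.card * d ^ (Fintype.card U - 1) := by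
    refine (Nat.cast_le.2 h1).trans ?_
    push_cast
    gcongr
    exact h.floor_le
  rw [div_le_div_iff₀ (by positivity) hV]
  calc _ ≤ (B.card * d ^ (Fintype.card U - 1)) * (Fintype.card V : ℝ) := by gcongr
    _ = _ := by ring

theorem injRatio_le_one (hF : F.Connected) [Nonempty V] (h : IsAdmissible G d) :
    injRatio F G d ≤ 1 := by
  classical
  have hV : (0 : ℝ) < Fintype.card V := by exact_mod_cast Fintype.card_pos
  obtain ⟨u⟩ := hF.nonempty
  have := card_filter_mem_div_le hF h u Finset.univ
  simp only [Finset.mem_univ, Finset.filter_true, Finset.card_univ, div_self hV.ne'] at this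
  exact this

/-- Each node outside the image of `C` costs a factor of at most `d`, which is what the
normalization pays for it. -/
theorem injRatio_le_of_subgraph (hF : F.Connected) [Nonempty V] (h : IsAdmissible G d)
    {T : Type*} [Fintype T] [Nonempty T] {C : SimpleGraph T} (i : C →g F)
    (hi : Function.Injective i) : injRatio F G d ≤ injRatio C G d := by
  classical
  have hd : 0 < d := by linarith [h.1]
  have hV : (0 : ℝ) < Fintype.card V := by exact_mod_cast Fintype.card_pos
  have h1 := card_injMaps_le_of_subgraph hF h.degree_le_floor i hi
  have h2 : ((injMaps F G).card : ℝ) ≤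
      (injMaps C G).card * d ^ (Fintype.card U - Fintype.card T) := by
    refine (Nat.cast_le.2 h1).trans ?_
    push_cast
    gcongr
    exact h.floor_le
  have hle := Fintype.card_le_of_injective i hi
  have hT : 0 < Fintype.card T := Fintype.card_pos
  unfold injRatio
  rw [div_le_div_iff₀ (by positivity) (by positivity)]
  calc _ ≤ ((injMaps C G).card * d ^ (Fintype.card U - Fintype.card T)) *
        (Fintype.card V * d ^ (Fintype.card T - 1)) := by gcongr
    _ = (injMaps C G).card * (Fintype.card V *
        d ^ ((Fintype.card U - Fintype.card T) + (Fintype.card T - 1))) := by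
          rw [pow_add]; ring
    _ = _ := by
      congr 3
      omega

theorem injRatio_cycle_le [Nonempty V] (h : IsAdmissible G d) {k : ℕ} (hk : 3 ≤ k) :
    injRatio (SimpleGraph.cycleGraph k) G d ≤ injDensity (SimpleGraph.cycleGraph k) G d := by
  classical
  have hV : (0 : ℝ) < Fintype.card V := by exact_mod_cast Fintype.card_pos
  unfold injRatio injDensity
  rw [card_injMaps]
  -- For `d = 1` the right side is a division by zero, hence `0`. The left side vanishes as well,
  -- since an injective cycle needs a node with two neighbours.
  rcases h.1.eq_or_lt with h1 | h1
  · have : (Nat.card {f : SimpleGraph.cycleGraph k →g G // Function.Injective f}) = 0 := by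
      rw [← card_injMaps, Finset.card_eq_zero, Finset.eq_empty_iff_forall_notMem]
      intro f hf
      obtain ⟨hf1, hf2⟩ := mem_injMaps.1 hf
      obtain ⟨n, rfl⟩ : ∃ n, k = n + 3 := ⟨k - 3, by omega⟩
      have hdeg := h.degree_le_floor (f 0)
      rw [← h1, Nat.floor_one, ← SimpleGraph.card_neighborFinset_eq_degree] at hdeg
      have := Finset.card_le_one.1 hdeg (f 1)
        ((SimpleGraph.mem_neighborFinset _ _ _).2 (hf2 _ _ (by
          rw [SimpleGraph.cycleGraph_adj]; right; simp))) (f (-1))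
        ((SimpleGraph.mem_neighborFinset _ _ _).2 (hf2 _ _ (by
          rw [SimpleGraph.cycleGraph_adj]; left; simp)))
      have h3 := hf1 this
      rw [Fin.ext_iff] at h3
      simp [Fin.val_neg] at h3
    rw [this]
    simp
  · have h2 : (0 : ℝ) < d - 1 := by linarith
    have hd : 0 < d := by linarith
    simp only [Fintype.card_fin]
    have e : k - 1 = (k - 2) + 1 := by omega
    rw [e, pow_succ, mul_comm (d ^ (k - 2)), ← mul_assoc]
    gcongr
    linarith

end Sequences

/-! ### Asymptotics of injective counts. -/

section Limits

variable {V : ℕ → Type*} [∀ n, Fintype (V n)] [∀ n, Nonempty (V n)] {G : ∀ n, SimpleGraph (V n)}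
  {d : ℕ → ℝ} {α : ℝ}

/-- Such an `F` contains a copy of some `C_k`, whose normalized count dominates that of `F` and
tends to `0`. -/
theorem tendsto_injRatio_of_not_isAcyclic (hadm : ∀ n, IsAdmissible (G n) (d n))
    (hgirth : HasLargeEssentialGirth G d) {U : Type*} [Fintype U] {F : SimpleGraph U}
    (hF : F.Connected) (hac : ¬ F.IsAcyclic) :
    Tendsto (fun n => injRatio F (G n) (d n)) atTop (𝓝 0) := by
  rw [SimpleGraph.isAcyclic_iff_free_cycleGraph] at hac
  push Not at hac
  obtain ⟨k, hk, hfree⟩ := hac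
  obtain ⟨c⟩ := hfree
  have : Nonempty (Fin k) := ⟨⟨0, by omega⟩⟩
  refine squeeze_zero (fun n => injRatio_nonneg (by linarith [(hadm n).1]))
    (fun n => ?_) (hgirth k hk)
  exact (injRatio_le_of_subgraph hF (hadm n) c.toHom c.injective).trans
    (injRatio_cycle_le (hadm n) hk)

open Classical in
-- The nodes of atypical degree form a set `B` of vanishing proportion, and the maps sending `u`
-- into `B` have normalized number at most `|B| / v`. For all other maps the summand is at most `ε /
-- 2` in absolute value.
theorem tendsto_sum_degree_sub (hadm : ∀ n, IsAdmissible (G n) (d n)) (hα₀ : 0 ≤ α) (hα₁ : α ≤ 1)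
    (hreg : IsRegularSeq G d α) {U : Type*} [Fintype U] {F : SimpleGraph U}
    (hF : F.Connected) (u : U) :
    Tendsto (fun n => (∑ g ∈ injMaps F (G n), (((G n).degree (g u) : ℝ) / d n - α)) /
      ((Fintype.card (V n) : ℝ) * d n ^ (Fintype.card U - 1))) atTop (𝓝 0) := by
  rw [Metric.tendsto_atTop]
  intro ε hε
  have h1 := hreg (ε / 2) (by linarith)
  rw [Metric.tendsto_atTop] at h1
  obtain ⟨N, hN⟩ := h1 (ε / 2) (by linarith)
  refine ⟨N, fun n hn => ?_⟩
  have hb := hN n hn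
  have hd : 0 < d n := by linarith [(hadm n).1]
  have hV : (0 : ℝ) < Fintype.card (V n) := by exact_mod_cast Fintype.card_pos
  set B := Finset.univ.filter (fun v : V n => ε / 2 < |((G n).degree v : ℝ) / d n - α|) with hB
  rw [Real.dist_eq, sub_zero, abs_of_nonneg (by positivity)] at hb
  rw [Real.dist_eq, sub_zero, abs_div,
    abs_of_pos (a := (Fintype.card (V n) : ℝ) * d n ^ (Fintype.card U - 1)) (by positivity)]
  have hpt : ∀ g : U → V n, |((G n).degree (g u) : ℝ) / d n - α| ≤
      ε / 2 + if g u ∈ B then 1 else 0 := by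
    intro g
    split_ifs with h
    · have h2 : ((G n).degree (g u) : ℝ) / d n ≤ 1 := by
        rw [div_le_one hd]
        convert (hadm n).2 (g u)
      have h3 : 0 ≤ ((G n).degree (g u) : ℝ) / d n := by positivity
      rw [abs_le]
      constructor <;> linarith
    · have : ¬ ε / 2 < |((G n).degree (g u) : ℝ) / d n - α| := by
        intro h4
        exact h (Finset.mem_filter.2 ⟨Finset.mem_univ _, h4⟩)
      linarith
  have hsum : |∑ g ∈ injMaps F (G n), (((G n).degree (g u) : ℝ) / d n - α)| ≤
      ε / 2 * (injMaps F (G n)).card + ((injMaps F (G n)).filter fun f => f u ∈ B).card := by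
    refine (Finset.abs_sum_le_sum_abs _ _).trans ((Finset.sum_le_sum fun g _ => hpt g).trans ?_)
    rw [Finset.sum_add_distrib, Finset.sum_const, nsmul_eq_mul, ← Finset.sum_filter,
      Finset.sum_const, nsmul_eq_mul]
    linarith
  have h5 := card_filter_mem_div_le hF (hadm n) u B
  have h6 := injRatio_le_one hF (hadm n)
  unfold injRatio at h6
  calc _ ≤ (ε / 2 * (injMaps F (G n)).card + ((injMaps F (G n)).filter fun f => f u ∈ B).card) /
        ((Fintype.card (V n) : ℝ) * d n ^ (Fintype.card U - 1)) := by gcongr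
    _ ≤ ε / 2 * 1 + B.card / Fintype.card (V n) := by
        rw [add_div, mul_div_assoc]
        gcongr
    _ < ε := by linarith

open Classical in
/-- The effect of adding a leaf on the normalized number of injective homomorphisms. -/
theorem tendsto_injRatio_add_leaf (hadm : ∀ n, IsAdmissible (G n) (d n))
    (hα₀ : 0 ≤ α) (hα₁ : α ≤ 1) (hreg : IsRegularSeq G d α) (hgirth : HasLargeEssentialGirth G d)
    {m : ℕ} {F : SimpleGraph (Fin (m + 1 + 1))} (hF : OrdConn F) (hF' : UniqueParent F)
    {F₀ : SimpleGraph (Fin (m + 1))} (hF₀ : F₀ = F.comap Fin.castSucc) {u : Fin (m + 1)} (hu : F.Adj u.castSucc (Fin.last _)) :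
    Tendsto (fun n => injRatio F (G n) (d n) -
      injRatio F₀ (G n) (d n) * (α - (F₀.degree u : ℝ) / d n)) atTop (𝓝 0) := by
  have hconn : F₀.Connected := hF₀ ▸ hF.comap_castSucc.connected
  have hA := tendsto_sum_degree_sub hadm hα₀ hα₁ hreg hconn u
  -- The normalized number of maps with an accidental adjacency between the images of `u` and `u'`;
  -- the corresponding graph has a cycle.
  let b : Fin (m + 1) → ℕ → ℝ := fun u' n => if F₀.Adj u u' ∨ u = u' then 0 else
    injRatio (F₀ ⊔ SimpleGraph.edge u u') (G n) (d n) / d n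
  have hb : Tendsto (fun n => ∑ u', b u' n) atTop (𝓝 (∑ _u' : Fin (m + 1), 0)) := by
    refine tendsto_finsetSum _ fun u' _ => ?_
    simp only [b]
    split_ifs with h
    · exact tendsto_const_nhds
    · push Not at h
      have h1 := tendsto_injRatio_of_not_isAcyclic hadm hgirth
        (hconn.mono (le_sup_left : F₀ ≤ F₀ ⊔ SimpleGraph.edge u u'))
        (not_isAcyclic_sup_edge hconn h.1 h.2)
      refine squeeze_zero (fun n => ?_) (fun n => ?_) h1
      · exact div_nonneg (injRatio_nonneg (by linarith [(hadm n).1])) (by linarith [(hadm n).1])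
      · exact div_le_self (injRatio_nonneg (by linarith [(hadm n).1])) (hadm n).1
  have hlim := hA.sub hb
  simp only [Finset.sum_const_zero, sub_zero] at hlim
  refine hlim.congr fun n => ?_
  have hd : 0 < d n := by linarith [(hadm n).1]
  have hV : (0 : ℝ) < Fintype.card (V n) := by exact_mod_cast Fintype.card_pos
  have key := card_injMaps_add_leaf (G := G n) hF' hF₀ hu
  simp_rw [card_filter_injMaps_adj] at key
  have key' := congrArg (Nat.cast (R := ℝ)) key
  push_cast at key'
  -- Neighbours of `u` in `F₀` produce the correction `deg u`; the remaining nodes produce the error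
  -- terms `b`.
  have hsplit : (∑ u' : Fin (m + 1), (if F₀.Adj u u' then ((injMaps F₀ (G n)).card : ℝ) else
      if u = u' then 0 else ((injMaps (F₀ ⊔ SimpleGraph.edge u u') (G n)).card : ℝ))) =
      F₀.degree u * (injMaps F₀ (G n)).card +
        ∑ u', b u' n * ((Fintype.card (V n) : ℝ) * d n ^ (m + 1)) := by
    have : ((F₀.degree u : ℕ) : ℝ) * (injMaps F₀ (G n)).card =
        ∑ u' : Fin (m + 1), if F₀.Adj u u' then ((injMaps F₀ (G n)).card : ℝ) else 0 := by
      rw [← Finset.sum_filter, Finset.sum_const, nsmul_eq_mul,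
        ← SimpleGraph.card_neighborFinset_eq_degree, SimpleGraph.neighborFinset_eq_filter]
    rw [this, ← Finset.sum_add_distrib]
    refine Finset.sum_congr rfl fun u' _ => ?_
    simp only [b, injRatio, Fintype.card_fin, Nat.add_sub_cancel]
    by_cases h1 : F₀.Adj u u'
    · simp [h1]
    · by_cases h2 : u = u'
      · simp [h2]
      · simp only [h1, h2, if_false, or_self]
        field_simp
        ring
  rw [hsplit, ← Finset.sum_mul] at key'
  have hsum : ∑ g ∈ injMaps F₀ (G n), (((G n).degree (g u) : ℝ) / d n - α) =
      (∑ g ∈ injMaps F₀ (G n), ((G n).degree (g u) : ℝ)) / d n - (injMaps F₀ (G n)).card * α := by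
    rw [Finset.sum_sub_distrib, Finset.sum_div, Finset.sum_const, nsmul_eq_mul]
  rw [hsum, ← key']
  simp only [injRatio, Fintype.card_fin, Nat.add_sub_cancel]
  field_simp
  ring

end Limits

/-! ### Homomorphisms with a given kernel -/

section Kernel

variable {U : Type*} (F : SimpleGraph U) (s : Setoid U)

/-- The quotient of a graph by an equivalence relation on its nodes. -/
def quotGraph : SimpleGraph (Quotient s) :=
  SimpleGraph.fromRel fun a b => ∃ u v, (Quotient.mk s u) = a ∧ (Quotient.mk s v) = b ∧ F.Adj u v

/-- Adjacent nodes are inequivalent. -/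
def IsProper : Prop := ∀ u v, F.Adj u v → ¬ s u v

variable {F s}

theorem IsProper.quotGraph_adj (hs : IsProper F s) {u v : U} (h : F.Adj u v) :
    (quotGraph F s).Adj (Quotient.mk s u) (Quotient.mk s v) := by
  rw [quotGraph, SimpleGraph.fromRel_adj]
  exact ⟨fun h' => hs u v h (Quotient.exact h'), Or.inl ⟨u, v, rfl, rfl, h⟩⟩

theorem exists_of_quotGraph_adj {a b : Quotient s} (h : (quotGraph F s).Adj a b) :
    ∃ u v, Quotient.mk s u = a ∧ Quotient.mk s v = b ∧ F.Adj u v := by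
  rw [quotGraph, SimpleGraph.fromRel_adj] at h
  rcases h with ⟨-, h | ⟨u, v, h1, h2, h3⟩⟩
  · exact h
  · exact ⟨v, u, h2, h1, h3.symm⟩

theorem IsProper.connected (hs : IsProper F s) (hF : F.Connected) :
    (quotGraph F s).Connected := by
  let f : F →g quotGraph F s := ⟨Quotient.mk s, fun h => hs.quotGraph_adj h⟩
  exact hF.map f Quotient.exists_rep

/-- Homomorphisms with kernel `s` are the injective homomorphisms of the quotient by `s`. -/
def IsProper.kerEquiv (hs : IsProper F s) {V : Type*} (H : SimpleGraph V) :
    {f : U → V // (∀ a b, F.Adj a b → H.Adj (f a) (f b)) ∧ Setoid.ker f = s} ≃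
    {g : Quotient s → V // Function.Injective g ∧
      ∀ a b, (quotGraph F s).Adj a b → H.Adj (g a) (g b)} where
  toFun f := ⟨Quotient.lift f.1 fun a b (h : s a b) => by
      rw [← f.2.2] at h; exact h, by
    constructor
    · intro a b
      induction a using Quotient.ind
      induction b using Quotient.ind
      intro h
      refine Quotient.sound ?_
      have h' : Setoid.ker f.1 _ _ := h
      rwa [f.2.2] at h'
    · intro a b h
      obtain ⟨u, v, rfl, rfl, h'⟩ := exists_of_quotGraph_adj h
      exact f.2.1 u v h'⟩
  invFun g := ⟨fun u => g.1 (Quotient.mk s u), fun a b h => g.2.2 _ _ (hs.quotGraph_adj h), by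
    ext a b
    exact ⟨fun h => Quotient.exact (g.2.1 h), fun h => congrArg g.1 (Quotient.sound h)⟩⟩
  left_inv f := rfl
  right_inv g := by
    ext a
    induction a using Quotient.ind
    rfl

theorem ker_isProper {V : Type*} {H : SimpleGraph V} {f : U → V}
    (hf : ∀ a b, F.Adj a b → H.Adj (f a) (f b)) : IsProper F (Setoid.ker f) :=
  fun u v h h' => (hf u v h).ne h'

instance Setoid.finite_of_finite [Finite U] : Finite (Setoid U) :=
  Finite.of_injective (fun s : Setoid U => fun a b => s a b) fun s t h => by
    ext a b
    exact iff_of_eq (congrFun (congrFun h a) b)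

noncomputable instance Setoid.fintypeOfFinite [Finite U] : Fintype (Setoid U) :=
  Fintype.ofFinite _

noncomputable instance Quotient.fintypeOfFintype [Fintype U] : Fintype (Quotient s) :=
  Fintype.ofFinite _

theorem bot_isProper : IsProper F ⊥ := fun _ _ h h' => h.ne h'

theorem card_quotient_lt [Fintype U] (hs : s ≠ ⊥) :
    Fintype.card (Quotient s) < Fintype.card U := by
  refine Fintype.card_lt_of_surjective_not_injective (Quotient.mk s) Quotient.exists_rep ?_
  intro hinj
  apply hs
  ext a b
  exact ⟨fun h => hinj (Quotient.sound h), fun h => by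
    have : a = b := h
    rw [this]⟩

variable (F) in
/-- The quotient by the trivial relation. -/
def quotGraphBotIso : F ≃g quotGraph F ⊥ where
  toEquiv := ⟨Quotient.mk ⊥, Quotient.lift id fun _ _ h => h, fun _ => rfl, fun a => by
    induction a using Quotient.ind; rfl⟩
  map_rel_iff' {a b} := by
    refine ⟨fun h => ?_, fun h => bot_isProper.quotGraph_adj h⟩
    obtain ⟨u, v, h1, h2, h⟩ := exists_of_quotGraph_adj h
    have h1' : u = a := Quotient.exact h1
    have h2' : v = b := Quotient.exact h2
    rwa [← h1', ← h2']

end Kernel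

section

variable {U V : Type*} [Fintype U] [Fintype V] {F : SimpleGraph U} {G : SimpleGraph V} {d : ℝ}

open Classical in
-- A map is the quotient by its kernel followed by an injection. Adjacent nodes have distinct
-- images, so only proper kernels occur.
theorem card_homMaps_eq_sum : (homMaps F G).card =
    ∑ s : Setoid U, if IsProper F s then (injMaps (quotGraph F s) G).card else 0 := by
  rw [Finset.card_eq_sum_card_fiberwise (f := fun f => Setoid.ker f) (t := Finset.univ)
    (fun _ _ => Finset.mem_coe.2 (Finset.mem_univ _))]
  refine Finset.sum_congr rfl fun s _ => ?_
  split_ifs with hs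
  · rw [← Fintype.card_coe, ← Fintype.card_coe, ← Nat.card_eq_fintype_card,
      ← Nat.card_eq_fintype_card]
    refine Nat.card_congr (((Equiv.subtypeEquivRight fun f => ?_).trans (hs.kerEquiv G)).trans
      (Equiv.subtypeEquivRight fun g => ?_))
    · simp only [Finset.mem_filter, mem_homMaps]
    · rw [mem_injMaps]
  · rw [Finset.card_eq_zero, Finset.eq_empty_iff_forall_notMem]
    intro f hf
    obtain ⟨hf', rfl⟩ := Finset.mem_filter.1 hf
    exact hs (ker_isProper (mem_homMaps.1 hf'))

theorem injRatio_congr {U' : Type*} [Fintype U'] {F' : SimpleGraph U'} (e : F ≃g F') :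
    injRatio F G d = injRatio F' G d := by
  unfold injRatio
  rw [Fintype.card_congr e.toEquiv, card_injMaps, card_injMaps]
  congr 2
  refine Nat.card_congr ⟨fun f => ⟨f.1.comp e.symm.toHom, f.2.comp e.symm.injective⟩,
    fun f => ⟨f.1.comp e.toHom, f.2.comp e.injective⟩, fun f => ?_, fun f => ?_⟩
  · ext x; simp
  · ext x; simp

end

/-! ### From injective counts to homomorphism densities. -/

section Limits

variable {V : ℕ → Type*} [∀ n, Fintype (V n)] [∀ n, Nonempty (V n)] {G : ∀ n, SimpleGraph (V n)}
  {d : ℕ → ℝ} {α : ℝ}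

open Classical in
/-- Convergence of homomorphism densities follows from the convergence of the normalized numbers
of injective homomorphisms of the quotients. -/
theorem tendsto_homDensity_of_injRatio (hadm : ∀ n, IsAdmissible (G n) (d n)) {δ : ℝ}
    (hδ : Tendsto (fun n => 1 / d n) atTop (𝓝 δ)) {U : Type*} [Fintype U] {F : SimpleGraph U}
    (hF : F.Connected) {c : Setoid U → ℝ} (hc : ∀ s, IsProper F s →
      Tendsto (fun n => injRatio (quotGraph F s) (G n) (d n)) atTop (𝓝 (c s))) :
    Tendsto (fun n => homDensity F (G n) (d n)) atTop
      (𝓝 (∑ s : Setoid U, if IsProper F s then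
        c s * δ ^ (Fintype.card U - Fintype.card (Quotient s)) else 0)) := by
  have hlim : Tendsto (fun n => ∑ s : Setoid U, if IsProper F s then
      injRatio (quotGraph F s) (G n) (d n) *
        (1 / d n) ^ (Fintype.card U - Fintype.card (Quotient s)) else 0) atTop
      (𝓝 (∑ s : Setoid U, if IsProper F s then
        c s * δ ^ (Fintype.card U - Fintype.card (Quotient s)) else 0)) := by
    refine tendsto_finsetSum _ fun s _ => ?_
    split_ifs with hs
    · exact (hc s hs).mul (hδ.pow _)
    · exact tendsto_const_nhds
  refine hlim.congr fun n => ?_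
  have hd : 0 < d n := by linarith [(hadm n).1]
  have hV : (0 : ℝ) < Fintype.card (V n) := by exact_mod_cast Fintype.card_pos
  have := hF.nonempty
  unfold homDensity
  rw [← card_homMaps, card_homMaps_eq_sum]
  push_cast
  rw [Finset.sum_div]
  refine Finset.sum_congr rfl fun s _ => ?_
  split_ifs with hs
  · unfold injRatio
    have h1 : Fintype.card (Quotient s) ≤ Fintype.card U :=
      Fintype.card_le_of_surjective (Quotient.mk s) Quotient.exists_rep
    have h2 : 0 < Fintype.card (Quotient s) := Fintype.card_pos_iff.2 (hs.connected hF).nonempty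
    -- Every node lost in the quotient leaves one factor `1 / d n` over.
    have h3 : Fintype.card U - 1 = (Fintype.card (Quotient s) - 1) +
      (Fintype.card U - Fintype.card (Quotient s)) := by omega
    rw [h3, pow_add, one_div, inv_pow]
    field_simp
  · simp

theorem injRatio_single {n : ℕ} (F : SimpleGraph (Fin 1)) :
    injRatio F (G n) (d n) = 1 := by
  have h : injMaps F (G n) = Finset.univ := by
    ext f
    rw [mem_injMaps]
    simp only [Finset.mem_univ, iff_true]
    exact ⟨Function.injective_of_subsingleton f, fun a b h =>
      absurd (Subsingleton.elim a b) h.ne⟩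
  have hV : (0 : ℝ) < Fintype.card (V n) := by exact_mod_cast Fintype.card_pos
  unfold injRatio
  rw [h]
  simp [hV.ne']

open Classical in
-- A tree is built leaf by leaf. The correction `deg u / d n` disappears in the limit, so each leaf
-- contributes a factor `α`.
theorem tendsto_injRatio_of_tendsto_zero (hadm : ∀ n, IsAdmissible (G n) (d n))
    (hα₀ : 0 ≤ α) (hα₁ : α ≤ 1) (hreg : IsRegularSeq G d α) (hgirth : HasLargeEssentialGirth G d)
    (hδ : Tendsto (fun n => 1 / d n) atTop (𝓝 0)) {m : ℕ} (F : SimpleGraph (Fin (m + 1)))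
    (hF : OrdConn F) : Tendsto (fun n => injRatio F (G n) (d n)) atTop
      (𝓝 (if F.IsAcyclic then α ^ m else 0)) := by
  split_ifs with hac
  · induction m with
    | zero =>
      simp_rw [injRatio_single F, pow_zero]
      exact tendsto_const_nhds
    | succ m ih =>
      obtain ⟨u, hu⟩ := hF.exists_adj_last
      have h1 := tendsto_injRatio_add_leaf hadm hα₀ hα₁ hreg hgirth hF (hF.uniqueParent hac) rfl hu
      have h2 := ih _ hF.comap_castSucc (hF.comap_castSucc.isAcyclic
        (hF.uniqueParent hac).comap_castSucc)
      have h3 := h1.add (h2.mul ((tendsto_const_nhds (x := α)).sub (hδ.const_mul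
        (((F.comap Fin.castSucc : SimpleGraph (Fin (m + 1))).degree u : ℕ) : ℝ))))
      simp only [mul_zero, sub_zero, zero_add, mul_one_div] at h3
      rw [pow_succ]
      refine h3.congr fun n => ?_
      convert sub_add_cancel _ _
  · exact tendsto_injRatio_of_not_isAcyclic hadm hgirth hF.connected hac

open Classical in
-- Nontrivial kernels carry a positive power of `1 / d n`, so only the injective homomorphisms
-- survive.
theorem tendsto_homDensity_of_tendsto_zero (hadm : ∀ n, IsAdmissible (G n) (d n))
    (hα₀ : 0 ≤ α) (hα₁ : α ≤ 1) (hreg : IsRegularSeq G d α) (hgirth : HasLargeEssentialGirth G d)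
    (hδ : Tendsto (fun n => 1 / d n) atTop (𝓝 0)) {U : Type*} [Fintype U] {F : SimpleGraph U}
    (hF : F.Connected) : Tendsto (fun n => homDensity F (G n) (d n)) atTop
      (𝓝 (if F.IsAcyclic then α ^ (Fintype.card U - 1) else 0)) := by
  have key : ∀ {T : Type _} [Fintype T] {F : SimpleGraph T} (hF : F.Connected),
      Tendsto (fun n => injRatio F (G n) (d n)) atTop
        (𝓝 (if F.IsAcyclic then α ^ (Fintype.card T - 1) else 0)) := by
    intro T _ F hF
    obtain ⟨r⟩ := hF.nonempty
    have hc : Fintype.card T = (Fintype.card T - 1) + 1 :=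
      (Nat.sub_add_cancel (Fintype.card_pos_iff.2 ⟨r⟩)).symm
    obtain ⟨φ, -, hφ⟩ := exists_ordConn F hF r hc
    have h1 := tendsto_injRatio_of_tendsto_zero hadm hα₀ hα₁ hreg hgirth hδ _ hφ
    have e : F.comap φ.symm ≃g F := ⟨φ.symm, Iff.rfl⟩
    simp_rw [injRatio_congr e] at h1
    rwa [e.isAcyclic_iff] at h1
  have h := tendsto_homDensity_of_injRatio hadm hδ hF (c := fun s =>
    if (quotGraph F s).IsAcyclic then α ^ (Fintype.card (Quotient s) - 1) else 0)
    (fun s hs => key (hs.connected hF))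
  rw [Finset.sum_eq_single ⊥] at h
  · rw [if_pos bot_isProper, ← Fintype.card_congr (quotGraphBotIso F).toEquiv, Nat.sub_self,
      pow_zero, mul_one, ← (quotGraphBotIso F).isAcyclic_iff] at h
    exact h
  · intro s _ hs
    have := card_quotient_lt hs
    split_ifs <;> simp [(Nat.sub_pos_of_lt this).ne']
  · intro h
    exact absurd (Finset.mem_univ _) h

end Limits

/-! ### Sparsity from the scarcity of 4-cycles. -/

section Dense

theorem pathGraph_three_isAcyclic : (SimpleGraph.pathGraph 3).IsAcyclic := by
  have h1 : OrdConn (SimpleGraph.pathGraph 3) := by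
    unfold OrdConn
    simp only [SimpleGraph.pathGraph_adj]
    decide
  refine h1.isAcyclic ?_
  unfold UniqueParent
  simp only [SimpleGraph.pathGraph_adj]
  decide

theorem cycleGraph_four_not_isAcyclic : ¬ (SimpleGraph.cycleGraph 4).IsAcyclic := by
  rw [SimpleGraph.isAcyclic_iff_free_cycleGraph]
  intro h
  exact h 4 (by norm_num) (SimpleGraph.IsContained.refl _)

/-- Paths with two edges and cycles with four edges, compared via codegrees. -/
theorem sq_card_homMaps_pathGraph_le {V : Type*} [Fintype V] (G : SimpleGraph V) :
    (homMaps (SimpleGraph.pathGraph 3) G).card ^ 2 ≤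
      Fintype.card V ^ 2 * (homMaps (SimpleGraph.cycleGraph 4) G).card := by
  classical
  -- `N p` is the common neighbourhood of the pair `p`. Its size counts paths between the two nodes
  -- and the square of its size counts 4-cycles with them as opposite nodes, so Cauchy–Schwarz
  -- applies.
  let N : V × V → Finset V := fun p => Finset.univ.filter fun y => G.Adj p.1 y ∧ G.Adj y p.2
  have h1 : (homMaps (SimpleGraph.pathGraph 3) G).card ≤ ∑ p, (N p).card := by
    rw [Finset.card_eq_sum_card_fiberwise (f := fun f => (f 0, f 2)) (t := Finset.univ)
      (fun _ _ => Finset.mem_coe.2 (Finset.mem_univ _))]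
    refine Finset.sum_le_sum fun p _ => ?_
    refine Finset.card_le_card_of_injOn (fun f => f 1) ?_ ?_
    · intro f hf
      obtain ⟨hf', rfl⟩ := Finset.mem_filter.1 (Finset.mem_coe.1 hf)
      have := mem_homMaps.1 hf'
      simp only [N, Finset.coe_filter, Finset.mem_univ, true_and, Set.mem_ofPred_eq]
      exact ⟨this 0 1 (by simp [SimpleGraph.pathGraph_adj]),
        this 1 2 (by simp [SimpleGraph.pathGraph_adj])⟩
    · intro f hf f' hf' h
      have e1 := (Finset.mem_filter.1 (Finset.mem_coe.1 hf)).2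
      have e2 := (Finset.mem_filter.1 (Finset.mem_coe.1 hf')).2
      rw [← e2, Prod.mk.injEq] at e1
      funext i
      fin_cases i
      · exact e1.1
      · exact h
      · exact e1.2
  have h2 : ∑ p, (N p).card ^ 2 ≤ (homMaps (SimpleGraph.cycleGraph 4) G).card := by
    rw [Finset.card_eq_sum_card_fiberwise (f := fun f => (f 0, f 2)) (t := Finset.univ)
      (fun _ _ => Finset.mem_coe.2 (Finset.mem_univ _))]
    refine Finset.sum_le_sum fun p _ => ?_
    rw [sq, ← Finset.card_product]
    refine Finset.card_le_card_of_injOn (fun q => ![p.1, q.1, p.2, q.2]) ?_ ?_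
    · intro q hq
      simp only [N, Finset.mem_coe, Finset.mem_product, Finset.mem_filter, Finset.mem_univ,
        true_and] at hq
      refine Finset.mem_coe.2 (Finset.mem_filter.2 ⟨mem_homMaps.2 fun a b hab => ?_, rfl⟩)
      obtain ⟨⟨h1, h2⟩, h3, h4⟩ := hq
      rw [SimpleGraph.cycleGraph_adj] at hab
      revert hab
      fin_cases a <;> fin_cases b <;> intro hab <;>
        first
        | exact absurd hab (by decide)
        | simpa using h1 | simpa using h2 | simpa using h3 | simpa using h4
        | simpa using h1.symm | simpa using h2.symm | simpa using h3.symm | simpa using h4.symm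
    · intro q _ q' _ h
      have e1 := congrFun h 1
      have e2 := congrFun h 3
      exact Prod.ext e1 e2
  calc _ ≤ (∑ p, (N p).card) ^ 2 := Nat.pow_le_pow_left h1 2
    _ ≤ (Finset.univ : Finset (V × V)).card * ∑ p, (N p).card ^ 2 := sq_sum_le_card_mul_sum_sq
    _ ≤ _ := by
      rw [Finset.card_univ, Fintype.card_prod, ← sq]
      gcongr

variable {V : ℕ → Type*} [∀ n, Fintype (V n)] [∀ n, Nonempty (V n)] {G : ∀ n, SimpleGraph (V n)}
  {d : ℕ → ℝ} {α : ℝ}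

/-- A sequence of large essential girth and positive regularity is sparse. -/
theorem tendsto_div_card (hadm : ∀ n, IsAdmissible (G n) (d n))
    (hα₀ : 0 < α) (hα₁ : α ≤ 1) (hreg : IsRegularSeq G d α) (hgirth : HasLargeEssentialGirth G d)
    (hδ : Tendsto (fun n => 1 / d n) atTop (𝓝 0)) :
    Tendsto (fun n => d n / Fintype.card (V n)) atTop (𝓝 0) := by
  have hP := tendsto_homDensity_of_tendsto_zero hadm hα₀.le hα₁ hreg hgirth hδ
    (F := SimpleGraph.pathGraph 3) (SimpleGraph.pathGraph_connected 2)
  have hC := tendsto_homDensity_of_tendsto_zero hadm hα₀.le hα₁ hreg hgirth hδ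
    (F := SimpleGraph.cycleGraph 4) SimpleGraph.cycleGraph_connected
  rw [if_pos pathGraph_three_isAcyclic] at hP
  rw [if_neg cycleGraph_four_not_isAcyclic] at hC
  have hα2 : (0 : ℝ) < α ^ (Fintype.card (Fin 3) - 1) := by positivity
  -- In normalized form the path and cycle inequality says that `d / v` is at most the density of
  -- `C₄` divided by the square of that of the path.
  have hdiv := hC.div (hP.pow 2) (by positivity)
  rw [zero_div] at hdiv
  refine squeeze_zero' (Eventually.of_forall fun n => ?_) ?_ hdiv
  · exact div_nonneg (by linarith [(hadm n).1]) (by positivity)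
  · filter_upwards [hP.eventually_const_lt hα2] with n hn
    have hd : 0 < d n := by linarith [(hadm n).1]
    have hV : (0 : ℝ) < Fintype.card (V n) := by exact_mod_cast Fintype.card_pos
    rw [Pi.div_apply, le_div_iff₀ (pow_pos hn 2)]
    have h1 := sq_card_homMaps_pathGraph_le (G n)
    rw [card_homMaps, card_homMaps] at h1
    have h2 : (Nat.card (SimpleGraph.pathGraph 3 →g G n) : ℝ) ^ 2 ≤
      (Fintype.card (V n) : ℝ) ^ 2 * Nat.card (SimpleGraph.cycleGraph 4 →g G n) := by
      exact_mod_cast h1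
    simp only [homDensity, Fintype.card_fin, Nat.add_one_sub_one]
    rw [div_pow, div_mul_div_comm, div_le_div_iff₀ (by positivity) (by positivity)]
    calc d n * (Nat.card (SimpleGraph.pathGraph 3 →g G n) : ℝ) ^ 2 *
          ((Fintype.card (V n) : ℝ) * d n ^ 3)
        ≤ d n * ((Fintype.card (V n) : ℝ) ^ 2 * Nat.card (SimpleGraph.cycleGraph 4 →g G n)) *
          ((Fintype.card (V n) : ℝ) * d n ^ 3) := by gcongr
      _ = _ := by ring

end Dense

/-! ### The gauge function -/

section Gauge

/-- The step function that takes the value `1 / d n` on `[1 / v n, 1 / (v n - 1/2))` if `v` is a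
strictly increasing sequence of positive integers and `d` is nondecreasing. -/
noncomputable def stepGauge (v : ℕ → ℕ) (d : ℕ → ℝ) (x : ℝ) : ℝ :=
  ⨅ n : {n : ℕ // x * (2 * (v n : ℝ) - 1) < 2}, 1 / d n

variable {v : ℕ → ℕ} {d : ℕ → ℝ}

theorem stepGauge_nonneg (hd : ∀ n, 1 ≤ d n) (x : ℝ) : 0 ≤ stepGauge v d x :=
  Real.iInf_nonneg fun n => div_nonneg zero_le_one (by linarith [hd n])

theorem stepGauge_le (hd : ∀ n, 1 ≤ d n) {x : ℝ} {n : ℕ} (h : x * (2 * (v n : ℝ) - 1) < 2) :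
    stepGauge v d x ≤ 1 / d n :=
  ciInf_le (f := fun n : {n : ℕ // x * (2 * (v n : ℝ) - 1) < 2} => 1 / d n)
    ⟨0, by rintro _ ⟨n, rfl⟩; exact div_nonneg zero_le_one (by linarith [hd n])⟩ ⟨n, h⟩

theorem le_stepGauge {x c : ℝ} {n : ℕ} (hn : x * (2 * (v n : ℝ) - 1) < 2)
    (h : ∀ n, x * (2 * (v n : ℝ) - 1) < 2 → c ≤ 1 / d n) : c ≤ stepGauge v d x := by
  have : Nonempty {n : ℕ // x * (2 * (v n : ℝ) - 1) < 2} := ⟨⟨n, hn⟩⟩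
  exact le_ciInf fun n => h n n.2

theorem stepGauge_mono (hv : StrictMono v) (hv0 : 0 < v 0) (hd : ∀ n, 1 ≤ d n) {x y : ℝ}
    (hxy : x ≤ y) (hy : y < 2 / (2 * v 0 - 1)) :
    stepGauge v d x ≤ stepGauge v d y := by
  have hpos : ∀ n, (0 : ℝ) < 2 * v n - 1 := by
    intro n
    have : 1 ≤ v n := hv0.trans_le (hv.monotone (Nat.zero_le n))
    have : (1 : ℝ) ≤ v n := by exact_mod_cast this
    linarith
  refine le_stepGauge (n := 0) ((lt_div_iff₀ (hpos 0)).1 hy) fun n hn => ?_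
  exact stepGauge_le hd (lt_of_le_of_lt (mul_le_mul_of_nonneg_right hxy (hpos n).le) hn)

/-- Each condition indexing the infimum is open in `x`, so an index that nearly attains it stays
admissible slightly to the right; monotonicity gives the other inequality. The interval ends at `1 /
(v 0 - 1/2)`, where the index set becomes empty. -/
theorem isGauge_stepGauge (hv : StrictMono v) (hv0 : 0 < v 0) (hd : ∀ n, 1 ≤ d n) :
    IsGauge (stepGauge v d) := by
  have hpos : (0 : ℝ) < 2 * v 0 - 1 := by
    have : (1 : ℝ) ≤ v 0 := by exact_mod_cast hv0
    linarith
  refine ⟨2 / (2 * v 0 - 1), by positivity, fun x _ => stepGauge_nonneg hd x,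
    fun x _ y hy hxy => stepGauge_mono hv hv0 hd hxy hy.2, fun x hx => ?_⟩
  refine tendsto_order.2 ⟨fun c hc => ?_, fun c hc => ?_⟩
  · have : ∀ᶠ y in 𝓝[≥] x, y < 2 / (2 * (v 0 : ℝ) - 1) :=
      nhdsWithin_le_nhds (Iio_mem_nhds hx.2)
    filter_upwards [this, self_mem_nhdsWithin] with y hy hxy
    exact hc.trans_le (stepGauge_mono hv hv0 hd hxy hy)
  · have : Nonempty {n : ℕ // x * (2 * (v n : ℝ) - 1) < 2} := ⟨⟨0, (lt_div_iff₀ hpos).1 hx.2⟩⟩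
    obtain ⟨⟨n, hn⟩, hlt⟩ := exists_lt_of_ciInf_lt hc
    have hcont : ContinuousAt (fun y : ℝ => y * (2 * (v n : ℝ) - 1)) x := by fun_prop
    filter_upwards [nhdsWithin_le_nhds (hcont.eventually_lt_const hn)] with y hy
    exact (stepGauge_le hd hy).trans_lt hlt

/-- At `1 / v n` the condition on `m` reads `v m < v n + 1/2`, that is `m ≤ n`, and `1 / d m` is
nonincreasing in `m`. -/
theorem stepGauge_one_div (hv : StrictMono v) (hv0 : 0 < v 0) (hd : ∀ n, 1 ≤ d n)
    (hdm : Monotone d) (n : ℕ) : stepGauge v d (1 / v n) = 1 / d n := by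
  have hpos : (0 : ℝ) < v n := by exact_mod_cast hv0.trans_le (hv.monotone (Nat.zero_le n))
  have hn : 1 / (v n : ℝ) * (2 * (v n : ℝ) - 1) < 2 := by
    rw [one_div, inv_mul_lt_iff₀ hpos]; linarith
  refine le_antisymm (stepGauge_le hd hn) (le_stepGauge hn fun m hm => ?_)
  rw [one_div, inv_mul_lt_iff₀ hpos] at hm
  have h1 : v m ≤ v n := by
    by_contra! h
    have : (v n : ℝ) + 1 ≤ v m := by exact_mod_cast h
    linarith
  have := hdm (hv.le_iff_le.1 h1)
  exact one_div_le_one_div_of_le (by linarith [hd m]) this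

theorem stepGauge_zero {δ : ℝ} (hd : ∀ n, 1 ≤ d n) (hdm : Monotone d)
    (hδ : Tendsto (fun n => 1 / d n) atTop (𝓝 δ)) : stepGauge v d 0 = δ := by
  have hanti : Antitone fun n => 1 / d n := fun m n h =>
    one_div_le_one_div_of_le (by linarith [hd m]) (hdm h)
  refine le_antisymm (ge_of_tendsto hδ (Eventually.of_forall fun n => stepGauge_le hd (by simp)))
    (le_stepGauge (n := 0) (by simp) fun n _ => hanti.le_of_tendsto hδ n)

/-- An index `n` occurring in the infimum at `x` satisfies `x < 2 / (2 * v n - 1) ≤ 2 / v n`, and `2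
* C / v n ≤ 1 / d n` for large `n`. Small indices only give larger values of `1 / d n`. -/
theorem mul_le_stepGauge (hv : StrictMono v) (hv0 : 0 < v 0) (hd : ∀ n, 1 ≤ d n)
    (hdm : Monotone d) (hlim : Tendsto (fun n => d n / v n) atTop (𝓝 0)) (C : ℝ) :
    ∃ η > 0, ∀ x, 0 < x → x < η → C * x ≤ stepGauge v d x := by
  wlog hC : 0 < C generalizing C
  · obtain ⟨η, hη, h⟩ := this 1 one_pos
    exact ⟨η, hη, fun x h1 h2 => le_trans (by nlinarith) (h x h1 h2)⟩
  have hpos : ∀ n, (1 : ℝ) ≤ v n := by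
    intro n
    exact_mod_cast hv0.trans_le (hv.monotone (Nat.zero_le n))
  obtain ⟨N, hN⟩ := eventually_atTop.1 (hlim.eventually_lt_const (u := 1 / (2 * C)) (by positivity))
  have hgood : ∀ n, N ≤ n → ∀ x, 0 < x → x * (2 * (v n : ℝ) - 1) < 2 → C * x ≤ 1 / d n := by
    intro n hn x hx h
    have h1 := hN n hn
    rw [div_lt_div_iff₀ (by linarith [hpos n]) (by positivity)] at h1
    rw [le_div_iff₀ (by linarith [hd n])]
    nlinarith [hpos n]
  refine ⟨2 / (2 * v N - 1), div_pos two_pos (by linarith [hpos N]), fun x hx0 hx => ?_⟩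
  have hxN : x * (2 * (v N : ℝ) - 1) < 2 := (lt_div_iff₀ (by linarith [hpos N])).1 hx
  refine le_stepGauge hxN fun n hn => ?_
  rcases le_total N n with h | h
  · exact hgood n h x hx0 hn
  · exact (hgood N le_rfl x hx0 hxN).trans
      (one_div_le_one_div_of_le (by linarith [hd n]) (hdm h))

end Gauge

/-! ### A Cantor set of finite gauge measure without additive coincidences -/

section Arithmetic

theorem eight_pow_add_eq_aux {i j k l : ℕ} (h : 8 ^ i + 8 ^ j = 8 ^ k + 8 ^ l) (hij : j ≤ i)
    (hkl : l ≤ k) : i = k ∧ j = l := by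
  have key : ∀ {i j k l : ℕ}, 8 ^ i + 8 ^ j = 8 ^ k + 8 ^ l → l ≤ k → i ≤ k := by
    intro i j k l h hkl
    have h1 : 8 ^ l ≤ 8 ^ k := Nat.pow_le_pow_right (by norm_num) hkl
    have h2 : 8 ^ i < 8 ^ (k + 1) := by
      have : 0 < 8 ^ j := by positivity
      have : 0 < 8 ^ k := by positivity
      rw [pow_succ]; omega
    exact Nat.lt_succ_iff.1 ((Nat.pow_lt_pow_iff_right (by norm_num)).1 h2)
  have hik : i = k := le_antisymm (key h hkl) (key h.symm hij)
  subst hik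
  exact ⟨rfl, Nat.pow_right_injective (le_refl 2 |>.trans (by norm_num)) (Nat.add_left_cancel h)⟩

/-- Powers of `8` form a Sidon set. -/
theorem eight_pow_add_eq {i j k l : ℕ} (h : 8 ^ i + 8 ^ j = 8 ^ k + 8 ^ l) : i = k ∨ i = l := by
  rcases le_total j i with h1 | h1 <;> rcases le_total l k with h2 | h2
  · exact Or.inl (eight_pow_add_eq_aux h h1 h2).1
  · rw [add_comm (8 ^ k)] at h
    exact Or.inr (eight_pow_add_eq_aux h h1 h2).1
  · rw [add_comm (8 ^ i)] at h
    exact Or.inr (eight_pow_add_eq_aux h h1 h2).2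
  · rw [add_comm (8 ^ i), add_comm (8 ^ k)] at h
    exact Or.inl (eight_pow_add_eq_aux h h1 h2).2

end Arithmetic

/-- Parameters of the construction: at level `n` there are `N n` intervals of length `1 / Q n`,
each of which is divided into `M n` cells of `R n` slots; the scale `y n` belongs to
level `n + 1`. -/
structure CantorData (h : ℝ → ℝ) where
  N : ℕ → ℕ
  Q : ℕ → ℕ
  M : ℕ → ℕ
  R : ℕ → ℕ
  y : ℕ → ℝ
  N_zero : N 0 = 1
  Q_zero : Q 0 = 1
  N_succ : ∀ n, N (n + 1) = N n * M n
  Q_succ : ∀ n, Q (n + 1) = Q n * (M n * R n)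
  M_pos : ∀ n, 0 < M n
  lt_R : ∀ n, 8 ^ (N n + 2) < R n
  y_pos : ∀ n, 0 < y n
  y_lt : ∀ n, y n < 1 / (n + 1)
  le_mul : ∀ n, 12 ≤ N (n + 1) * h (y n)
  mul_le : ∀ n, N (n + 1) * h (y n) ≤ 24
  one_le_Q_mul : ∀ n, 1 ≤ Q (n + 1) * y n
  Q_mul_le : ∀ n, Q (n + 1) * y n ≤ 2
  good : ∀ n r, 0 < r → r ≤ y n → h (y n) * r ≤ 2 * y n * h r

/-! ### Choice of the scales and parameters. -/

section Existence

variable {h : ℝ → ℝ}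

/-- Take `y` where `h x / x` is within a factor `2` of its infimum over a short interval; the
infimum is positive because `h x ≥ x` near `0`. -/
theorem exists_good_scale (hgrow : ∀ C : ℝ, ∃ η > 0, ∀ x, 0 < x → x < η → C * x ≤ h x)
    {η : ℝ} (hη : 0 < η) :
    ∃ y, 0 < y ∧ y < η ∧ ∀ r, 0 < r → r ≤ y → h y * r ≤ 2 * y * h r := by
  obtain ⟨η₁, hη₁, h1⟩ := hgrow 1
  set η₀ := min η η₁ with hη₀
  have hpos : 0 < η₀ := lt_min hη hη₁
  set A : Set ℝ := (fun x => h x / x) '' Set.Ioo 0 η₀ with hA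
  have hlow : ∀ a ∈ A, 1 ≤ a := by
    rintro _ ⟨x, hx, rfl⟩
    simp only
    rw [le_div_iff₀ hx.1]
    exact h1 x hx.1 (hx.2.trans_le (min_le_right _ _))
  have hne : A.Nonempty := ⟨_, η₀ / 2, ⟨by linarith, by linarith⟩, rfl⟩
  have hu : 1 ≤ sInf A := le_csInf hne hlow
  obtain ⟨_, ⟨y, hy, rfl⟩, hlt⟩ := exists_lt_of_csInf_lt hne (by linarith : sInf A < 2 * sInf A)
  refine ⟨y, hy.1, hy.2.trans_le (min_le_left _ _), fun r hr hry => ?_⟩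
  have h2 : sInf A ≤ h r / r := csInf_le ⟨1, hlow⟩ ⟨r, ⟨hr, hry.trans_lt hy.2⟩, rfl⟩
  have h3 : h y / y < 2 * (h r / r) := hlt.trans_le (by linarith)
  rw [← mul_div_assoc, div_lt_div_iff₀ hy.1 hr] at h3
  linarith

theorem exists_cantor_step (hgrow : ∀ C : ℝ, ∃ η > 0, ∀ x, 0 < x → x < η → C * x ≤ h x)
    (hlim : Tendsto h (𝓝[>] 0) (𝓝 0)) {N Q : ℕ} (hN : 0 < N) (hQ : 0 < Q) {η : ℝ} (hη : 0 < η) :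
    ∃ (M R : ℕ) (y : ℝ), 0 < M ∧ 8 ^ (N + 2) < R ∧ 0 < y ∧ y < η ∧
      12 ≤ ((N * M : ℕ) : ℝ) * h y ∧ ((N * M : ℕ) : ℝ) * h y ≤ 24 ∧
      1 ≤ ((Q * (M * R) : ℕ) : ℝ) * y ∧ ((Q * (M * R) : ℕ) : ℝ) * y ≤ 2 ∧
      ∀ r, 0 < r → r ≤ y → h y * r ≤ 2 * y * h r := by
  have hN' : (1 : ℝ) ≤ N := by exact_mod_cast hN
  have hQ' : (1 : ℝ) ≤ Q := by exact_mod_cast hQ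
  -- Chosen so that `h y ≥ C * y` will force more than `8 ^ (N + 2)` slots per cell.
  set C : ℝ := 24 * Q * (8 ^ (N + 2) + 1) with hC
  have hCpos : 0 < C := by positivity
  obtain ⟨η₁, hη₁, h1⟩ := hgrow C
  have hpos : (0 : ℝ) < 24 / N := by positivity
  have h2 := hlim.eventually_lt_const hpos
  rw [eventually_nhdsWithin_iff, Metric.eventually_nhds_iff] at h2
  obtain ⟨η₂, hη₂, h2⟩ := h2
  obtain ⟨y, hy0, hy, hgood⟩ := exists_good_scale hgrow
    (lt_min hη (lt_min hη₁ hη₂))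
  have hyη : y < η := hy.trans_le (min_le_left _ _)
  have hyη₁ : y < η₁ := hy.trans_le ((min_le_right _ _).trans (min_le_left _ _))
  have hyη₂ : y < η₂ := hy.trans_le ((min_le_right _ _).trans (min_le_right _ _))
  have hCy := h1 y hy0 hyη₁
  have hh : 0 < h y := lt_of_lt_of_le (by positivity) hCy
  have hsmall : h y < 24 / N := h2 (by rw [Real.dist_eq, sub_zero, abs_of_pos hy0]; exact hyη₂) hy0
  rw [lt_div_iff₀ (by positivity)] at hsmall
  -- Since `z ≥ 1`, its floor `M` exceeds `z / 2`, which places `N * M * h y` between `12` and `24`.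
  set z : ℝ := 24 / (N * h y) with hz
  have hz1 : 1 ≤ z := by rw [hz, le_div_iff₀ (by positivity)]; linarith
  have hMle : (⌊z⌋₊ : ℝ) ≤ z := Nat.floor_le (by linarith)
  have hMlt : z < ⌊z⌋₊ + 1 := Nat.lt_floor_add_one z
  have hM1 : 1 ≤ ⌊z⌋₊ := Nat.le_floor (by exact_mod_cast hz1)
  have hM1' : (1 : ℝ) ≤ ⌊z⌋₊ := by exact_mod_cast hM1
  have hzN : z * (N * h y) = 24 := by rw [hz]; field_simp
  set M := ⌊z⌋₊ with hM
  -- With `⌈w⌉` slots per cell the new interval length lies between `y / 2` and `y`.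
  set w : ℝ := 1 / (Q * M * y) with hw
  have hwQ : w * (Q * M * y) = 1 := by rw [hw]; field_simp
  have hMh : N * M * h y ≤ 24 := by
    calc (N : ℝ) * M * h y = M * (N * h y) := by ring
      _ ≤ z * (N * h y) := by gcongr
      _ = 24 := hzN
  have hwbig : (8 : ℝ) ^ (N + 2) + 1 ≤ w := by
    rw [hw, le_div_iff₀ (by positivity)]
    have h3 : M * (C * y) ≤ 24 := by
      calc M * (C * y) ≤ M * h y := by gcongr
        _ ≤ N * (M * h y) := le_mul_of_one_le_left (by positivity) hN'
        _ ≤ 24 := by linarith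
    have : M * (C * y) = 24 * (((8 : ℝ) ^ (N + 2) + 1) * (Q * M * y)) := by rw [hC]; ring
    linarith
  have hw1 : 1 ≤ w := by
    have : (0 : ℝ) < 8 ^ (N + 2) := by positivity
    linarith
  have hRle : w ≤ ⌈w⌉₊ := Nat.le_ceil w
  have hRlt : (⌈w⌉₊ : ℝ) < w + 1 := Nat.ceil_lt_add_one (by linarith)
  refine ⟨M, ⌈w⌉₊, y, hM1, ?_, hy0, hyη, ?_, ?_, ?_, ?_, hgood⟩
  · have : ((8 ^ (N + 2) : ℕ) : ℝ) < ⌈w⌉₊ := by push_cast; linarith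
    exact_mod_cast this
  · push_cast
    have : z ≤ 2 * M := by linarith
    nlinarith [mul_pos (lt_of_lt_of_le one_pos hN') hh]
  · push_cast; exact hMh
  · push_cast
    have : w * (Q * M * y) ≤ ⌈w⌉₊ * (Q * M * y) := by gcongr
    linarith
  · push_cast
    have : ⌈w⌉₊ * (Q * M * y) ≤ (2 * w) * (Q * M * y) := by
      gcongr
      linarith
    linarith

theorem exists_cantorData (hgrow : ∀ C : ℝ, ∃ η > 0, ∀ x, 0 < x → x < η → C * x ≤ h x)
    (hlim : Tendsto h (𝓝[>] 0) (𝓝 0)) : Nonempty (CantorData h) := by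
  have step : ∀ (n : ℕ) (p : {p : ℕ × ℕ // 0 < p.1 ∧ 0 < p.2}), ∃ q : ℕ × ℕ × ℝ,
      0 < q.1 ∧ 8 ^ (p.1.1 + 2) < q.2.1 ∧ 0 < q.2.2 ∧ q.2.2 < 1 / ((n : ℝ) + 1) ∧
      12 ≤ ((p.1.1 * q.1 : ℕ) : ℝ) * h q.2.2 ∧ ((p.1.1 * q.1 : ℕ) : ℝ) * h q.2.2 ≤ 24 ∧
      1 ≤ ((p.1.2 * (q.1 * q.2.1) : ℕ) : ℝ) * q.2.2 ∧
      ((p.1.2 * (q.1 * q.2.1) : ℕ) : ℝ) * q.2.2 ≤ 2 ∧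
      ∀ r, 0 < r → r ≤ q.2.2 → h q.2.2 * r ≤ 2 * q.2.2 * h r := by
    intro n p
    obtain ⟨M, R, y, hq⟩ := exists_cantor_step hgrow hlim p.2.1 p.2.2
      (η := 1 / ((n : ℝ) + 1)) (by positivity)
    exact ⟨(M, R, y), hq⟩
  choose f hf using step
  let st : ℕ → {p : ℕ × ℕ // 0 < p.1 ∧ 0 < p.2} := fun n =>
    Nat.rec ⟨(1, 1), one_pos, one_pos⟩ (fun n p => ⟨(p.1.1 * (f n p).1,
      p.1.2 * ((f n p).1 * (f n p).2.1)), Nat.mul_pos p.2.1 (hf n p).1,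
      Nat.mul_pos p.2.2 (Nat.mul_pos (hf n p).1 (lt_of_le_of_lt (Nat.zero_le _) (hf n p).2.1))⟩) n
  exact ⟨{
    N := fun n => (st n).1.1
    Q := fun n => (st n).1.2
    M := fun n => (f n (st n)).1
    R := fun n => (f n (st n)).2.1
    y := fun n => (f n (st n)).2.2
    N_zero := rfl
    Q_zero := rfl
    N_succ := fun n => rfl
    Q_succ := fun n => rfl
    M_pos := fun n => (hf n (st n)).1
    lt_R := fun n => (hf n (st n)).2.1
    y_pos := fun n => (hf n (st n)).2.2.1
    y_lt := fun n => (hf n (st n)).2.2.2.1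
    le_mul := fun n => (hf n (st n)).2.2.2.2.1
    mul_le := fun n => (hf n (st n)).2.2.2.2.2.1
    one_le_Q_mul := fun n => (hf n (st n)).2.2.2.2.2.2.1
    Q_mul_le := fun n => (hf n (st n)).2.2.2.2.2.2.2.1
    good := fun n => (hf n (st n)).2.2.2.2.2.2.2.2 }⟩

end Existence

/-! ### Geometry and parametrization of the Cantor set. -/

namespace CantorData

variable {h : ℝ → ℝ} (D : CantorData h)

theorem N_pos (n : ℕ) : 0 < D.N n := by
  induction n with
  | zero => rw [D.N_zero]; exact one_pos
  | succ n ih => rw [D.N_succ]; exact Nat.mul_pos ih (D.M_pos n)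

theorem R_pos (n : ℕ) : 0 < D.R n := lt_of_le_of_lt (Nat.zero_le _) (D.lt_R n)

theorem Q_pos (n : ℕ) : 0 < D.Q n := by
  induction n with
  | zero => rw [D.Q_zero]; exact one_pos
  | succ n ih => rw [D.Q_succ]; exact Nat.mul_pos ih (Nat.mul_pos (D.M_pos n) (D.R_pos n))

theorem N_pos' (n : ℕ) : (0 : ℝ) < D.N n := by exact_mod_cast D.N_pos n

theorem Q_pos' (n : ℕ) : (0 : ℝ) < D.Q n := by exact_mod_cast D.Q_pos n

theorem tendsto_y : Tendsto D.y atTop (𝓝[>] 0) := by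
  refine tendsto_nhdsWithin_iff.2 ⟨?_, Eventually.of_forall D.y_pos⟩
  exact squeeze_zero (fun n => (D.y_pos n).le) (fun n => (D.y_lt n).le)
    tendsto_one_div_add_atTop_nhds_zero_nat

theorem tendsto_inv_Q : Tendsto (fun n => 1 / (D.Q (n + 1) : ℝ)) atTop (𝓝 0) := by
  refine squeeze_zero (fun n => by positivity) (fun n => ?_)
    (D.tendsto_y.mono_right nhdsWithin_le_nhds)
  rw [div_le_iff₀ (D.Q_pos' _), mul_comm]
  exact D.one_le_Q_mul n

theorem h_y_pos (n : ℕ) : 0 < h (D.y n) := by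
  have := D.le_mul n
  by_contra! h0
  have := mul_nonpos_of_nonneg_of_nonpos (D.N_pos' (n + 1)).le h0
  linarith

theorem tendsto_inv_N (hlim : Tendsto h (𝓝[>] 0) (𝓝 0)) :
    Tendsto (fun n => 1 / (D.N (n + 1) : ℝ)) atTop (𝓝 0) := by
  refine squeeze_zero (fun n => by positivity) (fun n => ?_) (hlim.comp D.tendsto_y)
  rw [div_le_iff₀ (D.N_pos' _), mul_comm]
  exact le_trans (by norm_num) (D.le_mul n)

/-- The position of the `i`-th interval of level `n`, in units of `1 / Q n`. -/
def pos : ℕ → ℕ → ℕ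
  | 0, i => i
  | n + 1, i => pos n (i / D.M n) * (D.M n * D.R n) + (i % D.M n) * D.R n + 8 ^ (i / D.M n + 1)

/-- The slot chosen within a cell is nondecreasing in the index, so passing from cells to slots does
not reduce the spacing. -/
theorem pos_add_le (n : ℕ) {i j : ℕ} (hij : i ≤ j) : D.pos n i + (j - i) ≤ D.pos n j := by
  induction n generalizing i j with
  | zero => simp only [pos]; omega
  | succ n ih =>
    have h1 : i / D.M n ≤ j / D.M n := Nat.div_le_div_right hij
    have h2 := ih h1
    have h3 : 8 ^ (i / D.M n + 1) ≤ 8 ^ (j / D.M n + 1) :=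
      Nat.pow_le_pow_right (by norm_num) (by omega)
    have hi := Nat.div_add_mod i (D.M n)
    have hj := Nat.div_add_mod j (D.M n)
    have h4 : D.pos n (i / D.M n) * D.M n + i % D.M n + (j - i) ≤
        D.pos n (j / D.M n) * D.M n + j % D.M n := by
      have h5 := Nat.mul_le_mul_right (D.M n) h2
      obtain ⟨k, hk⟩ := Nat.exists_eq_add_of_le h1
      rw [hk] at h5 hj ⊢
      rw [Nat.add_sub_cancel_left, add_mul] at h5
      rw [mul_add] at hj
      rw [mul_comm k] at h5
      omega
    have h6 := Nat.mul_le_mul_right (D.R n) h4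
    have h7 : j - i ≤ (j - i) * D.R n := Nat.le_mul_of_pos_right _ (D.R_pos n)
    simp only [pos]
    calc _ ≤ (D.pos n (i / D.M n) * D.M n + i % D.M n + (j - i)) * D.R n +
          8 ^ (j / D.M n + 1) := by
          rw [add_mul, add_mul]
          have : D.pos n (i / D.M n) * (D.M n * D.R n) =
            D.pos n (i / D.M n) * D.M n * D.R n := by ring
          omega
      _ ≤ (D.pos n (j / D.M n) * D.M n + j % D.M n) * D.R n + 8 ^ (j / D.M n + 1) := by omega
      _ = _ := by ring

/-- Cells are at least as far apart as their indices. -/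
theorem pos_succ_add_le (n : ℕ) {i j : ℕ} (hij : i ≤ j) :
    D.pos (n + 1) i + (j - i) * D.R n ≤ D.pos (n + 1) j := by
  have h1 : i / D.M n ≤ j / D.M n := Nat.div_le_div_right hij
  have h2 := D.pos_add_le n h1
  have h3 : 8 ^ (i / D.M n + 1) ≤ 8 ^ (j / D.M n + 1) :=
    Nat.pow_le_pow_right (by norm_num) (by omega)
  have hi := Nat.div_add_mod i (D.M n)
  have hj := Nat.div_add_mod j (D.M n)
  have h4 : D.pos n (i / D.M n) * D.M n + i % D.M n + (j - i) ≤
      D.pos n (j / D.M n) * D.M n + j % D.M n := by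
    have h5 := Nat.mul_le_mul_right (D.M n) h2
    obtain ⟨k, hk⟩ := Nat.exists_eq_add_of_le h1
    rw [hk] at h5 hj ⊢
    rw [Nat.add_sub_cancel_left, add_mul] at h5
    rw [mul_add] at hj
    rw [mul_comm k] at h5
    omega
  have h6 := Nat.mul_le_mul_right (D.R n) h4
  simp only [pos]
  calc _ = (D.pos n (i / D.M n) * D.M n + i % D.M n + (j - i)) * D.R n +
        8 ^ (i / D.M n + 1) := by ring
    _ ≤ (D.pos n (j / D.M n) * D.M n + j % D.M n) * D.R n + 8 ^ (j / D.M n + 1) := by omega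
    _ = _ := by ring

theorem div_lt_N {n i : ℕ} (hi : i < D.N (n + 1)) : i / D.M n < D.N n := by
  rw [D.N_succ] at hi
  exact Nat.div_lt_of_lt_mul (by rwa [mul_comm])

/-- There is room for the chosen slot and for one more to its right; the spare slot makes the right
ends of nested intervals decrease strictly. -/
theorem slot_lt {n i : ℕ} (hi : i < D.N (n + 1)) : 8 ^ (i / D.M n + 1) + 1 < D.R n := by
  have h1 := D.div_lt_N hi
  have h2 : 8 ^ (i / D.M n + 1) < 8 ^ (D.N n + 2) :=
    Nat.pow_lt_pow_right (by norm_num) (by omega)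
  have := D.lt_R n
  omega

/-- The offset of an interval in the interval of the previous level. -/
theorem offset_lt {n i : ℕ} (hi : i < D.N (n + 1)) :
    (i % D.M n) * D.R n + 8 ^ (i / D.M n + 1) + 1 < D.M n * D.R n := by
  have h1 := D.slot_lt hi
  have h2 := Nat.mul_le_mul_right (D.R n) (Nat.mod_lt i (D.M_pos n))
  rw [Nat.succ_mul] at h2
  omega

theorem pos_div {n i : ℕ} (hi : i < D.N (n + 1)) :
    D.pos (n + 1) i / (D.M n * D.R n) = D.pos n (i / D.M n) := by
  have h1 := D.offset_lt hi
  have h2 : 0 < D.M n * D.R n := Nat.mul_pos (D.M_pos n) (D.R_pos n)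
  simp only [pos]
  rw [add_assoc, mul_comm (D.pos n _), Nat.mul_add_div h2, Nat.div_eq_of_lt (Nat.lt_of_succ_lt h1),
    add_zero]

/-- The Cantor set. -/
def cantorSet : Set ℝ :=
  {x | (0 ≤ x ∧ x < 1) ∧ ∀ n, ∃ i < D.N n, ⌊x * D.Q n⌋₊ = D.pos n i}

theorem measurableSet_cantorSet : MeasurableSet D.cantorSet := by
  refine MeasurableSet.inter (measurableSet_Ico (a := (0 : ℝ)) (b := 1)) ?_
  have : {x : ℝ | ∀ n, ∃ i < D.N n, ⌊x * D.Q n⌋₊ = D.pos n i} =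
      ⋂ n, ⋃ i ∈ Finset.range (D.N n), (fun x : ℝ => ⌊x * D.Q n⌋₊) ⁻¹' {D.pos n i} := by
    ext x; simp
  change MeasurableSet {x : ℝ | ∀ n, ∃ i < D.N n, ⌊x * D.Q n⌋₊ = D.pos n i}
  rw [this]
  refine MeasurableSet.iInter fun n => Finset.measurableSet_biUnion _ fun i _ => ?_
  exact (Nat.measurable_floor.comp (measurable_id.mul_const _)) (measurableSet_singleton _)

/-- The point of the Cantor set with parameter `u`, approximated at level `n`. -/
noncomputable def approx (n : ℕ) (u : ℝ) : ℕ := D.pos n ⌊u * D.N n⌋₊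

theorem floor_lt_N {u : ℝ} (h0 : 0 ≤ u) (h1 : u < 1) (n : ℕ) : ⌊u * D.N n⌋₊ < D.N n := by
  have := D.N_pos' n
  rw [Nat.floor_lt (by positivity)]
  nlinarith

/-- Keeps the levels consistent: the parent of the interval assigned to `u` is the interval assigned
to `u` one level earlier. -/
theorem floor_div (u : ℝ) (n : ℕ) : ⌊u * D.N (n + 1)⌋₊ / D.M n = ⌊u * D.N n⌋₊ := by
  have hM : (D.M n : ℝ) ≠ 0 := by exact_mod_cast (D.M_pos n).ne'
  rw [← Nat.floor_div_natCast, D.N_succ, Nat.cast_mul, ← mul_assoc, mul_div_cancel_right₀ _ hM]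

/-- The `+ 2` comes from the spare slot. It yields the strict inequality of `point_lt_approx`,
without which the floor of `point u * Q n` could be off by one. -/
theorem approx_succ {u : ℝ} (h0 : 0 ≤ u) (h1 : u < 1) (n : ℕ) :
    D.approx n u * (D.M n * D.R n) ≤ D.approx (n + 1) u ∧
      D.approx (n + 1) u + 2 ≤ (D.approx n u + 1) * (D.M n * D.R n) := by
  have h2 := D.offset_lt (D.floor_lt_N h0 h1 (n + 1))
  unfold approx
  simp only [pos, D.floor_div] at h2 ⊢
  have h3 : 0 < 8 ^ (⌊u * D.N n⌋₊ + 1) := by positivity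
  rw [Nat.succ_mul]
  omega

theorem approx_div_mono {u : ℝ} (h0 : 0 ≤ u) (h1 : u < 1) :
    Monotone fun n => (D.approx n u : ℝ) / D.Q n := by
  refine monotone_nat_of_le_succ fun n => ?_
  rw [div_le_div_iff₀ (D.Q_pos' _) (D.Q_pos' _), D.Q_succ]
  have := Nat.mul_le_mul_right (D.Q n) (D.approx_succ h0 h1 n).1
  have e : D.approx n u * (D.Q n * (D.M n * D.R n)) ≤ D.approx (n + 1) u * D.Q n := by
    calc _ = D.approx n u * (D.M n * D.R n) * D.Q n := by ring
      _ ≤ _ := this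
  exact_mod_cast e

theorem approx_add_div_succ {u : ℝ} (h0 : 0 ≤ u) (h1 : u < 1) (n : ℕ) :
    ((D.approx (n + 1) u : ℝ) + 1) / D.Q (n + 1) < ((D.approx n u : ℝ) + 1) / D.Q n := by
  rw [div_lt_div_iff₀ (D.Q_pos' _) (D.Q_pos' _), D.Q_succ]
  have h2 := (D.approx_succ h0 h1 n).2
  have h3 : (D.approx (n + 1) u + 1) * D.Q n < (D.approx n u + 1) * (D.Q n * (D.M n * D.R n)) := by
    calc _ < (D.approx (n + 1) u + 2) * D.Q n := Nat.mul_lt_mul_of_pos_right (by omega) (D.Q_pos n)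
      _ ≤ (D.approx n u + 1) * (D.M n * D.R n) * D.Q n := Nat.mul_le_mul_right _ h2
      _ = _ := by ring
  exact_mod_cast h3

theorem approx_add_div_anti {u : ℝ} (h0 : 0 ≤ u) (h1 : u < 1) :
    Antitone fun n => ((D.approx n u : ℝ) + 1) / D.Q n :=
  antitone_nat_of_succ_le fun n => (D.approx_add_div_succ h0 h1 n).le

theorem approx_div_le {u : ℝ} (h0 : 0 ≤ u) (h1 : u < 1) (m n : ℕ) :
    (D.approx m u : ℝ) / D.Q m ≤ ((D.approx n u : ℝ) + 1) / D.Q n := by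
  calc (D.approx m u : ℝ) / D.Q m ≤ (D.approx (max m n) u : ℝ) / D.Q (max m n) :=
        D.approx_div_mono h0 h1 (le_max_left _ _)
    _ ≤ ((D.approx (max m n) u : ℝ) + 1) / D.Q (max m n) := by gcongr; linarith
    _ ≤ _ := D.approx_add_div_anti h0 h1 (le_max_right _ _)

/-- The parametrization of the Cantor set. -/
noncomputable def point (u : ℝ) : ℝ := ⨆ n, (D.approx n u : ℝ) / D.Q n

theorem approx_le_point {u : ℝ} (h0 : 0 ≤ u) (h1 : u < 1) (n : ℕ) :
    (D.approx n u : ℝ) ≤ D.point u * D.Q n := by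
  rw [← div_le_iff₀ (D.Q_pos' n)]
  exact le_ciSup (f := fun n => (D.approx n u : ℝ) / D.Q n)
    ⟨((D.approx 0 u : ℝ) + 1) / D.Q 0, by rintro _ ⟨m, rfl⟩; exact D.approx_div_le h0 h1 m 0⟩ n

theorem point_lt_approx {u : ℝ} (h0 : 0 ≤ u) (h1 : u < 1) (n : ℕ) :
    D.point u * D.Q n < D.approx n u + 1 := by
  rw [← lt_div_iff₀ (D.Q_pos' n)]
  exact (ciSup_le fun m => D.approx_div_le h0 h1 m (n + 1)).trans_lt
    (D.approx_add_div_succ h0 h1 n)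

theorem point_mem {u : ℝ} (h0 : 0 ≤ u) (h1 : u < 1) : D.point u ∈ D.cantorSet := by
  have e0 : D.approx 0 u = 0 := by
    have := D.floor_lt_N h0 h1 0
    rw [D.N_zero] at this
    simp only [approx, pos, D.N_zero]
    omega
  have a1 := D.approx_le_point h0 h1 0
  have a2 := D.point_lt_approx h0 h1 0
  rw [e0, D.Q_zero] at a1 a2
  norm_num at a1 a2
  refine ⟨⟨a1, a2⟩, fun n => ⟨_, D.floor_lt_N h0 h1 n, ?_⟩⟩
  rw [Nat.floor_eq_iff (mul_nonneg a1 (D.Q_pos' n).le)]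
  exact ⟨D.approx_le_point h0 h1 n, D.point_lt_approx h0 h1 n⟩

/-- The parameters of nearby points are close. -/
theorem sub_le_of_point_sub_le {u u' ρ : ℝ} (h0 : 0 ≤ u) (huu : u ≤ u') (h1 : u' < 1)
    (hρ : D.point u' - D.point u ≤ ρ) (n : ℕ) :
    u' - u ≤ ρ * D.Q n / D.N n + 2 / D.N (n + 1) := by
  have hu1 : u < 1 := huu.trans_lt h1
  have h0' : 0 ≤ u' := h0.trans huu
  set i := ⌊u * D.N (n + 1)⌋₊ with hi
  set j := ⌊u' * D.N (n + 1)⌋₊ with hj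
  have hN := D.N_pos' (n + 1)
  have hij : i ≤ j := Nat.floor_le_floor (by gcongr)
  have hR : (1 : ℝ) ≤ D.R n := by exact_mod_cast D.R_pos n
  have hM : (0 : ℝ) < D.M n := by exact_mod_cast D.M_pos n
  have a1 := D.point_lt_approx h0 hu1 (n + 1)
  have a2 := D.approx_le_point h0' h1 (n + 1)
  -- The intervals with indices `i ≤ j` start at least `(j - i) * R n` units apart. The length of
  -- one interval, a single unit, is absorbed by the `- 1` in `a4` as `R n ≥ 1`.
  have a3 : (D.approx (n + 1) u : ℝ) + ((j : ℝ) - i) * D.R n ≤ D.approx (n + 1) u' := by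
    have := D.pos_succ_add_le n hij
    have h2 : ((D.pos (n + 1) i : ℕ) : ℝ) + ((j - i : ℕ) : ℝ) * D.R n ≤ D.pos (n + 1) j := by
      exact_mod_cast this
    rwa [Nat.cast_sub hij] at h2
  have a4 : ((j : ℝ) - i - 1) * D.R n ≤ ρ * D.Q (n + 1) := by
    have : (D.point u' - D.point u) * D.Q (n + 1) ≤ ρ * D.Q (n + 1) := by
      have := D.Q_pos' (n + 1)
      gcongr
    nlinarith
  have a5 : (D.Q (n + 1) : ℝ) = D.Q n * (D.M n * D.R n) := by exact_mod_cast D.Q_succ n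
  have a6 : (j : ℝ) - i - 1 ≤ ρ * D.Q n * D.M n := by
    have : ((j : ℝ) - i - 1) * D.R n ≤ (ρ * D.Q n * D.M n) * D.R n := by
      rw [a5] at a4; linarith
    exact le_of_mul_le_mul_right this (by linarith)
  have a7 : u' * D.N (n + 1) < j + 1 := Nat.lt_floor_add_one _
  have a8 : (i : ℝ) ≤ u * D.N (n + 1) := Nat.floor_le (by positivity)
  have a9 : (u' - u) * D.N (n + 1) ≤ ρ * D.Q n * D.M n + 2 := by nlinarith
  have a10 : (D.N (n + 1) : ℝ) = D.N n * D.M n := by exact_mod_cast D.N_succ n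
  rw [← le_div_iff₀ hN] at a9
  refine a9.trans (le_of_eq ?_)
  rw [a10]
  have := D.N_pos' n
  field_simp

theorem point_strictMonoOn (hlim : Tendsto h (𝓝[>] 0) (𝓝 0)) :
    StrictMonoOn D.point (Set.Ico 0 1) := by
  intro u hu u' hu' huu
  by_contra! hle
  have h1 : ∀ n, u' - u ≤ 2 * (1 / D.N (n + 1)) := by
    intro n
    have := D.sub_le_of_point_sub_le hu.1 huu.le hu'.2 (ρ := 0) (by linarith) n
    simp only [zero_mul, zero_div, zero_add] at this
    rwa [mul_one_div]
  have h2 := ge_of_tendsto ((D.tendsto_inv_N hlim).const_mul 2) (Eventually.of_forall h1)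
  linarith

end CantorData

/-! ### Gauge measure and additive structure of the Cantor set. -/

namespace CantorData

variable {h : ℝ → ℝ} (D : CantorData h)

/-- The modulus of continuity of the inverse parametrization. -/
theorem sub_le_gauge {ε : ℝ} (hmono : MonotoneOn h (Set.Ico 0 ε)) {u u' ρ : ℝ} (h0 : 0 ≤ u)
    (huu : u ≤ u') (h1 : u' < 1) (hρ0 : 0 < ρ) (hρε : ρ < ε) (hρ1 : ρ < 1 / D.Q 1)
    (hρ : D.point u' - D.point u ≤ ρ) : u' - u ≤ h ρ := by
  classical
  -- The least such `n` satisfies `1 / Q (n + 1) ≤ ρ < 1 / Q n`. It is not `0` because `ρ < 1 / Q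
  -- 1`, so both levels have a scale `y` attached to them.
  have hex : ∃ n, 1 / (D.Q (n + 1) : ℝ) ≤ ρ :=
    (D.tendsto_inv_Q.eventually_le_const hρ0).exists
  obtain ⟨n, hn, hmin⟩ : ∃ n, 1 / (D.Q (n + 1) : ℝ) ≤ ρ ∧ ρ < 1 / D.Q n ∧ n ≠ 0 := by
    refine ⟨Nat.find hex, Nat.find_spec hex, ?_⟩
    have hne : Nat.find hex ≠ 0 := by
      intro h0
      have := Nat.find_spec hex
      rw [h0] at this
      linarith
    refine ⟨?_, hne⟩
    obtain ⟨k, hk⟩ := Nat.exists_eq_succ_of_ne_zero hne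
    have := Nat.find_min hex (m := k) (by omega)
    rw [hk]
    exact not_le.1 this
  obtain ⟨hmin, hne⟩ := hmin
  obtain ⟨k, rfl⟩ := Nat.exists_eq_succ_of_ne_zero hne
  rw [Nat.succ_eq_add_one] at *
  have key := D.sub_le_of_point_sub_le h0 huu h1 hρ (k + 1)
  have hN := D.N_pos' (k + 1)
  have hN2 := D.N_pos' (k + 1 + 1)
  have hQ := D.Q_pos' (k + 1)
  have hQ2 := D.Q_pos' (k + 1 + 1)
  have hy := D.y_pos k
  have hy2 := D.y_pos (k + 1)
  have b1 : ρ * D.Q (k + 1) < 1 := (lt_div_iff₀ hQ).1 hmin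
  have b2 : 1 ≤ ρ * D.Q (k + 1 + 1) := (div_le_iff₀ hQ2).1 hn
  have hρy : ρ ≤ D.y k := by
    by_contra! hlt
    have := D.one_le_Q_mul k
    nlinarith
  -- From `good`, `12 ≤ N * h y` and `Q * y ≤ 2`, this term is at most `4 / 12` of `h ρ`. The
  -- rounding term `t2` takes the remaining `8 / 12`, which is where the constant `12` comes from.
  have t1 : ρ * D.Q (k + 1) / D.N (k + 1) ≤ h ρ / 3 := by
    have g := D.good k ρ hρ0 hρy
    have a1 := D.le_mul k
    have a2 := D.Q_mul_le k
    rw [div_le_iff₀ hN]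
    have a3 : 12 * ρ ≤ 2 * D.y k * (h ρ * D.N (k + 1)) := by
      calc 12 * ρ ≤ (D.N (k + 1) * h (D.y k)) * ρ := by gcongr
        _ = D.N (k + 1) * (h (D.y k) * ρ) := by ring
        _ ≤ D.N (k + 1) * (2 * D.y k * h ρ) := by gcongr
        _ = _ := by ring
    have a4 : 12 * ρ * D.Q (k + 1) ≤ 4 * (h ρ * D.N (k + 1)) := by
      have hpos : 0 ≤ h ρ * D.N (k + 1) := by
        by_contra! hneg
        have := mul_neg_of_pos_of_neg (by linarith : 0 < 2 * D.y k) hneg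
        linarith
      calc 12 * ρ * D.Q (k + 1) ≤ (2 * D.y k * (h ρ * D.N (k + 1))) * D.Q (k + 1) := by gcongr
        _ = 2 * (h ρ * D.N (k + 1)) * (D.Q (k + 1) * D.y k) := by ring
        _ ≤ 2 * (h ρ * D.N (k + 1)) * 2 := by gcongr
        _ = _ := by ring
    linarith
  have t2 : 2 / (D.N (k + 1 + 1) : ℝ) ≤ 2 * h ρ / 3 := by
    have a1 := D.le_mul (k + 1)
    have a2 := D.Q_mul_le (k + 1)
    have a3 : h (D.y (k + 1)) ≤ 4 * h ρ := by
      rcases le_total (D.y (k + 1)) ρ with hle | hle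
      · have := hmono ⟨hy2.le, hle.trans_lt hρε⟩ ⟨hρ0.le, hρε⟩ hle
        have := D.h_y_pos (k + 1)
        linarith
      · have g := D.good (k + 1) ρ hρ0 hle
        have b3 : D.y (k + 1) ≤ 2 * ρ := by nlinarith
        have hpos : 0 < h ρ := by
          by_contra! hneg
          have := D.h_y_pos (k + 1)
          nlinarith [mul_pos this hρ0]
        have : h (D.y (k + 1)) * ρ ≤ (4 * h ρ) * ρ := by nlinarith
        exact le_of_mul_le_mul_right this hρ0
    rw [div_le_iff₀ hN2]
    nlinarith
  linarith

/-- Mass distribution principle for the image `ν` of Lebesgue measure under `point`: by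
`sub_le_gauge` a set of small diameter `ρ` has a preimage of diameter at most `h ρ`, hence mass at
most `h ρ`. -/
theorem one_le_gaugeMeasure {ε : ℝ} (hε : 0 < ε) (hmono : MonotoneOn h (Set.Ico 0 ε))
    (hlim : Tendsto h (𝓝[>] 0) (𝓝 0)) : 1 ≤ gaugeMeasure ℝ h D.cantorSet := by
  have hsm := D.point_strictMonoOn hlim
  have hmeas : AEMeasurable D.point (volume.restrict (Set.Ico 0 1)) :=
    aemeasurable_restrict_of_monotoneOn measurableSet_Ico hsm.monotoneOn
  set ν : Measure ℝ := (volume.restrict (Set.Ico 0 1)).map D.point with hν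
  have hQ := D.Q_pos' 1
  set r₀ : ℝ := min (ε / 2) (1 / D.Q 1 / 2) with hr₀
  have hr₀pos : 0 < r₀ := lt_min (by linarith) (by positivity)
  have hle : ν ≤ gaugeMeasure ℝ h := by
    refine Measure.le_mkMetric _ ν (ENNReal.ofReal r₀) (ENNReal.ofReal_pos.2 hr₀pos) fun s hs => ?_
    have hsne : Metric.ediam s ≠ ∞ := (hs.trans_lt ENNReal.ofReal_lt_top).ne
    set ρ := (Metric.ediam s).toReal with hρ
    have hρr : ρ ≤ r₀ := ENNReal.toReal_le_of_le_ofReal hr₀pos.le hs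
    have hρ0 : 0 ≤ ρ := ENNReal.toReal_nonneg
    have hcl : Metric.ediam (closure s) = Metric.ediam s := Metric.ediam_closure s
    calc ν s ≤ ν (closure s) := measure_mono subset_closure
      _ = volume (D.point ⁻¹' closure s ∩ Set.Ico 0 1) := by
          rw [hν, Measure.map_apply_of_aemeasurable hmeas measurableSet_closure,
            Measure.restrict_apply' measurableSet_Ico]
      _ ≤ Metric.ediam (D.point ⁻¹' closure s ∩ Set.Ico 0 1) := Real.volume_le_diam _
      _ ≤ ENNReal.ofReal (h ρ) := by
          refine Metric.ediam_le fun u hu u' hu' => ?_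
          wlog huu : u ≤ u' generalizing u u'
          · rw [edist_comm]
            exact this _ hu' _ hu (not_le.1 huu).le
          have hd : D.point u' - D.point u ≤ ρ := by
            have hm : D.point u ∈ closure s := hu.1
            have hm' : D.point u' ∈ closure s := hu'.1
            have h1 := Metric.edist_le_ediam_of_mem hm' hm
            rw [hcl, edist_dist] at h1
            have h2 := (ENNReal.ofReal_le_iff_le_toReal hsne).1 h1
            rw [Real.dist_eq] at h2
            exact (le_abs_self _).trans h2
          -- `sub_le_gauge` needs `ρ > 0`; a set of diameter `0` has at most one parameter by strict
          -- monotonicity.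
          rcases hρ0.eq_or_lt with hz | hpos
          · have h3 : u' ≤ u := by
              by_contra! hlt
              have := hsm hu.2 hu'.2 hlt
              linarith
            rw [le_antisymm h3 huu, edist_self]
            exact zero_le
          · rw [edist_dist, dist_comm, Real.dist_eq, abs_of_nonneg (sub_nonneg.2 huu)]
            refine ENNReal.ofReal_le_ofReal ?_
            refine D.sub_le_gauge hmono hu.2.1 huu hu'.2.2 hpos ?_ ?_ hd
            · have := min_le_left (ε / 2) (1 / (D.Q 1 : ℝ) / 2)
              linarith
            · have := min_le_right (ε / 2) (1 / (D.Q 1 : ℝ) / 2)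
              have : (0 : ℝ) < 1 / D.Q 1 := by positivity
              linarith
  have hone : ν D.cantorSet = 1 := by
    rw [hν, Measure.map_apply_of_aemeasurable hmeas D.measurableSet_cantorSet,
      Measure.restrict_apply' measurableSet_Ico]
    have hsub : Set.Ico 0 1 ⊆ D.point ⁻¹' D.cantorSet := fun u hu => D.point_mem hu.1 hu.2
    rw [Set.inter_eq_right.2 hsub]
    simp
  exact hone ▸ hle D.cantorSet

/-- The `N (n + 1)` intervals of one level are no longer than `y n`, so covering by them costs at
most `N (n + 1) * h (y n) ≤ 24`. -/
theorem gaugeMeasure_cantorSet_le {ε : ℝ} (hε : 0 < ε) (hmono : MonotoneOn h (Set.Ico 0 ε)) :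
    gaugeMeasure ℝ h D.cantorSet ≤ 24 := by
  have hlim := D.tendsto_inv_Q
  refine (Measure.mkMetric_le_liminf_sum (β := ℕ) (ι := fun n => Fin (D.N (n + 1))) (l := atTop)
    D.cantorSet (fun n => ENNReal.ofReal (1 / (D.Q (n + 1) : ℝ))) ?_
    (fun n i => Set.Icc ((D.pos (n + 1) i : ℝ) / D.Q (n + 1))
      (((D.pos (n + 1) i : ℝ) + 1) / D.Q (n + 1))) ?_ ?_ _).trans ?_
  · rw [← ENNReal.ofReal_zero]
    exact (ENNReal.continuous_ofReal.tendsto _).comp hlim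
  · refine Eventually.of_forall fun n i => ?_
    rw [Real.ediam_Icc, ← sub_div, add_sub_cancel_left]
  · refine Eventually.of_forall fun n x hx => ?_
    obtain ⟨i, hi, hfl⟩ := hx.2 (n + 1)
    have hQ := D.Q_pos' (n + 1)
    rw [Nat.floor_eq_iff (mul_nonneg hx.1.1 hQ.le)] at hfl
    refine Set.mem_iUnion.2 ⟨⟨i, hi⟩, ?_, ?_⟩
    · rw [div_le_iff₀ hQ]; exact hfl.1
    · rw [le_div_iff₀ hQ]; exact hfl.2.le
  · refine Filter.liminf_le_of_frequently_le' (Eventually.frequently ?_)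
    have h2 : ∀ᶠ n in atTop, D.y n < ε :=
      (D.tendsto_y.mono_right nhdsWithin_le_nhds).eventually_lt_const hε
    filter_upwards [h2] with n hn
    have hQ := D.Q_pos' (n + 1)
    simp only [Real.ediam_Icc, ← sub_div, add_sub_cancel_left]
    rw [Finset.sum_const, Finset.card_univ, Fintype.card_fin, nsmul_eq_mul,
      ENNReal.toReal_ofReal (by positivity)]
    have h3 : 1 / (D.Q (n + 1) : ℝ) ≤ D.y n := by
      rw [div_le_iff₀ hQ, mul_comm]; exact D.one_le_Q_mul n
    have h4 := hmono ⟨by positivity, h3.trans_lt hn⟩ ⟨(D.y_pos n).le, hn⟩ h3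
    rw [← ENNReal.ofReal_natCast, ← ENNReal.ofReal_mul (Nat.cast_nonneg _)]
    rw [show (24 : ℝ≥0∞) = ENNReal.ofReal 24 by norm_num]
    refine ENNReal.ofReal_le_ofReal ((mul_le_mul_of_nonneg_left h4 (Nat.cast_nonneg _)).trans
      (D.mul_le n))

/-- Differences of elements of the Cantor set are distinct, even modulo `1`. -/
theorem sidon {a b c e : ℝ} (ha : a ∈ D.cantorSet) (hb : b ∈ D.cantorSet) (hc : c ∈ D.cantorSet)
    (he : e ∈ D.cantorSet) {z : ℤ} (hz : a - b - c + e = z) : a = b ∨ a = c := by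
  -- At level `n + 1` the point lies in slot `8 ^ (i + 1)` of its cell, so its position encodes the
  -- index `i` of its interval at level `n`.
  have level : ∀ x ∈ D.cantorSet, ∀ n, ∃ (i C : ℕ) (f : ℝ), i < D.N n ∧ ⌊x * D.Q n⌋₊ = D.pos n i ∧
      x * D.Q (n + 1) = C * D.R n + 8 ^ (i + 1) + f ∧ 0 ≤ f ∧ f < 1 := by
    intro x hx n
    obtain ⟨j, hj, hfl⟩ := hx.2 (n + 1)
    have hQ := D.Q_pos' (n + 1)
    have hMR : ((D.M n * D.R n : ℕ) : ℝ) ≠ 0 := by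
      exact_mod_cast (Nat.mul_pos (D.M_pos n) (D.R_pos n)).ne'
    have hd : ⌊x * D.Q (n + 1)⌋₊ / (D.M n * D.R n) = ⌊x * D.Q n⌋₊ := by
      rw [← Nat.floor_div_natCast, D.Q_succ, Nat.cast_mul, ← mul_assoc,
        mul_div_cancel_right₀ _ hMR]
    refine ⟨j / D.M n, D.pos n (j / D.M n) * D.M n + j % D.M n,
      x * D.Q (n + 1) - ⌊x * D.Q (n + 1)⌋₊, D.div_lt_N hj, ?_, ?_, ?_, ?_⟩
    · rw [← hd, hfl, D.pos_div hj]
    · rw [hfl]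
      simp only [pos]
      push_cast
      ring
    · linarith [Nat.floor_le (mul_nonneg hx.1.1 hQ.le)]
    · linarith [Nat.lt_floor_add_one (x * D.Q (n + 1))]
  have key : ∀ n, ⌊a * D.Q n⌋₊ = ⌊b * D.Q n⌋₊ ∨ ⌊a * D.Q n⌋₊ = ⌊c * D.Q n⌋₊ := by
    intro n
    obtain ⟨ia, Ca, fa, hia, pa, ea, fa0, fa1⟩ := level a ha n
    obtain ⟨ib, Cb, fb, hib, pb, eb, fb0, fb1⟩ := level b hb n
    obtain ⟨ic, Cc, fc, hic, pc, ec, fc0, fc1⟩ := level c hc n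
    obtain ⟨ie, Ce, fe, hie, pe, ee, fe0, fe1⟩ := level e he n
    -- Multiplied by `Q (n + 1)`, the relation says that `L * R n` and `T` differ by less than `2`.
    -- Since `T` is small compared with `R n`, this gives `L = 0`; since `8` divides `T`, it then
    -- gives `T = 0`, to which the Sidon property of powers of `8` applies.
    have hsum : fa - fb - fc + fe = ((z * (D.Q n * D.M n) - ((Ca : ℤ) - Cb - Cc + Ce)) * D.R n -
        ((8 : ℤ) ^ (ia + 1) - 8 ^ (ib + 1) - 8 ^ (ic + 1) + 8 ^ (ie + 1)) : ℤ) := by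
      have h1 : (a - b - c + e) * D.Q (n + 1) = z * (D.Q n * (D.M n * D.R n)) := by
        rw [hz]; congr 1; exact_mod_cast D.Q_succ n
      push_cast
      linarith
    set T : ℤ := (8 : ℤ) ^ (ia + 1) - 8 ^ (ib + 1) - 8 ^ (ic + 1) + 8 ^ (ie + 1) with hT
    set L : ℤ := z * (D.Q n * D.M n) - ((Ca : ℤ) - Cb - Cc + Ce) with hL
    have hE1 : L * D.R n - T < 2 := by
      have : ((L * D.R n - T : ℤ) : ℝ) < ((2 : ℤ) : ℝ) := by rw [← hsum]; push_cast; linarith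
      exact_mod_cast this
    have hE2 : -2 < L * D.R n - T := by
      have : ((-2 : ℤ) : ℝ) < ((L * D.R n - T : ℤ) : ℝ) := by rw [← hsum]; push_cast; linarith
      exact_mod_cast this
    have hb8 : ∀ i, i < D.N n → 0 < (8 : ℤ) ^ (i + 1) ∧ 8 * (8 : ℤ) ^ (i + 1) ≤ 8 ^ (D.N n + 2) ∧
        (8 : ℤ) ∣ 8 ^ (i + 1) := by
      intro i hi
      refine ⟨by positivity, ?_, dvd_pow_self _ (by omega)⟩
      rw [← pow_succ']
      exact pow_le_pow_right₀ (by norm_num) (by omega)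
    obtain ⟨a1, a2, a3⟩ := hb8 ia hia
    obtain ⟨b1, b2, b3⟩ := hb8 ib hib
    obtain ⟨c1, c2, c3⟩ := hb8 ic hic
    obtain ⟨e1, e2, e3⟩ := hb8 ie hie
    have hR : (8 : ℤ) ^ (D.N n + 2) < D.R n := by exact_mod_cast D.lt_R n
    have hL0 : L = 0 := by
      by_contra hne
      rcases lt_or_gt_of_ne hne with hlt | hgt
      · have : L * D.R n ≤ -1 * D.R n := by
          apply mul_le_mul_of_nonneg_right (by omega) (by omega)
        omega
      · have : 1 * (D.R n : ℤ) ≤ L * D.R n := by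
          apply mul_le_mul_of_nonneg_right (by omega) (by omega)
        omega
    have hT0 : T = 0 := by
      rw [hL0, zero_mul] at hE1 hE2
      omega
    have hnat : 8 ^ (ia + 1) + 8 ^ (ie + 1) = 8 ^ (ib + 1) + 8 ^ (ic + 1) := by
      have : (8 : ℤ) ^ (ia + 1) + 8 ^ (ie + 1) = 8 ^ (ib + 1) + 8 ^ (ic + 1) := by linarith
      exact_mod_cast this
    rcases eight_pow_add_eq hnat with h1 | h1
    · left
      rw [pa, pb, Nat.succ_injective h1]
    · right
      rw [pa, pc, Nat.succ_injective h1]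
  have close : ∀ x ∈ D.cantorSet, ∀ y ∈ D.cantorSet,
      (∃ᶠ n in atTop, ⌊x * D.Q (n + 1)⌋₊ = ⌊y * D.Q (n + 1)⌋₊) → x = y := by
    intro x hx y hy hfr
    by_contra hne
    have hpos : 0 < |x - y| := abs_pos.2 (sub_ne_zero.2 hne)
    obtain ⟨n, h1, h2⟩ := (hfr.and_eventually (D.tendsto_inv_Q.eventually_lt_const hpos)).exists
    have hQ := D.Q_pos' (n + 1)
    rw [div_lt_iff₀ hQ] at h2
    have x1 := Nat.floor_le (mul_nonneg hx.1.1 hQ.le)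
    have x2 := Nat.lt_floor_add_one (x * D.Q (n + 1))
    have y1 := Nat.floor_le (mul_nonneg hy.1.1 hQ.le)
    have y2 := Nat.lt_floor_add_one (y * D.Q (n + 1))
    rw [h1] at x1 x2
    rcases abs_cases (x - y) with ⟨h3, -⟩ | ⟨h3, -⟩ <;> rw [h3] at h2 <;> linarith
  -- At every level `a` shares its interval with `b` or with `c`, so it shares with one of them
  -- infinitely often.
  by_cases hfr : ∃ᶠ n in atTop, ⌊a * D.Q (n + 1)⌋₊ = ⌊b * D.Q (n + 1)⌋₊
  · exact Or.inl (close a ha b hb hfr)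
  · refine Or.inr (close a ha c hc (Eventually.frequently ?_))
    filter_upwards [not_frequently.1 hfr] with n hn
    exact (key (n + 1)).resolve_left hn

end CantorData

/-! ### Gauge measures -/

section GaugeMeasure

theorem gaugeMeasure_map_isometryEquiv {X : Type*} [MetricSpace X] [MeasurableSpace X]
    [BorelSpace X] (h : ℝ → ℝ) (e : X ≃ᵢ X) :
    (gaugeMeasure X h).map e = gaugeMeasure X h := by
  ext s hs
  rw [Measure.map_apply e.continuous.measurable hs]
  have := OuterMeasure.isometryEquiv_map_mkMetric
    (fun r : ℝ≥0∞ => ENNReal.ofReal (h r.toReal)) e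
  have h2 := congrArg (fun m : OuterMeasure X => m s) this
  simp only [OuterMeasure.map_apply] at h2
  rw [OuterMeasure.coe_mkMetric] at h2
  exact h2

theorem gaugeMeasure_singleton {X : Type*} [MetricSpace X] [MeasurableSpace X]
    [BorelSpace X] {h : ℝ → ℝ} (h0 : h 0 = 0) (x : X) : gaugeMeasure X h {x} = 0 := by
  refine le_antisymm ((Measure.mkMetric_le_liminf_sum (β := ℕ) (ι := fun _ => Unit) (l := atTop)
    {x} (fun _ => 0) tendsto_const_nhds (fun _ _ => {x}) (by simp) (by simp) _).trans ?_) zero_le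
  simp [h0]

theorem nullSingletonClass_gaugeMeasure {X : Type*} [MetricSpace X] [MeasurableSpace X]
    [BorelSpace X] {h : ℝ → ℝ} (h0 : h 0 = 0) : NullSingletonClass (gaugeMeasure X h) :=
  ⟨gaugeMeasure_singleton h0⟩

/-- Only small diameters matter, and the value `⊤` beyond `ε` makes the gauge monotone everywhere,
as comparison along an isometric embedding requires. -/
theorem gaugeMeasure_eq_mkMetric_monotone {X : Type*} [MetricSpace X] [MeasurableSpace X]
    [BorelSpace X] {h : ℝ → ℝ} {ε : ℝ} (hε : 0 < ε) :
    gaugeMeasure X h = Measure.mkMetric (fun r : ℝ≥0∞ =>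
      if r < ENNReal.ofReal ε then ENNReal.ofReal (h r.toReal) else ⊤) := by
  have hev : ∀ᶠ r in 𝓝 (0 : ℝ≥0∞), r < ENNReal.ofReal ε := Iio_mem_nhds (ENNReal.ofReal_pos.2 hε)
  refine le_antisymm (Measure.mkMetric_mono ?_) (Measure.mkMetric_mono ?_)
  · filter_upwards [hev] with r hr
    rw [if_pos hr]
  · filter_upwards [hev] with r hr
    rw [if_pos hr]

theorem monotone_gauge_extension {h : ℝ → ℝ} {ε : ℝ} (hmono : MonotoneOn h (Set.Ico 0 ε)) :
    Monotone (fun r : ℝ≥0∞ =>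
      if r < ENNReal.ofReal ε then ENNReal.ofReal (h r.toReal) else ⊤) := by
  intro r r' hrr
  simp only
  by_cases h' : r' < ENNReal.ofReal ε
  · rw [if_pos h', if_pos (hrr.trans_lt h')]
    have hlt : ∀ r, r < ENNReal.ofReal ε → r.toReal ∈ Set.Ico 0 ε := fun r hr =>
      ⟨ENNReal.toReal_nonneg, ENNReal.toReal_lt_of_lt_ofReal hr⟩
    exact ENNReal.ofReal_le_ofReal (hmono (hlt _ (hrr.trans_lt h')) (hlt _ h')
      (ENNReal.toReal_mono (h'.trans ENNReal.ofReal_lt_top).ne hrr))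
  · rw [if_neg h']
    exact le_top

/-- The gauge measure of a subspace. -/
theorem map_subtype_gaugeMeasure {X : Type*} [MetricSpace X] [MeasurableSpace X]
    [BorelSpace X] {h : ℝ → ℝ} {ε : ℝ} (hε : 0 < ε) (hmono : MonotoneOn h (Set.Ico 0 ε))
    (s : Set X) :
    (gaugeMeasure s h).map Subtype.val = (gaugeMeasure X h).restrict s := by
  rw [gaugeMeasure_eq_mkMetric_monotone hε, gaugeMeasure_eq_mkMetric_monotone hε]
  set m : ℝ≥0∞ → ℝ≥0∞ := fun r =>
    if r < ENNReal.ofReal ε then ENNReal.ofReal (h r.toReal) else ⊤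
  ext t ht
  rw [Measure.map_apply measurable_subtype_coe ht, Measure.restrict_apply ht]
  have := OuterMeasure.isometry_map_mkMetric m (isometry_subtype_coe (s := s))
    (Or.inl (monotone_gauge_extension hmono))
  have h2 := congrArg (fun m : OuterMeasure X => m t) this
  simp only [OuterMeasure.map_apply, OuterMeasure.restrict_apply] at h2
  rw [OuterMeasure.coe_mkMetric, OuterMeasure.coe_mkMetric, Subtype.range_coe] at h2
  exact h2

end GaugeMeasure

/-! ### Isometry-invariant measures on the line and periodic functions -/

section Periodic

variable {μ : Measure ℝ}

/-- Half-open unit intervals are fundamental domains for the integer translations. No σ-finiteness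
enters, which matters because gauge measures on the line need not have it. -/
theorem setLIntegral_Ioc_eq_of_periodic (hμ : ∀ e : ℝ ≃ᵢ ℝ, μ.map e = μ) {g : ℝ → ℝ≥0∞}
    (hg : Function.Periodic g 1) (a b : ℝ) :
    ∫⁻ x in Set.Ioc a (a + 1), g x ∂μ = ∫⁻ x in Set.Ioc b (b + 1), g x ∂μ := by
  have : VAddInvariantMeasure (AddSubgroup.zmultiples (1 : ℝ)) ℝ μ := by
    refine ⟨fun c s hs => ?_⟩
    have h1 := hμ (IsometryEquiv.addLeft (c : ℝ))
    have h2 := congrArg (fun m : Measure ℝ => m s) h1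
    rw [Measure.map_apply (IsometryEquiv.continuous _).measurable hs] at h2
    exact h2
  refine (isAddFundamentalDomain_Ioc one_pos a μ).setLIntegral_eq
    (isAddFundamentalDomain_Ioc one_pos b μ) _ ?_
  exact hg.map_vadd_zmultiples

theorem setLIntegral_Ioc_add_left (hμ : ∀ e : ℝ ≃ᵢ ℝ, μ.map e = μ) {g : ℝ → ℝ≥0∞}
    (hg : Function.Periodic g 1) (hgm : Measurable g) (c : ℝ) :
    ∫⁻ x in Set.Ioc 0 1, g (c + x) ∂μ = ∫⁻ x in Set.Ioc 0 1, g x ∂μ := by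
  have h1 := setLIntegral_Ioc_eq_of_periodic hμ hg c 0
  rw [zero_add] at h1
  rw [← h1]
  set e := IsometryEquiv.addLeft c with he
  have h2 : Set.Ioc (0 : ℝ) 1 = e ⁻¹' Set.Ioc c (c + 1) := by
    ext x; simp [he]
  conv_rhs => rw [← hμ e]
  rw [setLIntegral_map measurableSet_Ioc hgm e.continuous.measurable, ← h2]
  rfl

theorem setLIntegral_Ioc_sub_left [NullSingletonClass μ] (hμ : ∀ e : ℝ ≃ᵢ ℝ, μ.map e = μ)
    {g : ℝ → ℝ≥0∞} (hg : Function.Periodic g 1) (hgm : Measurable g) (c : ℝ) :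
    ∫⁻ x in Set.Ioc 0 1, g (c - x) ∂μ = ∫⁻ x in Set.Ioc 0 1, g x ∂μ := by
  have h1 := setLIntegral_Ioc_eq_of_periodic hμ hg (c - 1) 0
  rw [zero_add, sub_add_cancel] at h1
  rw [← h1, ← setLIntegral_congr (Ico_ae_eq_Ioc (a := c - 1) (b := c))]
  set e := IsometryEquiv.subLeft c with he
  have h2 : Set.Ioc (0 : ℝ) 1 = e ⁻¹' Set.Ico (c - 1) c := by
    ext x
    simp only [he, Set.mem_Ioc, Set.mem_preimage, IsometryEquiv.subLeft_apply, Set.mem_Ico]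
    constructor <;> rintro ⟨h1, h2⟩ <;> constructor <;> linarith
  conv_rhs => rw [← hμ e]
  rw [setLIntegral_map measurableSet_Ico hgm e.continuous.measurable, ← h2]
  rfl

end Periodic

/-! ### Lebesgue measure as one-dimensional Hausdorff measure. -/

section UnitInterval

theorem map_subtype_hausdorffMeasure :
    (Measure.hausdorffMeasure 1 : Measure (Set.Icc (0 : ℝ) 1)).map Subtype.val =
      volume.restrict (Set.Icc 0 1) := by
  rw [isometry_subtype_coe.map_hausdorffMeasure (Or.inl zero_le_one), hausdorffMeasure_real,
    Subtype.range_coe]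

theorem isProbabilityMeasure_hausdorffMeasure :
    IsProbabilityMeasure (Measure.hausdorffMeasure 1 : Measure (Set.Icc (0 : ℝ) 1)) := by
  constructor
  have h := congrArg (fun m : Measure ℝ => m Set.univ) map_subtype_hausdorffMeasure
  rw [Measure.map_apply measurable_subtype_coe MeasurableSet.univ, Set.preimage_univ] at h
  rw [h]
  simp

theorem volume_map_isometryEquiv (e : ℝ ≃ᵢ ℝ) : (volume : Measure ℝ).map e = volume := by
  rw [← hausdorffMeasure_real, IsometryEquiv.map_hausdorffMeasure]

end UnitInterval

/-! ### A Sidon set of prescribed gauge measure -/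

/-- The Cantor set has finite measure at least `1` without atoms, so its distribution function is
continuous and some initial piece has measure exactly `α`. -/
theorem exists_sidon_set {h : ℝ → ℝ} {ε : ℝ} (hε : 0 < ε) (hmono : MonotoneOn h (Set.Ico 0 ε))
    (h0 : h 0 = 0) (hlim : Tendsto h (𝓝[>] 0) (𝓝 0))
    (hgrow : ∀ C : ℝ, ∃ η > 0, ∀ x, 0 < x → x < η → C * x ≤ h x)
    {α : ℝ} (hα₀ : 0 ≤ α) (hα₁ : α ≤ 1) :
    ∃ S : Set ℝ, MeasurableSet S ∧ S ⊆ Set.Ioo 0 1 ∧ gaugeMeasure ℝ h S = ENNReal.ofReal α ∧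
      ∀ a ∈ S, ∀ b ∈ S, ∀ c ∈ S, ∀ e ∈ S, ∀ z : ℤ, a - b - c + e = z → a = b ∨ a = c := by
  obtain ⟨D⟩ := exists_cantorData hgrow hlim
  have hle := D.gaugeMeasure_cantorSet_le hε hmono
  have hge := D.one_le_gaugeMeasure hε hmono hlim
  have hms := D.measurableSet_cantorSet
  have hna : NullSingletonClass (gaugeMeasure ℝ h) := nullSingletonClass_gaugeMeasure h0
  set ν := (gaugeMeasure ℝ h).restrict D.cantorSet with hν
  have hfin : IsFiniteMeasure ν := by
    constructor
    rw [hν, Measure.restrict_apply_univ]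
    exact hle.trans_lt (by norm_num)
  have hcont : Continuous fun b => ∫ _ in (0 : ℝ)..b, (1 : ℝ) ∂ν :=
    intervalIntegral.continuous_primitive (fun a b => intervalIntegrable_const) 0
  have hval : ∀ b, 0 ≤ b → ∫ _ in (0 : ℝ)..b, (1 : ℝ) ∂ν = ν.real (Set.Ioc 0 b) := by
    intro b hb
    rw [intervalIntegral.integral_of_le hb]
    simp
  have h1 : 1 ≤ ν.real (Set.Ioc 0 1) := by
    have : gaugeMeasure ℝ h D.cantorSet ≤ ν (Set.Ioc 0 1) := by
      rw [← measure_congr (Ico_ae_eq_Ioc (μ := ν)), hν, Measure.restrict_apply measurableSet_Ico]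
      exact measure_mono fun x hx => ⟨hx.1, hx⟩
    rw [measureReal_def, ← ENNReal.toReal_one]
    exact ENNReal.toReal_mono (measure_ne_top _ _) (hge.trans this)
  obtain ⟨t, ht, hteq⟩ := intermediate_value_Icc zero_le_one hcont.continuousOn
    (show α ∈ Set.Icc _ _ by
      rw [hval 0 le_rfl, hval 1 zero_le_one]
      simp only [Set.Ioc_self, measureReal_empty]
      exact ⟨hα₀, hα₁.trans h1⟩)
  simp only at hteq
  rw [hval t ht.1] at hteq
  refine ⟨D.cantorSet ∩ Set.Ioc 0 t, hms.inter measurableSet_Ioc,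
    fun x hx => ⟨hx.2.1, hx.1.1.2⟩, ?_, fun a ha b hb c hc e he z hz =>
      D.sidon ha.1 hb.1 hc.1 he.1 hz⟩
  rw [← hteq, ofReal_measureReal (measure_ne_top _ _), hν, Measure.restrict_apply measurableSet_Ioc,
    Set.inter_comm]

/-! ### Iterated integrals -/

section Iterated

variable {X : Type*} [MeasurableSpace X] {lam mu : Measure X}

theorem iteratedLIntegral_succ_last (mu : Measure X) : ∀ (n : ℕ) (f : (Fin (n + 1) → X) → ℝ≥0∞),
    iteratedLIntegral mu (n + 1) f =
      iteratedLIntegral mu n (fun y => ∫⁻ x, f (Fin.snoc (α := fun _ => X) y x) ∂mu)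
  | 0, f => by
    simp only [iteratedLIntegral]
    refine lintegral_congr fun x => ?_
    congr 1
    ext i
    rw [Fin.fin_one_eq_zero i]
    simp [Fin.snoc]
  | n + 1, f => by
    rw [iteratedLIntegral, iteratedLIntegral]
    refine lintegral_congr fun x => ?_
    rw [iteratedLIntegral_succ_last mu n]
    simp only [Fin.cons_snoc_eq_snoc_cons]

theorem iteratedLIntegral_mono (mu : Measure X) : ∀ (n : ℕ) {f g : (Fin n → X) → ℝ≥0∞},
    (∀ y, f y ≤ g y) → iteratedLIntegral mu n f ≤ iteratedLIntegral mu n g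
  | 0, _, _, h => h _
  | n + 1, _, _, h => lintegral_mono fun _ => iteratedLIntegral_mono mu n fun _ => h _

theorem iteratedLIntegral_mul_const (mu : Measure X) {a : ℝ≥0∞} (ha : a ≠ ⊤) :
    ∀ (n : ℕ) (f : (Fin n → X) → ℝ≥0∞),
    iteratedLIntegral mu n (fun y => f y * a) = iteratedLIntegral mu n f * a
  | 0, f => rfl
  | n + 1, f => by
    simp only [iteratedLIntegral]
    rw [← lintegral_mul_const' _ _ ha]
    exact lintegral_congr fun x => iteratedLIntegral_mul_const mu ha n _

/-- Nested almost-everywhere quantifiers, matching iterated integrals. -/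
def IteratedAE (mu : Measure X) : (n : ℕ) → ((Fin n → X) → Prop) → Prop
  | 0, P => P Fin.elim0
  | n + 1, P => ∀ᵐ x ∂mu, IteratedAE mu n (fun y => P (Fin.cons x y))

theorem IteratedAE.mono : ∀ {n : ℕ} {P Q : (Fin n → X) → Prop},
    IteratedAE mu n P → (∀ y, P y → Q y) → IteratedAE mu n Q
  | 0, _, _, h, hPQ => hPQ _ h
  | _ + 1, _, _, h, hPQ => Eventually.mono h fun _ hx => IteratedAE.mono hx fun _ => hPQ _

theorem IteratedAE.of_forall : ∀ {n : ℕ} {P : (Fin n → X) → Prop}, (∀ y, P y) → IteratedAE mu n P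
  | 0, _, h => h _
  | _ + 1, _, h => Eventually.of_forall fun _ => IteratedAE.of_forall fun _ => h _

theorem IteratedAE.and : ∀ {n : ℕ} {P Q : (Fin n → X) → Prop},
    IteratedAE mu n P → IteratedAE mu n Q → IteratedAE mu n (fun y => P y ∧ Q y)
  | 0, _, _, h, h' => ⟨h, h'⟩
  | _ + 1, _, _, h, h' => by
    filter_upwards [h, h'] with x hx hx' using hx.and hx'

theorem IteratedAE.coord {p : X → Prop} (hp : ∀ᵐ x ∂mu, p x) : ∀ {n : ℕ} (i : Fin n),
    IteratedAE mu n (fun y => p (y i))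
  | n + 1, i => by
    rcases Fin.eq_zero_or_eq_succ i with rfl | ⟨j, rfl⟩
    · exact Eventually.mono hp fun x hx => IteratedAE.of_forall fun y => by simpa using hx
    · exact Eventually.of_forall fun x => by simpa using IteratedAE.coord hp j

theorem IteratedAE.ne [NullSingletonClass mu] : ∀ {n : ℕ} {i j : Fin n}, i < j →
    IteratedAE mu n (fun y => y i ≠ y j)
  | n + 1, i, j, hij => by
    obtain ⟨j, rfl⟩ := Fin.exists_succ_eq.2 (Fin.ne_zero_of_lt hij)
    rcases Fin.eq_zero_or_eq_succ i with rfl | ⟨i, rfl⟩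
    · refine Eventually.of_forall fun x => ?_
      simpa using IteratedAE.coord (p := fun y => x ≠ y)
        (by filter_upwards [compl_mem_ae_iff.2 (measure_singleton (μ := mu) x)] with y hy
            exact fun h => hy h.symm) j
    · exact Eventually.of_forall fun x => by
        simpa using IteratedAE.ne (Fin.succ_lt_succ_iff.1 hij)

/-- The quantifiers are nested in the order of integration because `mu` need not be σ-finite, so
Fubini's theorem cannot be invoked. -/
theorem iteratedLIntegral_eq_zero : ∀ {n : ℕ} {f : (Fin n → X) → ℝ≥0∞},
    IteratedAE mu n (fun y => f y = 0) → iteratedLIntegral mu n f = 0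
  | 0, _, h => h
  | n + 1, f, h => by
    rw [iteratedLIntegral, ← lintegral_zero (μ := mu)]
    exact lintegral_congr_ae (Eventually.mono h fun x hx => iteratedLIntegral_eq_zero hx)

/-- The iterated integral whose outermost variable is integrated with respect to `lam`. -/
noncomputable def rootedLIntegral (lam mu : Measure X) (m : ℕ)
    (f : (Fin (m + 1) → X) → ℝ≥0∞) : ℝ≥0∞ :=
  ∫⁻ x₀, iteratedLIntegral mu m (fun y => f (Fin.cons x₀ y)) ∂lam

theorem rootedLIntegral_succ (m : ℕ) (f : (Fin (m + 2) → X) → ℝ≥0∞) :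
    rootedLIntegral lam mu (m + 1) f =
      rootedLIntegral lam mu m (fun z => ∫⁻ x, f (Fin.snoc (α := fun _ => X) z x) ∂mu) := by
  refine lintegral_congr fun x => ?_
  rw [iteratedLIntegral_succ_last]
  simp only [Fin.cons_snoc_eq_snoc_cons]

theorem rootedLIntegral_mono {m : ℕ} {f g : (Fin (m + 1) → X) → ℝ≥0∞} (h : ∀ y, f y ≤ g y) :
    rootedLIntegral lam mu m f ≤ rootedLIntegral lam mu m g :=
  lintegral_mono fun _ => iteratedLIntegral_mono mu m fun _ => h _

theorem rootedLIntegral_mul_const {a : ℝ≥0∞} (ha : a ≠ ⊤) {m : ℕ}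
    (f : (Fin (m + 1) → X) → ℝ≥0∞) :
    rootedLIntegral lam mu m (fun y => f y * a) = rootedLIntegral lam mu m f * a := by
  rw [rootedLIntegral, rootedLIntegral, ← lintegral_mul_const' _ _ ha]
  exact lintegral_congr fun x => iteratedLIntegral_mul_const mu ha m _

theorem rootedLIntegral_eq_zero {m : ℕ} {f : (Fin (m + 1) → X) → ℝ≥0∞}
    (h : ∀ᵐ x ∂lam, IteratedAE mu m (fun y => f (Fin.cons x y) = 0)) :
    rootedLIntegral lam mu m f = 0 := by
  rw [rootedLIntegral, ← lintegral_zero (μ := lam)]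
  exact lintegral_congr_ae (Eventually.mono h fun x hx => iteratedLIntegral_eq_zero hx)

end Iterated

/-! ### Homomorphism densities of `{0,1}`-valued graphonings -/

section Density

open Classical in
/-- The indicator function of a relation. -/
noncomputable def relKernel {X : Type*} (R : X → X → Prop) (x y : X) : ℝ≥0∞ :=
  if R x y then 1 else 0

theorem relKernel_eq_zero_or_one {X : Type*} (R : X → X → Prop) (x y : X) :
    relKernel R x y = 0 ∨ relKernel R x y = 1 := by
  unfold relKernel
  split_ifs <;> simp

theorem lintegral_relKernel {X : Type*} [MeasurableSpace X] {mu : Measure X} {R : X → X → Prop}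
    {x : X} (hR : MeasurableSet {y | R x y}) : ∫⁻ y, relKernel R x y ∂mu = mu {y | R x y} := by
  rw [← lintegral_indicator_one hR]
  rfl

open Classical in
/-- The indicator function of the homomorphisms from `F` to the relation `R`. -/
noncomputable def homIndicator {X U : Type*} (R : X → X → Prop) (F : SimpleGraph U) (z : U → X) :
    ℝ≥0∞ :=
  if ∀ p q, F.Adj p q → R (z p) (z q) then 1 else 0

theorem graphoningDensity_relKernel {X : Type*} [MeasurableSpace X] (lam mu : Measure X)
    {R : X → X → Prop} (hR : ∀ x y, R x y → R y x) {U : Type*} (F : SimpleGraph U) {m : ℕ}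
    (φ : U ≃ Fin (m + 1)) :
    graphoningDensity lam mu (relKernel R) F φ =
      rootedLIntegral lam mu m (homIndicator R (F.comap φ.symm)) := by
  classical
  unfold graphoningDensity rootedLIntegral
  refine lintegral_congr fun x => ?_
  congr 1
  ext y
  set z : Fin (m + 1) → X := Fin.cons x y
  unfold homIndicator relKernel
  rw [Finset.prod_ite_zero]
  simp only [Finset.prod_const_one, Finset.mem_filter, Finset.mem_univ, true_and,
    SimpleGraph.comap_adj]
  congr 1
  refine propext ⟨fun h p q hpq => ?_, fun h p hp => h _ _ hp.2⟩
  rcases lt_or_gt_of_ne (fun e : p = q => F.loopless.irrefl _ (e ▸ hpq)) with h1 | h1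
  · exact h (p, q) ⟨h1, hpq⟩
  · exact hR _ _ (h (q, p) ⟨h1, hpq.symm⟩)

theorem homIndicator_snoc_le {X : Type*} {R : X → X → Prop} {m : ℕ}
    {F : SimpleGraph (Fin (m + 2))} {u : Fin (m + 1)} (hu : F.Adj u.castSucc (Fin.last _))
    (z : Fin (m + 1) → X) (x : X) :
    homIndicator R F (Fin.snoc (α := fun _ => X) z x) ≤
      homIndicator R (F.comap Fin.castSucc) z * relKernel R (z u) x := by
  unfold homIndicator relKernel
  by_cases h1 : ∀ p q, F.Adj p q →
      R (Fin.snoc (α := fun _ => X) z x p) (Fin.snoc (α := fun _ => X) z x q)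
  · have h2 : R (z u) x := by simpa using h1 _ _ hu
    have h3 : ∀ p q, (F.comap Fin.castSucc).Adj p q → R (z p) (z q) := fun p q hpq => by
      simpa using h1 _ _ hpq
    rw [if_pos h1, if_pos h2, if_pos h3, one_mul]
  · rw [if_neg h1]
    exact zero_le

theorem homIndicator_snoc {X : Type*} {R : X → X → Prop} (hR : ∀ x y, R x y → R y x) {m : ℕ}
    {F : SimpleGraph (Fin (m + 2))} {u : Fin (m + 1)}
    (hu : ∀ v : Fin (m + 1), F.Adj v.castSucc (Fin.last _) ↔ v = u)
    (z : Fin (m + 1) → X) (x : X) :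
    homIndicator R F (Fin.snoc (α := fun _ => X) z x) =
      homIndicator R (F.comap Fin.castSucc) z * relKernel R (z u) x := by
  refine le_antisymm (homIndicator_snoc_le ((hu u).2 rfl) z x) ?_
  unfold homIndicator relKernel
  split_ifs with h1 h2 h3 h3 <;> try simp
  refine h3 fun p q hpq => ?_
  induction p using Fin.lastCases with
  | last =>
    induction q using Fin.lastCases with
    | last => exact absurd rfl hpq.ne
    | cast q =>
      rw [(hu q).1 hpq.symm]
      simpa using hR _ _ h2
  | cast p =>
    induction q using Fin.lastCases with
    | last =>
      rw [(hu p).1 hpq]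
      simpa using h2
    | cast q => simpa using h1 p q hpq

variable {X : Type*} [MeasurableSpace X] {lam mu : Measure X}

open Classical in
-- Integrate out the last node. With a single earlier neighbour it gives the factor `a`. With two of
-- them, over a tree, their images are almost surely distinct and outside `N`, so the integral is a
-- vanishing codegree. If the remaining graph already fails to be a tree, its density `0` times `a`
-- is an upper bound.
theorem rootedLIntegral_homIndicator [IsProbabilityMeasure lam] [NullSingletonClass mu]
    {R : X → X → Prop} (hR : ∀ x y, R x y → R y x) (hRm : ∀ x, MeasurableSet {y | R x y})
    {a : ℝ≥0∞} (ha : a ≠ ⊤) (hdeg : ∀ x, mu {y | R x y} = a) {N : Set X} (hlam : lam N = 0)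
    (hmu : mu N = 0)
    (hcodeg : ∀ x y, x ∉ N → y ∉ N → x ≠ y → mu ({z | R x z} ∩ {z | R y z}) = 0) :
    ∀ {m : ℕ} {F : SimpleGraph (Fin (m + 1))}, OrdConn F →
      rootedLIntegral lam mu m (homIndicator R F) = if UniqueParent F then a ^ m else 0
  | 0, F, hF => by
    have h1 : UniqueParent F := fun i j j' h => by
      have := Fin.lt_def.1 h; omega
    have h2 : ∀ z : Fin 1 → X, homIndicator R F z = 1 := fun z => by
      refine if_pos fun p q hpq => ?_
      exact absurd ((Fin.fin_one_eq_zero p).trans (Fin.fin_one_eq_zero q).symm) hpq.ne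
    simp [rootedLIntegral, iteratedLIntegral, h1, h2]
  | m + 1, F, hF => by
    have ih := rootedLIntegral_homIndicator hR hRm ha hdeg hlam hmu hcodeg hF.comap_castSucc
    have hpt : ∀ (f : ℝ≥0∞) x, ∫⁻ y, f * relKernel R x y ∂mu = f * a := by
      intro f x
      rw [lintegral_const_mul, lintegral_relKernel (hRm x), hdeg]
      exact Measurable.ite (hRm x) measurable_const measurable_const
    rw [rootedLIntegral_succ]
    obtain ⟨u, hu⟩ := hF.exists_adj_last
    split_ifs with hUP
    · have key : ∀ v : Fin (m + 1), F.Adj v.castSucc (Fin.last _) ↔ v = u :=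
        fun v => hUP.adj_last_iff hu v
      simp only [homIndicator_snoc hR key, hpt]
      rw [rootedLIntegral_mul_const ha, ih, if_pos hUP.comap_castSucc, pow_succ]
    · by_cases hUP' : UniqueParent (F.comap Fin.castSucc)
      · obtain ⟨u', hu', hne⟩ : ∃ u' : Fin (m + 1), F.Adj u'.castSucc (Fin.last _) ∧ u' ≠ u := by
          by_contra! hcon
          refine hUP fun i j j' hj hj' h h' => ?_
          obtain ⟨j, rfl⟩ := Fin.exists_castSucc_eq.2 (Fin.ne_last_of_lt hj)
          obtain ⟨j', rfl⟩ := Fin.exists_castSucc_eq.2 (Fin.ne_last_of_lt hj')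
          induction i using Fin.lastCases with
          | last => rw [hcon j h, hcon j' h']
          | cast i => rw [hUP' i j j' hj hj' h h']
        have hz : ∀ z : Fin (m + 1) → X, z u' ≠ z u → z u' ∉ N → z u ∉ N →
            ∫⁻ x, homIndicator R F (Fin.snoc (α := fun _ => X) z x) ∂mu = 0 := by
          intro z h1 h2 h3
          rw [← nonpos_iff_eq_zero, ← hcodeg _ _ h2 h3 h1,
            ← lintegral_indicator_one ((hRm _).inter (hRm _))]
          refine lintegral_mono fun x => ?_
          simp only [homIndicator, Set.indicator, Set.mem_inter_iff, Set.mem_ofPred_eq]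
          split_ifs with h4 h5 <;> try simp
          exact h5 ⟨by simpa using h4 _ _ hu', by simpa using h4 _ _ hu⟩
        have hN1 : ∀ᵐ x ∂mu, x ∉ N := measure_eq_zero_iff_ae_notMem.1 hmu
        have hN2 : ∀ᵐ x ∂lam, x ∉ N := measure_eq_zero_iff_ae_notMem.1 hlam
        have hcN : ∀ w : Fin (m + 1), ∀ᵐ x ∂lam, IteratedAE mu m
            (fun y => (Fin.cons x y : Fin (m + 1) → X) w ∉ N) := by
          intro w
          rcases Fin.eq_zero_or_eq_succ w with rfl | ⟨w, rfl⟩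
          · filter_upwards [hN2] with x hx
            exact IteratedAE.of_forall fun y => by simpa using hx
          · exact Eventually.of_forall fun x => by simpa using IteratedAE.coord hN1 w
        have hcne : ∀ w w' : Fin (m + 1), w < w' → ∀ᵐ x ∂lam, IteratedAE mu m
            (fun y => (Fin.cons x y : Fin (m + 1) → X) w ≠ (Fin.cons x y : Fin (m + 1) → X) w') := by
          intro w w' hw
          refine Eventually.of_forall fun x => ?_
          obtain ⟨w', rfl⟩ := Fin.exists_succ_eq.2 (Fin.ne_zero_of_lt hw)
          rcases Fin.eq_zero_or_eq_succ w with rfl | ⟨w, rfl⟩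
          · simpa using IteratedAE.coord (p := fun y => x ≠ y)
              (by filter_upwards [compl_mem_ae_iff.2 (measure_singleton (μ := mu) x)] with y hy
                  exact fun h => hy h.symm) w'
          · simpa using IteratedAE.ne (Fin.succ_lt_succ_iff.1 hw)
        have hcne' : ∀ᵐ x ∂lam, IteratedAE mu m
            (fun y => (Fin.cons x y : Fin (m + 1) → X) u' ≠ (Fin.cons x y : Fin (m + 1) → X) u) := by
          rcases lt_or_gt_of_ne hne with h | h
          · exact hcne _ _ h
          · filter_upwards [hcne _ _ h] with x hx
            exact hx.mono fun y hy => hy.symm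
        refine rootedLIntegral_eq_zero ?_
        filter_upwards [hcN u, hcN u', hcne'] with x h1 h2 h3
        exact ((h1.and h2).and h3).mono fun y hy => hz _ hy.2 hy.1.2 hy.1.1
      · rw [if_neg hUP'] at ih
        rw [← nonpos_iff_eq_zero]
        calc _ ≤ rootedLIntegral lam mu m (fun z => homIndicator R (F.comap Fin.castSucc) z * a) :=
              rootedLIntegral_mono fun z => by
                rw [← hpt _ (z u)]
                exact lintegral_mono fun x => homIndicator_snoc_le hu z x
          _ = 0 := by rw [rootedLIntegral_mul_const ha, ih, zero_mul]

end Density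

/-- The nodes with labels up to `i` span a connected graph with at least two nodes, so `i` has a
neighbour among them. -/
theorem IsAdmissibleLabelling.ordConn {U : Type*} {F : SimpleGraph U} {m : ℕ}
    {φ : U ≃ Fin (m + 1)} (hφ : IsAdmissibleLabelling F φ) : OrdConn (F.comap φ.symm) := by
  intro i hi
  have hi0 : 0 < (i : ℕ) := Nat.pos_of_ne_zero fun h => hi (Fin.ext h)
  have hc := hφ (i + 1) (by omega) (by omega)
  let a : {u : U | (φ u : ℕ) < i + 1} := ⟨φ.symm i, by simp⟩
  let b : {u : U | (φ u : ℕ) < i + 1} := ⟨φ.symm 0, by simp⟩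
  have hab : a ≠ b := fun h => hi (φ.symm.injective (congrArg Subtype.val h))
  have : Nontrivial {u : U | (φ u : ℕ) < i + 1} := ⟨a, b, hab⟩
  obtain ⟨c, hc⟩ := hc.preconnected.exists_adj_of_nontrivial a
  have hadj : F.Adj (φ.symm i) c.1 := hc
  refine ⟨φ c.1, lt_of_le_of_ne (Fin.le_def.2 (Nat.lt_succ_iff.1 c.2)) ?_, ?_⟩
  · intro h
    exact hadj.ne (φ.symm_apply_eq.2 (h.symm))
  · simpa using hadj.symm

/-! ### The graphoning on the unit interval defined by a Sidon set -/

section Sidon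

/-- Adjacency of `x` and `y` when `x + y` lies in `S` modulo `1`. -/
def sumRel (S : Set ℝ) (x y : Set.Icc (0 : ℝ) 1) : Prop :=
  Int.fract ((x : ℝ) + y) ∈ S

theorem sumRel_symm {S : Set ℝ} (x y : Set.Icc (0 : ℝ) 1) (h : sumRel S x y) : sumRel S y x := by
  unfold sumRel at *
  rwa [add_comm]

/-- The indicator function of the periodic extension of a subset of the line. -/
noncomputable def fractIndicator (A : Set ℝ) (x : ℝ) : ℝ≥0∞ :=
  A.indicator 1 (Int.fract x)

theorem measurable_fractIndicator {A : Set ℝ} (hA : MeasurableSet A) :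
    Measurable (fractIndicator A) :=
  (measurable_one.indicator hA).comp measurable_fract

theorem fractIndicator_add_one (A : Set ℝ) (x : ℝ) :
    fractIndicator A (x + 1) = fractIndicator A x := by
  simp [fractIndicator]

theorem relKernel_sumRel (S : Set ℝ) (x y : Set.Icc (0 : ℝ) 1) :
    relKernel (sumRel S) x y = fractIndicator S (x + y) := by
  by_cases h : Int.fract ((x : ℝ) + y) ∈ S <;> simp [relKernel, sumRel, fractIndicator, h]

variable {mu : Measure (Set.Icc (0 : ℝ) 1)} {ρ : Measure ℝ}

theorem setLIntegral_subtype_eq [NullSingletonClass ρ]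
    (hmu : mu.map Subtype.val = ρ.restrict (Set.Icc 0 1))
    {A : Set (Set.Icc (0 : ℝ) 1)} (hA : MeasurableSet A) {f : ℝ → ℝ≥0∞} (hf : Measurable f) :
    ∫⁻ y in A, f y ∂mu =
      ∫⁻ u in Set.Ioc 0 1, f u * fractIndicator (Subtype.val '' A) u ∂ρ := by
  have hA' : MeasurableSet (Subtype.val '' A : Set ℝ) := MeasurableSet.subtype_image measurableSet_Icc hA
  calc ∫⁻ y in A, f y ∂mu
      = ∫⁻ y, (fun u => f u * (Subtype.val '' A).indicator 1 u) (y : ℝ) ∂mu := by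
        rw [← lintegral_indicator hA]
        refine lintegral_congr fun y => ?_
        by_cases hy : y ∈ A
        · have : (y : ℝ) ∈ (Subtype.val '' A : Set ℝ) := ⟨y, hy, rfl⟩
          simp only [Set.indicator_of_mem hy, Set.indicator_of_mem this, Pi.one_apply, mul_one]
        · simp [hy]
    _ = ∫⁻ u in Set.Icc 0 1, f u * (Subtype.val '' A).indicator 1 u ∂ρ := by
        rw [← hmu]
        exact (lintegral_map (hf.mul (measurable_one.indicator hA')) measurable_subtype_coe).symm
    _ = ∫⁻ u in Set.Ioo 0 1, f u * (Subtype.val '' A).indicator 1 u ∂ρ :=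
        setLIntegral_congr Ioo_ae_eq_Icc.symm
    _ = ∫⁻ u in Set.Ioo 0 1, f u * fractIndicator (Subtype.val '' A) u ∂ρ := by
        refine setLIntegral_congr_fun measurableSet_Ioo fun u hu => ?_
        have : Int.fract u = u := Int.fract_eq_self.2 ⟨hu.1.le, hu.2⟩
        simp only [fractIndicator, this]
    _ = _ := setLIntegral_congr Ioo_ae_eq_Ioc

theorem setLIntegral_fractIndicator [NullSingletonClass ρ] {S : Set ℝ} (hS : MeasurableSet S)
    (f : ℝ → ℝ≥0∞) (hS1 : S ⊆ Set.Ioo 0 1) :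
    ∫⁻ u in Set.Ioc 0 1, fractIndicator S u * f u ∂ρ = ∫⁻ u in S, f u ∂ρ := by
  calc _ = ∫⁻ u in Set.Ioo 0 1, fractIndicator S u * f u ∂ρ :=
        setLIntegral_congr Ioo_ae_eq_Ioc.symm
    _ = ∫⁻ u in Set.Ioo 0 1, S.indicator f u ∂ρ := by
        refine setLIntegral_congr_fun measurableSet_Ioo fun u hu => ?_
        have : Int.fract u = u := Int.fract_eq_self.2 ⟨hu.1.le, hu.2⟩
        by_cases hu' : u ∈ S <;> simp [fractIndicator, this, hu']
    _ = _ := by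
        rw [lintegral_indicator hS, Measure.restrict_restrict hS,
          Set.inter_eq_self_of_subset_left hS1]

/-- The substitution `u = x + y` modulo `1` moves the integral onto `S`, where the measure will be
finite even if `ρ` is not σ-finite. -/
theorem setLIntegral_relKernel_sumRel [NullSingletonClass ρ]
    (hρ : ∀ e : ℝ ≃ᵢ ℝ, ρ.map e = ρ) (hmu : mu.map Subtype.val = ρ.restrict (Set.Icc 0 1))
    {S : Set ℝ} (hS : MeasurableSet S) (hS1 : S ⊆ Set.Ioo 0 1)
    {A : Set (Set.Icc (0 : ℝ) 1)} (hA : MeasurableSet A) (x : Set.Icc (0 : ℝ) 1) :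
    ∫⁻ y in A, relKernel (sumRel S) x y ∂mu =
      ∫⁻ u in S, fractIndicator (Subtype.val '' A) (u - x) ∂ρ := by
  have hA' : MeasurableSet (Subtype.val '' A : Set ℝ) := MeasurableSet.subtype_image measurableSet_Icc hA
  have hSm := measurable_fractIndicator hS
  have hAm := measurable_fractIndicator hA'
  simp only [relKernel_sumRel]
  rw [setLIntegral_subtype_eq (f := fun y => fractIndicator S (x + y)) hmu hA (by fun_prop),
    ← setLIntegral_fractIndicator hS _ hS1]
  have := setLIntegral_Ioc_add_left hρ
    (g := fun u => fractIndicator S u * fractIndicator (Subtype.val '' A) (u - x)) (fun u => by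
      simp only [fractIndicator_add_one, add_sub_right_comm]) (by fun_prop) (x : ℝ)
  rw [← this]
  simp only [add_sub_cancel_left]

/-- Degrees are integrals over `S`, so Tonelli's theorem is applied to the finite measure
`ρ.restrict S`. For each `u` in `S` the reflection `x ↦ u - x` of the circle preserves Lebesgue
measure and exchanges the roles of `A` and `B`. -/
theorem isGraphoning_sumRel {lam : Measure (Set.Icc (0 : ℝ) 1)} [IsProbabilityMeasure lam]
    [NullSingletonClass ρ] (hρ : ∀ e : ℝ ≃ᵢ ℝ, ρ.map e = ρ)
    (hmu : mu.map Subtype.val = ρ.restrict (Set.Icc 0 1))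
    (hlam : lam.map Subtype.val = volume.restrict (Set.Icc 0 1))
    {S : Set ℝ} (hS : MeasurableSet S) (hS1 : S ⊆ Set.Ioo 0 1) (hρS : ρ S ≤ 1) :
    IsGraphoning lam mu (relKernel (sumRel S)) := by
  have hfin : IsFiniteMeasure (ρ.restrict S) :=
    ⟨by rw [Measure.restrict_apply_univ]; exact hρS.trans_lt ENNReal.one_lt_top⟩
  have hmeas : ∀ A : Set (Set.Icc (0 : ℝ) 1), MeasurableSet A → Measurable
      (fun x : ℝ => ∫⁻ u in S, fractIndicator (Subtype.val '' A) (u - x) ∂ρ) := by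
    intro A hA
    have := measurable_fractIndicator (MeasurableSet.subtype_image measurableSet_Icc hA)
    exact Measurable.lintegral_prod_right' (ν := ρ.restrict S)
      (f := fun p : ℝ × ℝ => fractIndicator (Subtype.val '' A) (p.2 - p.1)) (by fun_prop)
  refine ⟨inferInstance, fun x y => ?_, fun x y => ?_, ?_, fun x => ?_, fun A hA => ?_,
    fun A B hA hB => ?_⟩
  · rcases relKernel_eq_zero_or_one (sumRel S) x y with h | h <;> simp [h]
  · rw [relKernel_sumRel, relKernel_sumRel, add_comm]
  · have := measurable_fractIndicator hS
    have h2 : Function.uncurry (relKernel (sumRel S)) =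
        fun p => fractIndicator S ((p.1 : ℝ) + p.2) := by
      ext p
      exact relKernel_sumRel S p.1 p.2
    rw [h2]
    exact this.comp (by fun_prop)
  · rw [← setLIntegral_univ, setLIntegral_relKernel_sumRel hρ hmu hS hS1 MeasurableSet.univ]
    refine le_trans ?_ hρS
    calc _ ≤ ∫⁻ u in S, 1 ∂ρ := lintegral_mono fun u => by
            exact Set.indicator_le_self' (fun _ _ => zero_le) _
      _ = ρ S := by simp
  · simp only [setLIntegral_relKernel_sumRel hρ hmu hS hS1 hA]
    exact (hmeas A hA).comp measurable_subtype_coe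
  · simp only [setLIntegral_relKernel_sumRel hρ hmu hS hS1 hA,
      setLIntegral_relKernel_sumRel hρ hmu hS hS1 hB]
    rw [setLIntegral_subtype_eq hlam hA (hmeas B hB), setLIntegral_subtype_eq hlam hB (hmeas A hA)]
    have hAm := measurable_fractIndicator (MeasurableSet.subtype_image measurableSet_Icc hA)
    have hBm := measurable_fractIndicator (MeasurableSet.subtype_image measurableSet_Icc hB)
    have key : ∀ C D : Set (Set.Icc (0 : ℝ) 1),
        Measurable (fractIndicator (Subtype.val '' C)) →
        Measurable (fractIndicator (Subtype.val '' D)) →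
        ∫⁻ x in Set.Ioc (0 : ℝ) 1, (∫⁻ u in S, fractIndicator (Subtype.val '' D) (u - x) ∂ρ) *
          fractIndicator (Subtype.val '' C) x =
        ∫⁻ u in S, (∫⁻ x in Set.Ioc (0 : ℝ) 1, fractIndicator (Subtype.val '' D) (u - x) *
          fractIndicator (Subtype.val '' C) x) ∂ρ := by
      intro C D hC hD
      rw [lintegral_lintegral_swap]
      · refine lintegral_congr fun x => ?_
        rw [lintegral_mul_const _ (by fun_prop)]
      · exact Measurable.aemeasurable (by fun_prop)
    rw [key A B hAm hBm, key B A hBm hAm]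
    refine lintegral_congr fun u => ?_
    rw [← setLIntegral_Ioc_sub_left volume_map_isometryEquiv (c := u)]
    · simp only [sub_sub_cancel]
      exact lintegral_congr fun x => mul_comm _ _
    · intro x
      have h1 : fractIndicator (Subtype.val '' B) (u - (x + 1)) =
          fractIndicator (Subtype.val '' B) (u - x) := by
        rw [← fractIndicator_add_one]
        congr 1
        ring
      simp only [fractIndicator_add_one, h1]
    · fun_prop

theorem measurableSet_sumRel {S : Set ℝ} (hS : MeasurableSet S) (x : Set.Icc (0 : ℝ) 1) :
    MeasurableSet {y | sumRel S x y} := by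
  have : Measurable fun y : Set.Icc (0 : ℝ) 1 => Int.fract ((x : ℝ) + y) := by fun_prop
  exact this hS

theorem measure_sumRel [NullSingletonClass ρ]
    (hρ : ∀ e : ℝ ≃ᵢ ℝ, ρ.map e = ρ) (hmu : mu.map Subtype.val = ρ.restrict (Set.Icc 0 1))
    {S : Set ℝ} (hS : MeasurableSet S) (hS1 : S ⊆ Set.Ioo 0 1) (x : Set.Icc (0 : ℝ) 1) :
    mu {y | sumRel S x y} = ρ S := by
  have hm := measurable_fractIndicator hS
  rw [← lintegral_relKernel (measurableSet_sumRel hS x), ← setLIntegral_univ]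
  simp only [relKernel_sumRel]
  have h1 := setLIntegral_subtype_eq (f := fun y => fractIndicator S (x + y)) hmu
    MeasurableSet.univ (by fun_prop)
  have h2 := setLIntegral_subtype_eq (f := fun y => fractIndicator S y) hmu
    MeasurableSet.univ (by fun_prop)
  have h3 : ∀ u : ℝ, fractIndicator (Subtype.val '' (Set.univ : Set (Set.Icc (0 : ℝ) 1))) u = 1 := by
    intro u
    have : Int.fract u ∈ Set.Icc (0 : ℝ) 1 := ⟨Int.fract_nonneg u, (Int.fract_lt_one u).le⟩
    simp only [fractIndicator, Set.image_univ, Subtype.range_coe]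
    rw [Set.indicator_of_mem this, Pi.one_apply]
  rw [h1]
  simp only [h3, mul_one]
  rw [setLIntegral_Ioc_add_left hρ (fractIndicator_add_one S) hm]
  simpa using setLIntegral_fractIndicator (ρ := ρ) hS (fun _ => 1) hS1

/-- Fix a common neighbour `w`. Any common neighbour `z` gives an integer relation between four
elements of `S`, so `x - y` or `z - w` is an integer. The first is impossible for distinct points
below `1`; the second leaves countably many `z`. -/
theorem codegree_sumRel_eq_zero [NullSingletonClass mu] {S : Set ℝ}
    (hSidon : ∀ a ∈ S, ∀ b ∈ S, ∀ c ∈ S, ∀ e ∈ S, ∀ z : ℤ, a - b - c + e = z → a = b ∨ a = c)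
    {x y : Set.Icc (0 : ℝ) 1} (hx : x ≠ 1) (hy : y ≠ 1) (hxy : x ≠ y) :
    mu ({z | sumRel S x z} ∩ {z | sumRel S y z}) = 0 := by
  refine Set.Countable.measure_zero ?_ _
  rcases Set.eq_empty_or_nonempty ({z | sumRel S x z} ∩ {z | sumRel S y z}) with h | ⟨w, hw⟩
  · rw [h]; exact Set.countable_empty
  refine Set.Countable.mono (s₂ := Subtype.val ⁻¹' (Set.range fun n : ℤ => (w : ℝ) + n)) ?_
    ((Set.countable_range _).preimage_of_injOn Subtype.val_injective.injOn)
  intro z hz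
  have hlt : ∀ t : Set.Icc (0 : ℝ) 1, t ≠ 1 → (t : ℝ) < 1 := fun t ht =>
    lt_of_le_of_ne t.2.2 fun h => ht (Subtype.ext h)
  have e1 := Int.floor_add_fract ((x : ℝ) + z)
  have e2 := Int.floor_add_fract ((y : ℝ) + z)
  have e3 := Int.floor_add_fract ((x : ℝ) + w)
  have e4 := Int.floor_add_fract ((y : ℝ) + w)
  rcases hSidon _ hz.1 _ hz.2 _ hw.1 _ hw.2
    (-⌊(x : ℝ) + z⌋ + ⌊(y : ℝ) + z⌋ + ⌊(x : ℝ) + w⌋ - ⌊(y : ℝ) + w⌋)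
    (by push_cast; linarith) with h | h
  · exfalso
    have h5 : (x : ℝ) - y = ((⌊(x : ℝ) + z⌋ - ⌊(y : ℝ) + z⌋ : ℤ) : ℝ) := by
      push_cast; linarith
    set n := ⌊(x : ℝ) + z⌋ - ⌊(y : ℝ) + z⌋
    have h6 : (-1 : ℝ) < n := by linarith [x.2.1, hlt y hy]
    have h7 : (n : ℝ) < 1 := by linarith [y.2.1, hlt x hx]
    have h8 : n = 0 := by
      have h9 : -1 < n := by exact_mod_cast h6
      have h10 : n < 1 := by exact_mod_cast h7
      omega
    rw [h8] at h5
    exact hxy (Subtype.ext (by push_cast at h5; linarith))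
  · refine ⟨⌊(x : ℝ) + z⌋ - ⌊(x : ℝ) + w⌋, ?_⟩
    push_cast
    linarith

end Sidon

open Classical in
/-- For a gauge function vanishing at `0` but growing faster than every linear function there is
an `α`-regular graphoning on the unit interval in which cycles have density `0`. -/
theorem exists_acyclic_graphoning {h : ℝ → ℝ} (hg : IsGauge h) (h0 : h 0 = 0)
    (hgrow : ∀ C : ℝ, ∃ η > 0, ∀ x, 0 < x → x < η → C * x ≤ h x)
    {α : ℝ} (hα₀ : 0 ≤ α) (hα₁ : α ≤ 1) :
    ∃ R : Set.Icc (0 : ℝ) 1 → Set.Icc (0 : ℝ) 1 → Prop,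
      IsHausdorffGraphoning (Set.Icc (0 : ℝ) 1) h (relKernel R) ∧
      ∀ (U : Type) (F : SimpleGraph U) (m : ℕ) (φ : U ≃ Fin (m + 1)), IsAdmissibleLabelling F φ →
        graphoningDensity (Measure.hausdorffMeasure 1) (gaugeMeasure (Set.Icc (0 : ℝ) 1) h)
          (relKernel R) F φ = if F.IsAcyclic then ENNReal.ofReal α ^ m else 0 := by
  obtain ⟨ε, hε, hnn, hmono, hcont⟩ := hg
  have hlim : Tendsto h (𝓝[>] 0) (𝓝 0) := by
    have := hcont 0 ⟨le_rfl, hε⟩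
    rw [ContinuousWithinAt, h0] at this
    exact this.mono_left (nhdsWithin_mono _ Set.Ioi_subset_Ici_self)
  obtain ⟨S, hS, hS1, hSα, hSidon⟩ := exists_sidon_set hε hmono h0 hlim hgrow hα₀ hα₁
  have hna : NullSingletonClass (gaugeMeasure ℝ h) := nullSingletonClass_gaugeMeasure h0
  have hna' : NullSingletonClass (gaugeMeasure (Set.Icc (0 : ℝ) 1) h) :=
    nullSingletonClass_gaugeMeasure h0
  have hna'' : NullSingletonClass (Measure.hausdorffMeasure 1 : Measure (Set.Icc (0 : ℝ) 1)) :=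
    Measure.nullSingletonClass_hausdorff _ one_pos
  have hmu := map_subtype_gaugeMeasure hε hmono (Set.Icc (0 : ℝ) 1)
  have hp := isProbabilityMeasure_hausdorffMeasure
  have hρ := gaugeMeasure_map_isometryEquiv (X := ℝ) h
  refine ⟨sumRel S, ⟨⟨ε, hε, hnn, hmono, hcont⟩, isGraphoning_sumRel hρ hmu
    map_subtype_hausdorffMeasure hS hS1 ?_⟩, fun U F m φ hφ => ?_⟩
  · rw [hSα]
    exact ENNReal.ofReal_le_one.2 hα₁
  · have hiso : (F.comap φ.symm).IsAcyclic ↔ F.IsAcyclic := (SimpleGraph.Iso.comap φ.symm F).isAcyclic_iff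
    have hord := hφ.ordConn
    have hu : UniqueParent (F.comap φ.symm) ↔ F.IsAcyclic := by
      rw [← hiso]
      exact ⟨hord.isAcyclic, hord.uniqueParent⟩
    rw [graphoningDensity_relKernel _ _ sumRel_symm,
      rootedLIntegral_homIndicator sumRel_symm (measurableSet_sumRel hS) ENNReal.ofReal_ne_top
        -- The point `1` is discarded because it has the same neighbours as `0`.
        (fun x => (measure_sumRel hρ hmu hS hS1 x).trans hSα) (N := {1}) (measure_singleton _)
        (measure_singleton _)
        (fun x y hx hy hxy => codegree_sumRel_eq_zero hSidon hx hy hxy) hord]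
    simp only [hu]

/-! ### A compact group containing a free product of groups of order two -/

section CompactGroup

/-- Words of length at most `n` over `ι` in which consecutive letters differ: the vertices of a
ball in the Cayley tree. -/
abbrev ReducedBall (ι : Type) (n : ℕ) : Type :=
  {l : List ι // l.IsChain (· ≠ ·) ∧ l.length ≤ n}

instance (ι : Type) [Finite ι] (n : ℕ) : Finite (ReducedBall ι n) :=
  ((List.finite_length_le ι n).subset fun _ h => h.2).to_subtype

open Classical in
/-- Left multiplication by a letter on reduced words, where words that would become longer than `n`
are fixed. -/
noncomputable def swapLetter {ι : Type} (n : ℕ) (i : ι) (l : List ι) : List ι :=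
  if l.head? = some i then l.tail else if l.length + 1 ≤ n then i :: l else l

theorem isChain_cons_of_head? {ι : Type} {i : ι} {l : List ι} (hl : l.IsChain (· ≠ ·))
    (h : l.head? ≠ some i) : (i :: l).IsChain (· ≠ ·) := by
  rw [List.isChain_cons]
  exact ⟨fun j hj hij => h (hij ▸ hj), hl⟩

theorem swapLetter_mem {ι : Type} {n : ℕ} (i : ι) {l : List ι}
    (hl : l.IsChain (· ≠ ·) ∧ l.length ≤ n) :
    (swapLetter n i l).IsChain (· ≠ ·) ∧ (swapLetter n i l).length ≤ n := by
  unfold swapLetter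
  split_ifs with h1 h2
  · exact ⟨hl.1.tail, by rw [List.length_tail]; omega⟩
  · exact ⟨isChain_cons_of_head? hl.1 h1, h2⟩
  · exact hl

/-- In a reduced word the letter after a leading `i` differs from `i`, so removing and prepending
`i` undo each other; the other words are fixed. -/
theorem swapLetter_swapLetter {ι : Type} {n : ℕ} (i : ι) {l : List ι}
    (hl : l.IsChain (· ≠ ·) ∧ l.length ≤ n) : swapLetter n i (swapLetter n i l) = l := by
  by_cases h1 : l.head? = some i
  · obtain ⟨t, rfl⟩ : ∃ t, l = i :: t := ⟨l.tail, (List.cons_head?_tail h1).symm⟩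
    have h2 : t.head? ≠ some i := fun h => (List.isChain_cons.1 hl.1).1 i h rfl
    have h3 : t.length + 1 ≤ n := hl.2
    simp [swapLetter, h2, h3]
  · by_cases h2 : l.length + 1 ≤ n <;> simp [swapLetter, h1, h2]

/-- The permutation of a ball given by a letter. -/
noncomputable def swapLetterPerm {ι : Type} (n : ℕ) (i : ι) : Equiv.Perm (ReducedBall ι n) :=
  Function.Involutive.toPerm (fun l => ⟨swapLetter n i l.1, swapLetter_mem i l.2⟩)
    fun l => Subtype.ext (swapLetter_swapLetter i l.2)

/-- The permutations of a ball. -/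
abbrev BallPerm (ι : Type) (n : ℕ) : Type := Equiv.Perm (ReducedBall ι n)

instance (ι : Type) (n : ℕ) : TopologicalSpace (BallPerm ι n) := ⊥

instance (ι : Type) (n : ℕ) : DiscreteTopology (BallPerm ι n) := ⟨rfl⟩

/-- The product of the permutation groups of all balls. -/
def BallGroup (ι : Type) : Type := ∀ n, BallPerm ι n

noncomputable instance (ι : Type) : Group (BallGroup ι) :=
  inferInstanceAs (Group (∀ n, BallPerm ι n))

instance (ι : Type) : TopologicalSpace (BallGroup ι) :=
  inferInstanceAs (TopologicalSpace (∀ n, BallPerm ι n))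

instance (ι : Type) : IsTopologicalGroup (BallGroup ι) :=
  inferInstanceAs (IsTopologicalGroup (∀ n, BallPerm ι n))

instance (ι : Type) [Finite ι] : CompactSpace (BallGroup ι) :=
  inferInstanceAs (CompactSpace (∀ n, BallPerm ι n))

instance (ι : Type) [Finite ι] : PolishSpace (BallGroup ι) :=
  inferInstanceAs (PolishSpace (∀ n, BallPerm ι n))

instance (ι : Type) : MeasurableSpace (BallGroup ι) := borel _

instance (ι : Type) : BorelSpace (BallGroup ι) := ⟨rfl⟩

/-- The generating involutions. -/
noncomputable def ballGen {ι : Type} (i : ι) : BallGroup ι :=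
  fun n => swapLetterPerm n i

theorem ballGen_mul_self {ι : Type} (i : ι) : ballGen i * ballGen i = 1 := by
  funext n
  exact Equiv.ext fun l => Subtype.ext (swapLetter_swapLetter i l.2)

theorem ballGen_mul_ballGen_mul {ι : Type} (i : ι) (g : BallGroup ι) :
    ballGen i * (ballGen i * g) = g := by
  rw [← mul_assoc, ballGen_mul_self, one_mul]

/-- The product of the generators given by a word, the first letter being the rightmost factor. -/
noncomputable def wordProd {ι : Type} : List ι → BallGroup ι
  | [] => 1
  | i :: l => wordProd l * ballGen i

/-- As long as nothing cancels and the ball is not left, each generator prepends its letter. -/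
theorem wordProd_apply {ι : Type} {n : ℕ} : ∀ (l : List ι) (s : ReducedBall ι n),
    (l.reverse ++ s.1).IsChain (· ≠ ·) → l.length + s.1.length ≤ n →
      (wordProd l n s).1 = l.reverse ++ s.1
  | [], s, _, _ => rfl
  | i :: l, s, h1, h2 => by
    have h3 : (i :: s.1).IsChain (· ≠ ·) := by
      have : (l.reverse ++ (i :: s.1)).IsChain (· ≠ ·) := by simpa using h1
      exact this.right_of_append
    have h4 : s.1.head? ≠ some i := fun h => (List.isChain_cons.1 h3).1 i h rfl
    have h5 : s.1.length + 1 ≤ n := by simp at h2; omega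
    have h6 : swapLetterPerm n i s = ⟨i :: s.1, h3, h5⟩ := by
      refine Subtype.ext ?_
      change swapLetter n i s.1 = _
      rw [swapLetter, if_neg h4, if_pos h5]
    have h7 : wordProd (i :: l) n s = wordProd l n (swapLetterPerm n i s) := rfl
    rw [h7, h6, wordProd_apply l _ (by simpa using h1) (by simp at h2 ⊢; omega)]
    simp

/-- A reduced word moves the empty word in the ball whose radius is its length. So the generators
satisfy no relation beyond being involutions. -/
theorem wordProd_ne_one {ι : Type} {l : List ι} (hl : l.IsChain (· ≠ ·)) (hne : l ≠ []) :
    wordProd l ≠ 1 := by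
  intro h
  have hrev : l.reverse.IsChain (· ≠ ·) := by
    rw [List.isChain_reverse]
    exact hl.imp fun a b hab => hab.symm
  have h1 := wordProd_apply (n := l.length) l ⟨[], by simp, by simp⟩ (by simpa using hrev) (by simp)
  rw [h] at h1
  have h2 : ([] : List ι) = l.reverse ++ [] := h1
  simp at h2
  exact hne h2

theorem ballGen_injective {ι : Type} : Function.Injective (ballGen (ι := ι)) := by
  intro i j h
  by_contra hne
  refine wordProd_ne_one (l := [i, j]) (by simpa using hne) (by simp) ?_
  simp [wordProd, h, ballGen_mul_self]

/-- A generator acts nontrivially on each ball of positive radius, so its single components give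
infinitely many elements. This is what makes Haar measure atomless. -/
theorem infinite_ballGroup {ι : Type} [Nonempty ι] : Infinite (BallGroup ι) := by
  obtain ⟨i⟩ := ‹Nonempty ι›
  refine Infinite.of_injective
    (fun N : ℕ => (Pi.mulSingle (N + 1) (ballGen i (N + 1)) : BallGroup ι)) fun N N' h => ?_
  by_contra hne
  have h1 := congrFun h (N + 1)
  simp only [Pi.mulSingle_eq_same] at h1
  rw [Pi.mulSingle_eq_of_ne (by omega)] at h1
  have h2 := congrArg Subtype.val (Equiv.congr_fun h1 ⟨[], by simp, by simp⟩)
  have h3 : swapLetter (N + 1) i [] = [] := h2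
  simp [swapLetter] at h3

/-- The Cayley graph of the generating involutions. -/
def ballCayley (ι : Type) : SimpleGraph (BallGroup ι) where
  Adj g g' := ∃ i : ι, g' = ballGen i * g
  symm := ⟨by
    rintro g g' ⟨i, rfl⟩
    exact ⟨i, (ballGen_mul_ballGen_mul i g).symm⟩⟩
  loopless := ⟨by
    rintro g ⟨i, hi⟩
    refine wordProd_ne_one (l := [i]) (by simp) (by simp) ?_
    simpa [wordProd] using hi⟩

/-- A repeated letter would be a step back, so a path spells a reduced word. The clause about the
first edge lets the induction compare the next letter with it. -/
theorem exists_word_of_isPath {ι : Type} : ∀ {g g' : BallGroup ι} (p : (ballCayley ι).Walk g g'),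
    p.IsPath → ∃ l : List ι, l.IsChain (· ≠ ·) ∧ g' = wordProd l * g ∧
      ∀ i ∈ l.head?, s(g, ballGen i * g) ∈ p.edges
  | g, _, .nil, _ => ⟨[], by simp, by simp [wordProd], by simp⟩
  | g, g', .cons (v := v) h p, hp => by
    rw [SimpleGraph.Walk.cons_isPath_iff] at hp
    obtain ⟨l, hl, hg, hhead⟩ := exists_word_of_isPath p hp.1
    obtain ⟨i, rfl⟩ := id h
    refine ⟨i :: l, ?_, by rw [hg, wordProd, mul_assoc], fun j hj => ?_⟩
    · rw [List.isChain_cons]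
      refine ⟨fun j hj hij => hp.2 ?_, hl⟩
      have := hhead j hj
      rw [← hij, ballGen_mul_ballGen_mul] at this
      exact p.snd_mem_support_of_mem_edges this
    · obtain rfl : i = j := by simpa using hj
      simp

/-- A cycle is an edge followed by a path that avoids this edge, so it would spell a nonempty
reduced word with product `1`. -/
theorem ballCayley_isAcyclic (ι : Type) : (ballCayley ι).IsAcyclic := by
  intro g c hc
  cases c with
  | nil => exact hc.not_nil (by simp)
  | cons h p =>
    rw [SimpleGraph.Walk.cons_isCycle_iff] at hc
    obtain ⟨l, hl, hg, hhead⟩ := exists_word_of_isPath p hc.1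
    obtain ⟨i, rfl⟩ := id h
    refine wordProd_ne_one (l := i :: l) ?_ (by simp) ?_
    · rw [List.isChain_cons]
      refine ⟨fun j hj hij => hc.2 ?_, hl⟩
      have := hhead j hj
      rw [← hij, ballGen_mul_ballGen_mul, Sym2.eq_swap] at this
      exact this
    · rw [wordProd]
      rw [← mul_assoc] at hg
      exact (right_eq_mul.1 hg)

end CompactGroup

/-! ### Gauge functions that are positive at `0` -/

/-- A point can be covered at cost `h 0`, and by monotonicity no small set costs less, so every
point has mass `h 0`. -/
theorem gaugeMeasure_eq_smul_count (X : Type*) [MetricSpace X] [MeasurableSpace X] [BorelSpace X]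
    {h : ℝ → ℝ} {ε : ℝ} (hε : 0 < ε) (hmono : MonotoneOn h (Set.Ico 0 ε)) (h0 : 0 < h 0) :
    gaugeMeasure X h = ENNReal.ofReal (h 0) • Measure.count := by
  have hsing : ∀ x : X, gaugeMeasure X h {x} = ENNReal.ofReal (h 0) := by
    intro x
    refine le_antisymm ((Measure.mkMetric_le_liminf_sum (β := ℕ) (ι := fun _ => Unit) (l := atTop)
      {x} (fun _ => 0) tendsto_const_nhds (fun _ _ => {x}) (by simp) (by simp) _).trans ?_) ?_
    · simp
    · have h1 : ENNReal.ofReal (h 0) • Measure.dirac x ≤ gaugeMeasure X h := by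
        refine Measure.le_mkMetric _ _ (ENNReal.ofReal (ε / 2)) (by simpa using hε) fun s hs => ?_
        refine le_trans ?_ (ENNReal.ofReal_le_ofReal (hmono ⟨le_rfl, hε⟩
          ⟨ENNReal.toReal_nonneg, ?_⟩ ENNReal.toReal_nonneg))
        · rw [Measure.smul_apply, smul_eq_mul]
          exact mul_le_of_le_one_right zero_le prob_le_one
        · refine (ENNReal.toReal_mono ENNReal.ofReal_ne_top hs).trans_lt ?_
          rw [ENNReal.toReal_ofReal (by positivity)]
          linarith
      simpa using h1 {x}
  have hne : ENNReal.ofReal (h 0) ≠ 0 := by simpa using h0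
  ext s hs
  rw [Measure.smul_apply, smul_eq_mul]
  by_cases hfin : s.Finite
  · lift s to Finset X using hfin
    rw [← sum_measure_singleton, Finset.sum_congr rfl fun x _ => hsing x, Measure.count_apply_finset]
    simp [mul_comm]
  · rw [Set.Infinite.meas_eq_top hfin ⟨_, hne, fun x _ => (hsing x).ge⟩,
      Measure.count_apply_infinite hfin, ENNReal.mul_top hne]

theorem iteratedLIntegral_smul_count {X : Type*} [MeasurableSpace X] [MeasurableSingletonClass X]
    (a : ℝ≥0∞) : ∀ (n : ℕ) (f : (Fin n → X) → ℝ≥0∞),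
    iteratedLIntegral (a • Measure.count) n f = a ^ n * ∑' y, f y
  | 0, f => by
    simp only [iteratedLIntegral, pow_zero, one_mul]
    rw [tsum_fintype, Finset.univ_unique, Finset.sum_singleton]
    congr 1
  | n + 1, f => by
    simp only [iteratedLIntegral]
    rw [lintegral_smul_measure, lintegral_count, smul_eq_mul, pow_succ', mul_assoc]
    congr 1
    simp only [iteratedLIntegral_smul_count a n]
    rw [ENNReal.tsum_mul_left, ← (Fin.consEquiv fun _ => X).tsum_eq, ENNReal.tsum_prod']
    rfl

/-! ### The unit interval as a universal atomless probability space -/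

theorem hausdorffMeasure_unitInterval :
    (Measure.hausdorffMeasure 1 : Measure (Set.Icc (0 : ℝ) 1)) = (volume : Measure unitInterval) := by
  have he : MeasurableEmbedding (Subtype.val : Set.Icc (0 : ℝ) 1 → ℝ) :=
    MeasurableEmbedding.subtype_coe measurableSet_Icc
  rw [← he.comap_map (Measure.hausdorffMeasure 1), map_subtype_hausdorffMeasure,
    ← he.comap_map (volume : Measure unitInterval),
    unitInterval.measurePreserving_coe.map_eq]

/-- Embed `Ω` measurably in the unit interval. The image measure has no atoms, so its distribution
function `F` is continuous and onto; a right inverse `g`, a quantile function, is strictly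
increasing and carries Lebesgue measure to it. A left inverse of the embedding leads back to `Ω`. -/
theorem exists_measurable_map_eq_injOn {Ω : Type*} [MeasurableSpace Ω] [StandardBorelSpace Ω]
    [Nonempty Ω] (P : Measure Ω) [IsProbabilityMeasure P] [NullSingletonClass P] :
    ∃ θ : unitInterval → Ω, Measurable θ ∧ (volume : Measure unitInterval).map θ = P ∧
      ∃ X₀ : Set unitInterval, MeasurableSet X₀ ∧ volume X₀ᶜ = 0 ∧ Set.InjOn θ X₀ := by
  have he := measurableEmbedding_sigmoid_comp_embeddingReal Ω
  set e : Ω → unitInterval := unitInterval.sigmoid ∘ embeddingReal Ω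
  set ρ : Measure unitInterval := P.map e with hρ
  have hρp : IsProbabilityMeasure ρ := Measure.isProbabilityMeasure_map he.measurable.aemeasurable
  have hρs : ∀ t, ρ {t} = 0 := by
    intro t
    rw [hρ, he.map_apply]
    rcases (e ⁻¹' {t}).eq_empty_or_nonempty with h | ⟨ω, hω⟩
    · simp [h]
    · have : e ⁻¹' {t} ⊆ {ω} := fun ω' hω' => he.injective (hω'.trans hω.symm)
      exact measure_mono_null this (measure_singleton ω)
  set ρ' : Measure ℝ := ρ.map Subtype.val with hρ'
  have hce := unitInterval.measurableEmbedding_coe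
  have hρp' : IsProbabilityMeasure ρ' := Measure.isProbabilityMeasure_map hce.measurable.aemeasurable
  have hρs' : NullSingletonClass ρ' := by
    refine ⟨fun t => ?_⟩
    rw [hρ', hce.map_apply]
    by_cases ht : t ∈ unitInterval
    · have : Subtype.val ⁻¹' {t} ⊆ {(⟨t, ht⟩ : unitInterval)} := fun s hs => Subtype.ext hs
      exact measure_mono_null this (hρs _)
    · have : Subtype.val ⁻¹' {t} ⊆ (∅ : Set unitInterval) := fun s hs => ht (hs ▸ s.2)
      exact measure_mono_null this (by simp)
  set F : unitInterval → ℝ := fun x => ρ.real (Set.Iic x) with hF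
  have hFmono : Monotone F := fun x y hxy => measureReal_mono (Set.Iic_subset_Iic.2 hxy)
  have hFeq : ∀ x : unitInterval, F x = ∫ _ in (0 : ℝ)..x, (1 : ℝ) ∂ρ' := by
    intro x
    rw [intervalIntegral.integral_of_le x.2.1]
    simp only [hF, integral_const, smul_eq_mul, mul_one]
    rw [measureReal_restrict_apply_univ, measureReal_def, measureReal_def,
      measure_congr Ioc_ae_eq_Icc, hρ', hce.map_apply]
    congr 2
    ext y
    simp [y.2.1]
  have hsurj : ∀ t : unitInterval, ∃ x, F x = t := by
    intro t
    have hcont : Continuous fun b : ℝ => ∫ _ in (0 : ℝ)..b, (1 : ℝ) ∂ρ' :=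
      intervalIntegral.continuous_primitive (fun a b => intervalIntegrable_const) 0
    have h1 : F 1 = 1 := by
      have : Set.Iic (1 : unitInterval) = Set.univ := Set.eq_univ_of_forall fun x => x.2.2
      simp [hF, this]
    obtain ⟨x, hx, hxt⟩ := intermediate_value_Icc zero_le_one hcont.continuousOn
      (show (t : ℝ) ∈ Set.Icc _ _ by
        have := hFeq 1
        rw [h1] at this
        simp only [intervalIntegral.integral_same]
        exact ⟨t.2.1, t.2.2.trans this.le⟩)
    exact ⟨⟨x, hx⟩, (hFeq _).trans hxt⟩
  choose g hg using hsurj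
  have hgmono : StrictMono g := by
    intro t t' htt'
    by_contra! hcon
    have := hFmono hcon
    rw [hg, hg] at this
    exact absurd htt' (not_lt.2 this)
  have hgm : Measurable g := hgmono.monotone.measurable
  have hgmap : (volume : Measure unitInterval).map g = ρ := by
    refine Measure.ext_of_Iic _ _ fun x => ?_
    rw [Measure.map_apply hgm measurableSet_Iic]
    have hF1 : F x ∈ unitInterval := ⟨measureReal_nonneg, measureReal_le_one⟩
    have hFx : ρ (Set.Iic x) = ENNReal.ofReal (F x) := (ofReal_measureReal (measure_ne_top _ _)).symm
    refine le_antisymm ?_ ?_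
    · calc _ ≤ volume (Set.Iic (⟨F x, hF1⟩ : unitInterval)) := by
            refine measure_mono fun t ht => ?_
            change (t : ℝ) ≤ F x
            rw [← hg t]
            exact hFmono ht
        _ = _ := by rw [unitInterval.volume_Iic, hFx]
    · calc ρ (Set.Iic x) = volume (Set.Iio (⟨F x, hF1⟩ : unitInterval)) := by
            rw [unitInterval.volume_Iio, hFx]
        _ ≤ _ := by
            refine measure_mono fun t ht => ?_
            by_contra hcon
            have h1 : x ≤ g t := (not_le.1 hcon).le
            have h2 := hFmono h1
            rw [hg] at h2
            exact absurd (show (t : ℝ) < F x from ht) (not_lt.2 h2)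
  obtain ⟨i, him, hi⟩ := he.exists_measurable_extend measurable_id fun _ => ‹Nonempty Ω›
  refine ⟨i ∘ g, him.comp hgm, ?_, g ⁻¹' Set.range e, hgm he.measurableSet_range, ?_, ?_⟩
  · rw [← Measure.map_map him hgm, hgmap, hρ, Measure.map_map him he.measurable, hi, Measure.map_id]
  · rw [← Set.preimage_compl, ← Measure.map_apply hgm he.measurableSet_range.compl, hgmap, hρ,
      he.map_apply]
    simp
  · rintro t ⟨ω, hω⟩ t' ⟨ω', hω'⟩ htt'
    refine hgmono.injective ?_
    have h1 : i (e ω) = ω := congrFun hi ω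
    have h2 : i (e ω') = ω' := congrFun hi ω'
    simp only [Function.comp_apply, ← hω, ← hω', h1, h2] at htt'
    rw [← hω, ← hω', htt']

/-! ### Transporting a Cayley graph to the unit interval -/

section Transport

theorem setLIntegral_ite_one {X : Type*} [MeasurableSpace X] {μ : Measure X} {p : X → Prop}
    [DecidablePred p] (hp : MeasurableSet {x | p x}) (A : Set X) :
    ∫⁻ x in A, (if p x then 1 else 0) ∂μ = μ ({x | p x} ∩ A) := by
  rw [← Measure.restrict_apply hp, ← lintegral_indicator_one hp]
  refine lintegral_congr fun x => ?_
  by_cases h : p x <;> simp [h]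

variable {Ω : Type*} [Group Ω] {κ X : Type*}

/-- The graph on `X` that `θ`, restricted to `X₁`, pulls back from the Cayley graph of `a`. -/
def transportRel (a : κ → Ω) (θ : X → Ω) (X₁ : Set X) (x y : X) : Prop :=
  x ∈ X₁ ∧ y ∈ X₁ ∧ ∃ i, θ y = a i * θ x

theorem transportRel_symm {a : κ → Ω} (ha : ∀ i, a i * a i = 1) {θ : X → Ω} {X₁ : Set X} (x y : X)
    (h : transportRel a θ X₁ x y) : transportRel a θ X₁ y x := by
  obtain ⟨hx, hy, i, hi⟩ := h
  exact ⟨hy, hx, i, by rw [hi, ← mul_assoc, ha, one_mul]⟩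

open Classical in
theorem relKernel_transportRel [Fintype κ] {a : κ → Ω} (hainj : Function.Injective a) {θ : X → Ω}
    (X₁ : Set X) (x y : X) : relKernel (transportRel a θ X₁) x y =
      ∑ i, if x ∈ X₁ ∧ y ∈ X₁ ∧ θ y = a i * θ x then 1 else 0 := by
  unfold relKernel
  split_ifs with h
  · obtain ⟨hx, hy, i, hi⟩ := h
    rw [Finset.sum_eq_single i, if_pos ⟨hx, hy, hi⟩]
    · intro j _ hji
      refine if_neg fun hj => hji (hainj (mul_right_cancel (b := θ x) ?_))
      rw [← hj.2.2, hi]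
    · simp
  · symm
    refine Finset.sum_eq_zero fun i _ => if_neg fun hi => h ⟨hi.1, hi.2.1, i, hi.2.2⟩

variable [TopologicalSpace Ω] [IsTopologicalGroup Ω] [PolishSpace Ω] [MeasurableSpace Ω]
  [BorelSpace Ω] [MeasurableSpace X]

theorem measurableSet_graph_mul {θ : X → Ω} (hθ : Measurable θ) {X₁ : Set X}
    (hX₁ : MeasurableSet X₁) (g : Ω) :
    MeasurableSet {p : X × X | p.1 ∈ X₁ ∧ p.2 ∈ X₁ ∧ θ p.2 = g * θ p.1} :=
  (measurable_fst hX₁).inter ((measurable_snd hX₁).inter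
    (measurableSet_eq_fun (hθ.comp measurable_snd) ((hθ.comp measurable_fst).const_mul g)))

variable {P : Measure Ω} [P.IsMulLeftInvariant] [StandardBorelSpace X] {lam : Measure X}

/-- Keep the points whose translates by all words in the generators remain in the image of `X₀`.
These are countably many conditions, each conull by left invariance. -/
theorem exists_invariant_conull [Countable κ] (a : κ → Ω) {θ : X → Ω} (hθ : Measurable θ)
    (hmap : lam.map θ = P) {X₀ : Set X} (hX₀ : MeasurableSet X₀) (hnull : lam X₀ᶜ = 0)
    (hinj : Set.InjOn θ X₀) :
    ∃ X₁ : Set X, MeasurableSet X₁ ∧ lam X₁ᶜ = 0 ∧ Set.InjOn θ X₁ ∧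
      ∀ x ∈ X₁, ∀ i, ∃ y ∈ X₁, θ y = a i * θ x := by
  have hE : MeasurableSet (θ '' X₀) := hX₀.image_of_measurable_injOn hθ hinj
  have hPE : P (θ '' X₀)ᶜ = 0 := by
    rw [← hmap, Measure.map_apply hθ hE.compl]
    exact measure_mono_null (fun x hx hx' => hx ⟨x, hx', rfl⟩) hnull
  refine ⟨X₀ ∩ ⋂ l : List κ, {x | (l.map a).prod * θ x ∈ θ '' X₀}, ?_, ?_,
    hinj.mono Set.inter_subset_left, ?_⟩
  · refine hX₀.inter (MeasurableSet.iInter fun l => ?_)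
    exact (hθ.const_mul _) hE
  · rw [Set.compl_inter, Set.compl_iInter]
    refine measure_union_null hnull (measure_iUnion_null fun l => ?_)
    have h1 : {x | (l.map a).prod * θ x ∈ θ '' X₀}ᶜ =
        θ ⁻¹' ((fun ω => (l.map a).prod * ω) ⁻¹' (θ '' X₀)ᶜ) := rfl
    rw [h1, ← Measure.map_apply hθ (measurable_const_mul _ hE.compl), hmap, measure_preimage_mul,
      hPE]
  · rintro x ⟨hx, hx'⟩ i
    rw [Set.mem_iInter] at hx'
    obtain ⟨y, hy, hxy⟩ := hx' [i]
    simp only [List.map_cons, List.map_nil, List.prod_cons, List.prod_nil, mul_one] at hxy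
    refine ⟨y, ⟨hy, Set.mem_iInter.2 fun l => ?_⟩, hxy⟩
    have := hx' (l ++ [i])
    simpa [hxy, mul_assoc] using this

open Classical in
theorem setLIntegral_relKernel_transportRel [Fintype κ] {a : κ → Ω}
    (hainj : Function.Injective a) {θ : X → Ω} (hθ : Measurable θ) {X₁ : Set X}
    (hX₁ : MeasurableSet X₁) (hinj : Set.InjOn θ X₁) (δ : ℝ≥0∞) (A : Set X) (x : X) :
    ∫⁻ y in A, relKernel (transportRel a θ X₁) x y ∂(δ • Measure.count) =
      δ * ∑ i, if x ∈ X₁ ∧ a i * θ x ∈ θ '' (A ∩ X₁) then 1 else 0 := by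
  simp only [relKernel_transportRel hainj]
  have hm : ∀ i, MeasurableSet {y | x ∈ X₁ ∧ y ∈ X₁ ∧ θ y = a i * θ x} := fun i =>
    measurable_prodMk_left (measurableSet_graph_mul hθ hX₁ (a i))
  rw [Measure.restrict_smul, lintegral_smul_measure, smul_eq_mul,
    lintegral_finsetSum _ fun i _ => Measurable.ite (hm i) measurable_const measurable_const]
  congr 1
  refine Finset.sum_congr rfl fun i _ => ?_
  rw [setLIntegral_ite_one (hm i)]
  split_ifs with h
  · obtain ⟨hx, y, hy, hyx⟩ := h
    have : {y | x ∈ X₁ ∧ y ∈ X₁ ∧ θ y = a i * θ x} ∩ A = {y} := by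
      ext z
      constructor
      · rintro ⟨⟨_, hz, hzx⟩, _⟩
        exact hinj hz hy.2 (hzx.trans hyx.symm)
      · rintro rfl
        exact ⟨⟨hx, hy.2, hyx⟩, hy.1⟩
    rw [this, Measure.count_singleton]
  · have : {y | x ∈ X₁ ∧ y ∈ X₁ ∧ θ y = a i * θ x} ∩ A = ∅ := by
      refine Set.eq_empty_of_forall_notMem ?_
      rintro z ⟨⟨hx, hz, hzx⟩, hzA⟩
      exact h ⟨hx, z, ⟨hzA, hz⟩, hzx⟩
    rw [this, measure_empty]

/-- The edge measure between two sets is a sum over the generators of the Haar measure of one image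
intersected with a translate of the other; invariance and `a i * a i = 1` make it symmetric. -/
theorem isGraphoning_transportRel [IsProbabilityMeasure lam] [Fintype κ] {a : κ → Ω}
    (ha : ∀ i, a i * a i = 1) (hainj : Function.Injective a) {θ : X → Ω} (hθ : Measurable θ)
    (hmap : lam.map θ = P) {X₁ : Set X} (hX₁ : MeasurableSet X₁) (hnull : lam X₁ᶜ = 0)
    (hinj : Set.InjOn θ X₁) {δ : ℝ≥0∞} (hδ : δ * Fintype.card κ ≤ 1) :
    IsGraphoning lam (δ • Measure.count) (relKernel (transportRel a θ X₁)) := by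
  classical
  have himg : ∀ A : Set X, MeasurableSet A → MeasurableSet (θ '' (A ∩ X₁)) := fun A hA =>
    (hA.inter hX₁).image_of_measurable_injOn hθ (hinj.mono Set.inter_subset_right)
  have hms : ∀ A : Set X, MeasurableSet A → ∀ i,
      MeasurableSet {x | x ∈ X₁ ∧ a i * θ x ∈ θ '' (A ∩ X₁)} := fun A hA i =>
    hX₁.inter ((hθ.const_mul (a i)) (himg A hA))
  refine ⟨inferInstance, fun x y => ?_, fun x y => ?_, ?_, fun x => ?_, fun A hA => ?_,
    fun A B hA hB => ?_⟩
  · rcases relKernel_eq_zero_or_one (transportRel a θ X₁) x y with h | h <;> simp [h]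
  · unfold relKernel
    congr 1
    exact propext ⟨transportRel_symm ha x y, transportRel_symm ha y x⟩
  · have : Function.uncurry (relKernel (transportRel a θ X₁)) = fun p : X × X =>
        ∑ i, if p.1 ∈ X₁ ∧ p.2 ∈ X₁ ∧ θ p.2 = a i * θ p.1 then (1 : ℝ≥0∞) else 0 := by
      ext p
      exact relKernel_transportRel hainj X₁ p.1 p.2
    rw [this]
    exact Finset.measurable_sum _ fun i _ =>
      Measurable.ite (measurableSet_graph_mul hθ hX₁ (a i)) measurable_const measurable_const
  · rw [← setLIntegral_univ,
      setLIntegral_relKernel_transportRel hainj hθ hX₁ hinj δ Set.univ]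
    refine le_trans ?_ hδ
    gcongr
    calc _ ≤ ∑ i : κ, (1 : ℝ≥0∞) := Finset.sum_le_sum fun i _ => by split_ifs <;> simp
      _ = _ := by simp
  · simp only [setLIntegral_relKernel_transportRel hainj hθ hX₁ hinj δ A]
    exact (Finset.measurable_sum _ fun i _ =>
      Measurable.ite (hms A hA i) measurable_const measurable_const).const_mul δ
  · simp only [setLIntegral_relKernel_transportRel hainj hθ hX₁ hinj δ A,
      setLIntegral_relKernel_transportRel hainj hθ hX₁ hinj δ B]
    have key : ∀ C D : Set X, MeasurableSet C → MeasurableSet D →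
        ∫⁻ x in C, δ * ∑ i, (if x ∈ X₁ ∧ a i * θ x ∈ θ '' (D ∩ X₁) then (1 : ℝ≥0∞) else 0) ∂lam =
          δ * ∑ i, P (θ '' (C ∩ X₁) ∩ (fun ω => a i * ω) ⁻¹' (θ '' (D ∩ X₁))) := by
      intro C D hC hD
      rw [lintegral_const_mul _ (Finset.measurable_sum _ fun i _ =>
          Measurable.ite (hms D hD i) measurable_const measurable_const),
        lintegral_finsetSum _ fun i _ =>
          Measurable.ite (hms D hD i) measurable_const measurable_const]
      congr 1
      refine Finset.sum_congr rfl fun i _ => ?_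
      have h2 : {x | x ∈ X₁ ∧ a i * θ x ∈ θ '' (D ∩ X₁)} ∩ C =
          θ ⁻¹' (θ '' (C ∩ X₁) ∩ (fun ω => a i * ω) ⁻¹' (θ '' (D ∩ X₁))) ∩ X₁ := by
        ext x
        constructor
        · rintro ⟨⟨hx, hx'⟩, hxC⟩
          exact ⟨⟨⟨x, ⟨hxC, hx⟩, rfl⟩, hx'⟩, hx⟩
        · rintro ⟨⟨⟨z, hz, hzx⟩, hx'⟩, hx⟩
          obtain rfl : z = x := hinj hz.2 hx hzx
          exact ⟨⟨hx, hx'⟩, hz.1⟩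
      rw [setLIntegral_ite_one (hms D hD i), h2, measure_inter_conull hnull, ← Measure.map_apply hθ ((himg C hC).inter
        (measurable_const_mul _ (himg D hD))), hmap]
    rw [key A B hA hB, key B A hB hA]
    congr 1
    refine Finset.sum_congr rfl fun i _ => ?_
    rw [← measure_preimage_mul P (a i), Set.preimage_inter, ← Set.preimage_comp, Set.inter_comm]
    congr 2
    ext ω
    simp [ha]

end Transport

/-! ### Rooted homomorphisms to regular acyclic graphs -/

section RootedCount

variable {Ω : Type*} {T : SimpleGraph Ω} {k : ℕ}

/-- The injective homomorphisms from `F` to `T` that send `r` to `x`. -/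
abbrev RootedInj {U Ω : Type*} (F : SimpleGraph U) (T : SimpleGraph Ω) (r : U) (x : Ω) : Type _ :=
  {f : U → Ω // (Function.Injective f ∧ ∀ a b, F.Adj a b → T.Adj (f a) (f b)) ∧ f r = x}

/-- The homomorphisms from `F` to `T` that send `r` to `x`. -/
abbrev RootedHom {U Ω : Type*} (F : SimpleGraph U) (T : SimpleGraph Ω) (r : U) (x : Ω) : Type _ :=
  {f : U → Ω // (∀ a b, F.Adj a b → T.Adj (f a) (f b)) ∧ f r = x}

theorem isAcyclic_of_injective {U : Type*} {F : SimpleGraph U} (hT : T.IsAcyclic) {f : U → Ω}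
    (hf : Function.Injective f) (hf' : ∀ a b, F.Adj a b → T.Adj (f a) (f b)) : F.IsAcyclic :=
  hT.comap ⟨f, fun h => hf' _ _ h⟩ hf

/-- The new neighbours of the image of a node. -/
theorem ncard_neighborSet_diff_range (hT : T.IsAcyclic)
    (hreg : ∀ x, (T.neighborSet x).Finite ∧ (T.neighborSet x).ncard = k) {U : Type*} [Fintype U]
    {F : SimpleGraph U} [DecidableRel F.Adj] (hF : F.Connected) {f : U → Ω}
    (hf : Function.Injective f) (hf' : ∀ a b, F.Adj a b → T.Adj (f a) (f b)) (u : U) :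
    F.degree u ≤ k ∧ (T.neighborSet (f u) \ Set.range f).ncard = k - F.degree u := by
  have h1 : T.neighborSet (f u) \ Set.range f = T.neighborSet (f u) \ f '' F.neighborSet u := by
    ext y
    refine and_congr_right fun hy => not_congr ⟨?_, fun ⟨w, _, hw⟩ => ⟨w, hw⟩⟩
    rintro ⟨w, rfl⟩
    refine ⟨w, ?_, rfl⟩
    -- A neighbour of `f u` in the image that does not come from an edge of `F` would close a cycle
    -- in `T`.
    by_contra hw
    refine not_isAcyclic_sup_edge hF hw (fun h => T.loopless.irrefl (f u) ?_)
      (isAcyclic_of_injective hT hf ?_)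
    · have : T.Adj (f u) (f w) := hy
      rwa [← h] at this
    · rintro a b (hab | hab)
      · exact hf' a b hab
      · rcases (SimpleGraph.edge_adj ..).1 hab with ⟨⟨rfl, rfl⟩ | ⟨rfl, rfl⟩, _⟩
        · exact hy
        · exact SimpleGraph.Adj.symm hy
  have h2 : f '' F.neighborSet u ⊆ T.neighborSet (f u) := by
    rintro _ ⟨w, hw, rfl⟩
    exact hf' u w hw
  have h3 : (f '' F.neighborSet u).ncard = F.degree u := by
    rw [Set.ncard_image_of_injective _ hf, Set.ncard_eq_toFinset_card', ← SimpleGraph.neighborFinset_def,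
      F.card_neighborFinset_eq_degree]
  refine ⟨?_, ?_⟩
  · rw [← h3, ← (hreg (f u)).2]
    exact Set.ncard_le_ncard h2 (hreg (f u)).1
  · rw [h1, Set.ncard_sdiff h2 (Set.toFinite _), h3, (hreg (f u)).2]

/-- Removing a leaf from an injective homomorphism. -/
def rootedInjLeafEquiv {m : ℕ} {F : SimpleGraph (Fin (m + 2))} {u : Fin (m + 1)}
    (hu : ∀ v : Fin (m + 1), F.Adj v.castSucc (Fin.last _) ↔ v = u) (x : Ω) :
    RootedInj F T 0 x ≃ Σ f : RootedInj (F.comap Fin.castSucc) T 0 x,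
      (T.neighborSet (f.1 u) \ Set.range f.1 : Set Ω) where
  toFun f := ⟨⟨fun i => f.1 i.castSucc,
      ⟨f.2.1.1.comp (Fin.castSucc_injective _), fun _ _ h => f.2.1.2 _ _ h⟩, f.2.2⟩,
    ⟨f.1 (Fin.last _), f.2.1.2 _ _ ((hu u).2 rfl), by
      rintro ⟨i, hi⟩
      exact (Fin.castSucc_lt_last i).ne (f.2.1.1 hi)⟩⟩
  invFun p := ⟨Fin.snoc (α := fun _ => Ω) p.1.1 p.2.1, ⟨by
      rw [Fin.snoc_injective_iff]
      exact ⟨p.1.2.1.1, p.2.2.2⟩, by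
      intro a b hab
      induction a using Fin.lastCases with
      | last =>
        induction b using Fin.lastCases with
        | last => exact absurd rfl hab.ne
        | cast b =>
          obtain rfl := (hu b).1 hab.symm
          simpa using SimpleGraph.Adj.symm p.2.2.1
      | cast a =>
        induction b using Fin.lastCases with
        | last =>
          obtain rfl := (hu a).1 hab
          simpa using p.2.2.1
        | cast b => simpa using p.1.2.1.2 a b hab⟩, by
      have h := Fin.snoc_castSucc (α := fun _ => Ω) p.2.1 p.1.1 0
      exact h.trans p.1.2.2⟩
  left_inv f := by
    refine Subtype.ext (funext fun i => ?_)
    induction i using Fin.lastCases with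
    | last => simp
    | cast i => simp
  right_inv p := by
    refine Sigma.subtype_ext (Subtype.ext (funext fun i => ?_)) ?_ <;> simp

variable {V : ℕ → Type*} [∀ n, Fintype (V n)] [∀ n, Nonempty (V n)]
  {G : ∀ n, SimpleGraph (V n)} {d : ℕ → ℝ} {α δ : ℝ}

/-- Both sides obey one recursion: a leaf at `u` has `k - deg u` free places in `T`, and its
asymptotic factor is `α - deg u * δ = (k - deg u) * δ`. Graphs with a cycle do not embed in `T` and
have vanishing density. -/
theorem exists_card_rootedInj_fin (hadm : ∀ n, IsAdmissible (G n) (d n)) (hα₀ : 0 ≤ α)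
    (hα₁ : α ≤ 1) (hreg : IsRegularSeq G d α) (hgirth : HasLargeEssentialGirth G d)
    (hδ : Tendsto (fun n => 1 / d n) atTop (𝓝 δ)) (hα : α = k * δ) (hT : T.IsAcyclic)
    (hTreg : ∀ x, (T.neighborSet x).Finite ∧ (T.neighborSet x).ncard = k) [Nonempty Ω] :
    ∀ {m : ℕ} {F : SimpleGraph (Fin (m + 1))}, OrdConn F → ∃ c : ℕ,
      (∀ x, Finite (RootedInj F T 0 x) ∧ Nat.card (RootedInj F T 0 x) = c) ∧
      Tendsto (fun n => injRatio F (G n) (d n)) atTop (𝓝 (c * δ ^ m))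
  | 0, F, hF => by
    refine ⟨1, fun x => ?_, ?_⟩
    · have : Unique (RootedInj F T 0 x) :=
        { default := ⟨fun _ => x, ⟨fun a b _ => (Fin.fin_one_eq_zero a).trans (Fin.fin_one_eq_zero b).symm, fun a b h =>
            absurd ((Fin.fin_one_eq_zero a).trans (Fin.fin_one_eq_zero b).symm) h.ne⟩, rfl⟩
          uniq := fun f => Subtype.ext (funext fun i => by
            exact (congrArg f.1 (Fin.fin_one_eq_zero i)).trans f.2.2) }
      exact ⟨inferInstance, Nat.card_unique⟩
    · simp [injRatio_single]
  | m + 1, F, hF => by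
    classical
    by_cases hac : F.IsAcyclic
    · have hUP := hF.uniqueParent hac
      obtain ⟨u, hu⟩ := hF.exists_adj_last
      obtain ⟨c, hc, hlim⟩ := exists_card_rootedInj_fin hadm hα₀ hα₁ hreg hgirth hδ hα hT hTreg
        hF.comap_castSucc
      set F₀ := F.comap Fin.castSucc with hF₀
      have hconn : F₀.Connected := hF.comap_castSucc.connected
      have hdiff := fun x (f : RootedInj F₀ T 0 x) =>
        ncard_neighborSet_diff_range hT hTreg hconn f.2.1.1 f.2.1.2 u
      refine ⟨c * (k - F₀.degree u), fun x => ?_, ?_⟩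
      · have e := rootedInjLeafEquiv (T := T) (hUP.adj_last_iff hu) x
        have h1 := (hc x).1
        have h2 : ∀ f : RootedInj F₀ T 0 x,
            Finite (T.neighborSet (f.1 u) \ Set.range f.1 : Set Ω) := fun f =>
          ((hTreg (f.1 u)).1.subset Set.sdiff_subset).to_subtype
        have := Fintype.ofFinite (RootedInj F₀ T 0 x)
        refine ⟨Finite.of_equiv _ e.symm, ?_⟩
        rw [Nat.card_congr e, Nat.card_sigma]
        have h3 : ∀ f : RootedInj F₀ T 0 x,
            Nat.card (T.neighborSet (f.1 u) \ Set.range f.1 : Set Ω) = k - F₀.degree u := fun f => by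
          rw [Nat.card_coe_set_eq, (hdiff x f).2]
        simp only [h3]
        rw [Finset.sum_const, smul_eq_mul, Finset.card_univ, ← Nat.card_eq_fintype_card, (hc x).2]
      · have h1 := tendsto_injRatio_add_leaf hadm hα₀ hα₁ hreg hgirth hF hUP hF₀ hu
        have h2 : Tendsto (fun n => injRatio F₀ (G n) (d n) * (α - (F₀.degree u : ℝ) / d n)) atTop
            (𝓝 (c * δ ^ m * (α - F₀.degree u * δ))) := by
          refine hlim.mul (tendsto_const_nhds.sub ?_)
          simpa [div_eq_mul_inv] using hδ.const_mul (F₀.degree u : ℝ)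
        have h3 := h1.add h2
        rw [zero_add] at h3
        refine (h3.congr fun n => sub_add_cancel _ _).trans (le_of_eq (congrArg 𝓝 ?_))
        rw [hα]
        -- The subtraction `k - deg u` is truncated. If `c > 0`, an actual embedding shows `deg u ≤
        -- k`; if `c = 0`, both sides vanish.
        rcases Nat.eq_zero_or_pos c with rfl | hcpos
        · simp
        · obtain ⟨x⟩ := ‹Nonempty Ω›
          rw [← (hc x).2] at hcpos
          obtain ⟨⟨f⟩, _⟩ := Nat.card_pos_iff.1 hcpos
          rw [Nat.cast_mul, Nat.cast_sub (hdiff x f).1]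
          ring
    · refine ⟨0, fun x => ?_, ?_⟩
      · have : IsEmpty (RootedInj F T 0 x) :=
          ⟨fun f => hac (isAcyclic_of_injective hT f.2.1.1 f.2.1.2)⟩
        exact ⟨inferInstance, Nat.card_of_isEmpty⟩
      · simpa using tendsto_injRatio_of_not_isAcyclic hadm hgirth hF.connected hac

theorem exists_card_rootedInj (hadm : ∀ n, IsAdmissible (G n) (d n)) (hα₀ : 0 ≤ α)
    (hα₁ : α ≤ 1) (hreg : IsRegularSeq G d α) (hgirth : HasLargeEssentialGirth G d)
    (hδ : Tendsto (fun n => 1 / d n) atTop (𝓝 δ)) (hα : α = k * δ) (hT : T.IsAcyclic)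
    (hTreg : ∀ x, (T.neighborSet x).Finite ∧ (T.neighborSet x).ncard = k) [Nonempty Ω]
    {U : Type*} [Fintype U] {F : SimpleGraph U} (hF : F.Connected) (r : U) : ∃ c : ℕ,
      (∀ x, Finite (RootedInj F T r x) ∧ Nat.card (RootedInj F T r x) = c) ∧
      Tendsto (fun n => injRatio F (G n) (d n)) atTop (𝓝 (c * δ ^ (Fintype.card U - 1))) := by
  have hpos : 0 < Fintype.card U := Fintype.card_pos_iff.2 ⟨r⟩
  obtain ⟨m, hm⟩ : ∃ m, Fintype.card U = m + 1 := ⟨_, (Nat.succ_pred_eq_of_pos hpos).symm⟩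
  obtain ⟨φ, hφ, hord⟩ := exists_ordConn F hF r hm
  obtain ⟨c, hc, hlim⟩ := exists_card_rootedInj_fin hadm hα₀ hα₁ hreg hgirth hδ hα hT hTreg hord
  have hφ' : φ.symm 0 = r := φ.symm_apply_eq.2 hφ.symm
  refine ⟨c, fun x => ?_, ?_⟩
  · let e : RootedInj (F.comap φ.symm) T 0 x ≃ RootedInj F T r x :=
      { toFun := fun f => ⟨fun u => f.1 (φ u), ⟨f.2.1.1.comp φ.injective, fun a b h =>
            f.2.1.2 _ _ (by simpa using h)⟩, (congrArg f.1 hφ).trans f.2.2⟩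
        invFun := fun f => ⟨fun i => f.1 (φ.symm i), ⟨f.2.1.1.comp φ.symm.injective, fun a b h =>
            f.2.1.2 _ _ h⟩, (congrArg f.1 hφ').trans f.2.2⟩
        left_inv := fun f => Subtype.ext (funext fun i => by simp)
        right_inv := fun f => Subtype.ext (funext fun i => by simp) }
    have := (hc x).1
    exact ⟨Finite.of_equiv _ e, by rw [← Nat.card_congr e, (hc x).2]⟩
  · rw [hm, Nat.add_sub_cancel]
    simpa only [injRatio_congr (SimpleGraph.Iso.comap φ.symm F)] using hlim

/-- Both sides are sorted by kernel. A quotient with `q` nodes contributes `δ ^ (q - 1)` and the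
lost nodes `δ ^ (v(F) - q)`, so all kernels carry the same power of `δ` and the counts add up. -/
theorem exists_card_rootedHom (hadm : ∀ n, IsAdmissible (G n) (d n)) (hα₀ : 0 ≤ α)
    (hα₁ : α ≤ 1) (hreg : IsRegularSeq G d α) (hgirth : HasLargeEssentialGirth G d)
    (hδ : Tendsto (fun n => 1 / d n) atTop (𝓝 δ)) (hα : α = k * δ) (hT : T.IsAcyclic)
    (hTreg : ∀ x, (T.neighborSet x).Finite ∧ (T.neighborSet x).ncard = k) [Nonempty Ω]
    {U : Type*} [Fintype U] {F : SimpleGraph U} (hF : F.Connected) (r : U) : ∃ c : ℕ,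
      (∀ x, Finite (RootedHom F T r x) ∧ Nat.card (RootedHom F T r x) = c) ∧
      Tendsto (fun n => homDensity F (G n) (d n)) atTop (𝓝 (c * δ ^ (Fintype.card U - 1))) := by
  classical
  have key : ∀ s : {s : Setoid U // IsProper F s}, _ := fun s =>
    exists_card_rootedInj hadm hα₀ hα₁ hreg hgirth hδ hα hT hTreg (s.2.connected hF)
      (Quotient.mk s.1 r)
  choose c hc hlim using key
  refine ⟨∑ s, c s, fun x => ?_, ?_⟩
  · let w : (Σ s : {s : Setoid U // IsProper F s},
        RootedInj (quotGraph F s.1) T (Quotient.mk s.1 r) x) → RootedHom F T r x := fun p =>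
      ⟨((p.1.2.kerEquiv T).symm ⟨p.2.1, p.2.2.1⟩).1,
        ((p.1.2.kerEquiv T).symm ⟨p.2.1, p.2.2.1⟩).2.1, p.2.2.2⟩
    have hw : Function.Bijective w := by
      constructor
      · rintro ⟨⟨s, hs⟩, g, hg, hgx⟩ ⟨⟨s', hs'⟩, g', hg', hgx'⟩ h
        have h1 := ((hs.kerEquiv T).symm ⟨g, hg⟩).2.2
        have h2 := ((hs'.kerEquiv T).symm ⟨g', hg'⟩).2.2
        have h3 := congrArg Subtype.val h
        change ((hs.kerEquiv T).symm ⟨g, hg⟩).1 = ((hs'.kerEquiv T).symm ⟨g', hg'⟩).1 at h3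
        obtain rfl : s = s' := by rw [← h1, ← h2, h3]
        have h4 := (hs.kerEquiv T).symm.injective (Subtype.ext h3)
        obtain rfl : g = g' := congrArg Subtype.val h4
        rfl
      · rintro ⟨f, hf, hfx⟩
        have hs : IsProper F (Setoid.ker f) := ker_isProper hf
        exact ⟨⟨⟨_, hs⟩, ⟨(hs.kerEquiv T ⟨f, hf, rfl⟩).1, (hs.kerEquiv T ⟨f, hf, rfl⟩).2, hfx⟩⟩, rfl⟩
    let e := (Equiv.ofBijective w hw).symm
    have h1 : ∀ s : {s : Setoid U // IsProper F s},
        Finite (RootedInj (quotGraph F s.1) T (Quotient.mk s.1 r) x) := fun s => (hc s x).1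
    refine ⟨Finite.of_equiv _ e.symm, ?_⟩
    rw [Nat.card_congr e, Nat.card_sigma]
    exact Finset.sum_congr rfl fun s _ => (hc s x).2
  · have h1 := tendsto_homDensity_of_injRatio hadm hδ hF
      (c := fun s => if h : IsProper F s then c ⟨s, h⟩ * δ ^ (Fintype.card (Quotient s) - 1) else 0)
      (fun s hs => by simpa only [dif_pos hs] using hlim ⟨s, hs⟩)
    refine h1.trans (le_of_eq (congrArg 𝓝 ?_))
    rw [Nat.cast_sum, Finset.sum_mul, ← Finset.sum_filter]
    symm
    rw [Finset.sum_subtype _ (p := IsProper F) fun s => by simp]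
    refine Finset.sum_congr rfl fun s _ => ?_
    rw [dif_pos s.2, mul_assoc, ← pow_add]
    have h2 : Fintype.card (Quotient s.1) ≤ Fintype.card U := Fintype.card_le_of_surjective (Quotient.mk s.1) Quotient.mk_surjective
    have h3 : 0 < Fintype.card (Quotient s.1) := Fintype.card_pos_iff.2 ⟨Quotient.mk s.1 r⟩
    congr 2
    omega

end RootedCount

/-! ### The graphoning of a sequence with bounded degrees -/

section Discrete

variable {Ω X κ : Type*} [Group Ω] {T : SimpleGraph Ω} {a : κ → Ω} {θ : X → Ω} {X₁ : Set X}

/-- Composition with `θ`, on the homomorphisms to the pulled back graph with a given root. -/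
theorem bijective_comp_transport (hT : ∀ g g', T.Adj g g' ↔ ∃ i, g' = a i * g)
    (hinj : Set.InjOn θ X₁) (hinv : ∀ x ∈ X₁, ∀ i, ∃ y ∈ X₁, θ y = a i * θ x) {m : ℕ}
    {F : SimpleGraph (Fin (m + 1))} (hF : OrdConn F) {x : X} (hx : x ∈ X₁) :
    Function.Bijective (fun y : {y : Fin m → X // ∀ p q, F.Adj p q → transportRel a θ X₁
        ((Fin.cons x y : Fin (m + 1) → X) p) ((Fin.cons x y : Fin (m + 1) → X) q)} =>
      (⟨fun p => θ ((Fin.cons x y.1 : Fin (m + 1) → X) p),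
        fun p q h => (hT _ _).2 (y.2 p q h).2.2, rfl⟩ : RootedHom F T 0 (θ x))) := by
  have hmem : ∀ y : {y : Fin m → X // ∀ p q, F.Adj p q → transportRel a θ X₁
      ((Fin.cons x y : Fin (m + 1) → X) p) ((Fin.cons x y : Fin (m + 1) → X) q)}, ∀ p,
      (Fin.cons x y.1 : Fin (m + 1) → X) p ∈ X₁ := by
    intro y p
    by_cases hp : p = 0
    · rw [hp]; exact hx
    · obtain ⟨q, _, hq⟩ := hF p hp
      exact (y.2 q p hq).2.1
  constructor
  · intro y y' h
    have h1 := congrArg Subtype.val h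
    refine Subtype.ext (funext fun i => ?_)
    have h2 := hinj (hmem y i.succ) (hmem y' i.succ) (congrFun h1 i.succ)
    simpa using h2
  · rintro ⟨f, hf, hf0⟩
    -- Since `X₁` is closed under the generators, a homomorphism into `T` lifts node by node from
    -- the root.
    have hrange : ∀ n : ℕ, ∀ p : Fin (m + 1), (p : ℕ) = n → ∃ z ∈ X₁, θ z = f p := by
      intro n
      induction n using Nat.strong_induction_on with
      | _ n ih =>
        intro p hpn
        by_cases hp : p = 0
        · exact ⟨x, hx, by rw [hp, hf0]⟩
        · obtain ⟨q, hqp, hq⟩ := hF p hp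
          obtain ⟨z, hz, hzq⟩ := ih q (hpn ▸ hqp) q rfl
          obtain ⟨i, hi⟩ := (hT _ _).1 (hf q p hq)
          obtain ⟨z', hz', hzz'⟩ := hinv z hz i
          exact ⟨z', hz', by rw [hzz', hi, hzq]⟩
    choose z hz hzf using fun p => hrange _ p rfl
    have hz0 : z 0 = x := hinj (hz 0) hx ((hzf 0).trans hf0)
    have hcons : (Fin.cons x (Fin.tail z) : Fin (m + 1) → X) = z := by
      rw [← hz0, Fin.cons_self_tail]
    refine ⟨⟨Fin.tail z, fun p q h => ?_⟩, Subtype.ext (funext fun p => ?_)⟩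
    · rw [hcons]
      refine ⟨hz p, hz q, ?_⟩
      rw [hzf, hzf]
      exact (hT _ _).1 (hf p q h)
    · change θ ((Fin.cons x (Fin.tail z) : Fin (m + 1) → X) p) = f p
      rw [hcons, hzf]

theorem graphoningDensity_transportRel [MeasurableSpace X] [MeasurableSingletonClass X]
    {lam : Measure X} [IsProbabilityMeasure lam] (ha : ∀ i, a i * a i = 1)
    (hT : ∀ g g', T.Adj g g' ↔ ∃ i, g' = a i * g)
    (hinj : Set.InjOn θ X₁) (hnull : lam X₁ᶜ = 0)
    (hinv : ∀ x ∈ X₁, ∀ i, ∃ y ∈ X₁, θ y = a i * θ x) (δ : ℝ≥0∞) {U : Type*}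
    {F : SimpleGraph U} {m : ℕ} {φ : U ≃ Fin (m + 1)} (hφ : IsAdmissibleLabelling F φ) {c : ℕ}
    (hc : ∀ ω, Finite (RootedHom F T (φ.symm 0) ω) ∧ Nat.card (RootedHom F T (φ.symm 0) ω) = c) :
    graphoningDensity lam (δ • Measure.count) (relKernel (transportRel a θ X₁)) F φ =
      c * δ ^ m := by
  classical
  rw [graphoningDensity_relKernel _ _ (transportRel_symm ha), rootedLIntegral]
  have hae : ∀ᵐ x ∂lam, x ∈ X₁ := mem_ae_iff.2 hnull
  rw [lintegral_congr_ae (g := fun _ => c * δ ^ m), lintegral_const, measure_univ, mul_one]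
  filter_upwards [hae] with x hx
  rw [iteratedLIntegral_smul_count, mul_comm]
  congr 1
  set F' := F.comap φ.symm
  let p : (Fin m → X) → Prop := fun y => ∀ p q, F'.Adj p q → transportRel a θ X₁
        ((Fin.cons x y : Fin (m + 1) → X) p) ((Fin.cons x y : Fin (m + 1) → X) q)
  let e₁ : {y // p y} ≃ RootedHom F' T 0 (θ x) :=
    Equiv.ofBijective _ (bijective_comp_transport hT hinj hinv hφ.ordConn hx)
  let e₂ : RootedHom F' T 0 (θ x) ≃ RootedHom F T (φ.symm 0) (θ x) :=
    { toFun := fun f => ⟨fun u => f.1 (φ u), fun a b h => f.2.1 _ _ (by simpa [F'] using h),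
        (congrArg f.1 (φ.apply_symm_apply 0)).trans f.2.2⟩
      invFun := fun f => ⟨fun i => f.1 (φ.symm i), fun a b h => f.2.1 _ _ h, f.2.2⟩
      left_inv := fun f => Subtype.ext (funext fun i => by simp)
      right_inv := fun f => Subtype.ext (funext fun i => by simp) }
  have hfin : Finite {y // p y} := by
    have := (hc (θ x)).1
    exact Finite.of_equiv _ (e₁.trans e₂).symm
  have hcard : Nat.card {y // p y} = c := by rw [Nat.card_congr (e₁.trans e₂), (hc (θ x)).2]
  have hind : ∀ y : Fin m → X, homIndicator (transportRel a θ X₁) F' (Fin.cons x y) =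
      Set.indicator {y | p y} 1 y := fun y => by
    by_cases h : p y
    · rw [Set.indicator_of_mem (show y ∈ {y | p y} from h)]
      exact if_pos h
    · rw [Set.indicator_of_notMem (show y ∉ {y | p y} from h)]
      exact if_neg h
  simp only [hind]
  rw [← tsum_subtype]
  have := Fintype.ofFinite {y // p y}
  change ∑' y : {y // p y}, (1 : ℝ≥0∞) = c
  rw [tsum_fintype, Finset.sum_const, Finset.card_univ, ← Nat.card_eq_fintype_card, hcard]
  simp

end Discrete

/-- The Cayley graph of `k` generators of the compact group of a larger set of letters. -/
def ballTree (k : ℕ) : SimpleGraph (BallGroup (Option (Fin k))) where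
  Adj g g' := ∃ i : Fin k, g' = ballGen (some i) * g
  symm := ⟨by
    rintro g g' ⟨i, rfl⟩
    exact ⟨i, (ballGen_mul_ballGen_mul _ g).symm⟩⟩
  loopless := ⟨by
    rintro g ⟨i, hi⟩
    exact (ballCayley _).loopless.irrefl g ⟨some i, hi⟩⟩

theorem ballTree_isAcyclic (k : ℕ) : (ballTree k).IsAcyclic :=
  (ballCayley_isAcyclic (Option (Fin k))).anti
    (show ballTree k ≤ ballCayley _ from fun _ _ ⟨i, hi⟩ => ⟨some i, hi⟩)

theorem ballTree_regular (k : ℕ) (g : BallGroup (Option (Fin k))) :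
    ((ballTree k).neighborSet g).Finite ∧ ((ballTree k).neighborSet g).ncard = k := by
  have h1 : (ballTree k).neighborSet g = Set.range fun i : Fin k => ballGen (some i) * g := by
    ext g'
    exact ⟨fun ⟨i, hi⟩ => ⟨i, hi.symm⟩, fun ⟨i, hi⟩ => ⟨i, hi.symm⟩⟩
  have h2 : Function.Injective fun i : Fin k => ballGen (some i) * g := fun i j hij =>
    Option.some_injective _ (ballGen_injective (mul_right_cancel hij))
  rw [h1]
  refine ⟨Set.finite_range _, ?_⟩
  rw [Set.ncard_range_of_injective h2, Nat.card_eq_fintype_card, Fintype.card_fin]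

/-- For a gauge function that is positive at `0` there is a graphoning on the unit interval whose
homomorphism densities are those of the `k`-regular tree. -/
theorem exists_regular_graphoning {h : ℝ → ℝ} (hg : IsGauge h) (h0 : 0 < h 0) {k : ℕ}
    (hk : k * h 0 ≤ 1) :
    ∃ R : Set.Icc (0 : ℝ) 1 → Set.Icc (0 : ℝ) 1 → Prop,
      IsHausdorffGraphoning (Set.Icc (0 : ℝ) 1) h (relKernel R) ∧
      ∀ (U : Type) (F : SimpleGraph U) (m : ℕ) (φ : U ≃ Fin (m + 1)), IsAdmissibleLabelling F φ →
        ∀ c : ℕ, (∀ ω, Finite (RootedHom F (ballTree k) (φ.symm 0) ω) ∧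
          Nat.card (RootedHom F (ballTree k) (φ.symm 0) ω) = c) →
        graphoningDensity (Measure.hausdorffMeasure 1) (gaugeMeasure (Set.Icc (0 : ℝ) 1) h)
          (relKernel R) F φ = c * ENNReal.ofReal (h 0) ^ m := by
  obtain ⟨ε, hε, hnn, hmono, hcont⟩ := hg
  -- The additional letter `none` keeps the group infinite even for `k = 0`.
  set Ω := BallGroup (Option (Fin k))
  let P : Measure Ω := Measure.haarMeasure ⊤
  have hP : IsProbabilityMeasure P := ⟨Measure.haarMeasure_self⟩
  have hPs : NullSingletonClass P := by
    refine ⟨fun g => ?_⟩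
    by_contra hne
    have hinf : (Set.univ : Set Ω).Infinite := Set.infinite_univ_iff.2 infinite_ballGroup
    have h1 : ∀ g', P {g'} = P {1} := Measure.haar_singleton P
    have := hinf.meas_eq_top (μ := P) ⟨P {g}, hne, fun g' _ => by rw [h1 g, h1 g']⟩
    rw [measure_univ] at this
    exact ENNReal.one_ne_top this
  have hX : StandardBorelSpace (Set.Icc (0 : ℝ) 1) := inferInstance
  have hp := isProbabilityMeasure_hausdorffMeasure
  obtain ⟨θ, hθ, hmap, X₀, hX₀, hnull₀, hinj₀⟩ := exists_measurable_map_eq_injOn P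
  rw [← hausdorffMeasure_unitInterval] at hmap hnull₀
  let a : Fin k → Ω := fun i => ballGen (some i)
  have hainj : Function.Injective a := fun i j hij =>
    Option.some_injective _ (ballGen_injective hij)
  have ha : ∀ i, a i * a i = 1 := fun i => ballGen_mul_self _
  obtain ⟨X₁, hX₁, hnull, hinj, hinv⟩ := exists_invariant_conull a hθ hmap hX₀ hnull₀ hinj₀
  have hcount := gaugeMeasure_eq_smul_count (Set.Icc (0 : ℝ) 1) hε hmono h0
  refine ⟨transportRel a θ X₁, ⟨⟨ε, hε, hnn, hmono, hcont⟩, ?_⟩, fun U F m φ hφ c hc => ?_⟩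
  · rw [hcount]
    refine isGraphoning_transportRel ha hainj hθ hmap hX₁ hnull hinj ?_
    rw [Fintype.card_fin, mul_comm, ← ENNReal.ofReal_natCast, ← ENNReal.ofReal_mul (Nat.cast_nonneg _)]
    exact ENNReal.ofReal_le_one.2 hk
  · rw [hcount]
    exact graphoningDensity_transportRel ha (T := ballTree k) (fun _ _ => Iff.rfl) hinj hnull hinv _
      hφ hc

/-- If the degree bounds converge, then so do the typical degrees, to a natural number. -/
theorem exists_natCast_eq_of_tendsto {V : ℕ → Type*} [∀ n, Fintype (V n)] [∀ n, Nonempty (V n)]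
    {G : ∀ n, SimpleGraph (V n)} {d : ℕ → ℝ} {α D : ℝ} (hadm : ∀ n, IsAdmissible (G n) (d n))
    (hα₀ : 0 ≤ α) (hreg : IsRegularSeq G d α) (hD : Tendsto d atTop (𝓝 D)) :
    ∃ k : ℕ, α * D = k := by
  classical
  have hD1 : 1 ≤ D := ge_of_tendsto' hD fun n => (hadm n).1
  have key : ∀ η : ℝ, 0 < η → ∃ N : ℕ, |α * D - N| < η := by
    intro η hη
    have hε : 0 < η / (4 * D) := by positivity
    have h1 : ∀ᶠ n in atTop, d n < 2 * D := hD.eventually_lt_const (by linarith)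
    have h2 : ∀ᶠ n in atTop, |α * D - α * d n| < η / 2 := by
      have : Tendsto (fun n => |α * D - α * d n|) atTop (𝓝 |α * D - α * D|) :=
        (tendsto_const_nhds.sub (hD.const_mul α)).abs
      exact this.eventually_lt_const (by simpa using hη)
    have h3 := (hreg _ hε).eventually_lt_const one_pos
    obtain ⟨n, hn1, hn2, hn3⟩ := (h1.and (h2.and h3)).exists
    have hdn := (hadm n).1
    -- Not all nodes are atypical, so some degree, an integer, is close to `α * d n` and hence to `α
    -- * D`. As this holds to any precision, `α * D` is an integer.
    obtain ⟨v, hv⟩ : ∃ v : V n, ¬ η / (4 * D) < |((G n).degree v : ℝ) / d n - α| := by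
      by_contra! hcon
      rw [Finset.filter_true_of_mem fun v _ => by convert hcon v, Finset.card_univ, div_self] at hn3
      · exact lt_irrefl _ hn3
      · exact Nat.cast_ne_zero.2 Fintype.card_ne_zero
    refine ⟨(G n).degree v, ?_⟩
    have h4 : |α * d n - (G n).degree v| ≤ η / 2 := by
      have h5 : α * d n - (G n).degree v = -((((G n).degree v : ℝ) / d n - α) * d n) := by
        field_simp
        ring
      rw [h5, abs_neg, abs_mul, abs_of_pos (by linarith : 0 < d n)]
      calc _ ≤ η / (4 * D) * (2 * D) := by
            gcongr
            · linarith
        _ = η / 2 := by field_simp; ring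
    calc _ = |(α * D - α * d n) + (α * d n - (G n).degree v)| := by ring_nf
      _ ≤ _ := abs_add_le _ _
      _ < η := by linarith
  have hint : α * D = round (α * D) := by
    by_contra hne
    obtain ⟨N, hN⟩ := key _ (abs_pos.2 (sub_ne_zero.2 hne))
    have := round_le (α * D) N
    push_cast at this
    exact absurd hN (not_lt.2 this)
  have hnn : 0 ≤ round (α * D) := by
    have : (0 : ℝ) ≤ round (α * D) := hint ▸ (by positivity)
    exact_mod_cast this
  exact ⟨(round (α * D)).toNat, by
    rw [hint]
    have := Int.toNat_of_nonneg hnn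
    simp only [round_intCast]
    exact_mod_cast this.symm⟩

/-! ### The limit -/

open Classical in
-- Covers `α = 0`, where `tendsto_div_card` gives no growth of `h`. Here `0 ^ m` is `1` exactly for
-- a single node.
theorem exists_empty_graphoning {h : ℝ → ℝ} (hg : IsGauge h) (h0 : h 0 = 0) :
    ∃ R : Set.Icc (0 : ℝ) 1 → Set.Icc (0 : ℝ) 1 → Prop,
      IsHausdorffGraphoning (Set.Icc (0 : ℝ) 1) h (relKernel R) ∧
      ∀ (U : Type) (F : SimpleGraph U) (m : ℕ) (φ : U ≃ Fin (m + 1)), IsAdmissibleLabelling F φ →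
        graphoningDensity (Measure.hausdorffMeasure 1) (gaugeMeasure (Set.Icc (0 : ℝ) 1) h)
          (relKernel R) F φ = if F.IsAcyclic then 0 ^ m else 0 := by
  have hna : NullSingletonClass (gaugeMeasure (Set.Icc (0 : ℝ) 1) h) :=
    nullSingletonClass_gaugeMeasure h0
  have hp := isProbabilityMeasure_hausdorffMeasure
  have hR : relKernel (fun _ _ : Set.Icc (0 : ℝ) 1 => False) = 0 := by
    funext x y
    simp [relKernel]
  refine ⟨fun _ _ => False, ⟨hg, ?_⟩, fun U F m φ hφ => ?_⟩
  · rw [hR]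
    refine ⟨hp, ?_, ?_, measurable_const, ?_, ?_, ?_⟩ <;> simp
  · have hiso : (F.comap φ.symm).IsAcyclic ↔ F.IsAcyclic :=
      (SimpleGraph.Iso.comap φ.symm F).isAcyclic_iff
    have hord := hφ.ordConn
    have hu : UniqueParent (F.comap φ.symm) ↔ F.IsAcyclic := by
      rw [← hiso]
      exact ⟨hord.isAcyclic, hord.uniqueParent⟩
    rw [graphoningDensity_relKernel _ _ fun _ _ h => h, rootedLIntegral_homIndicator (a := 0)
      (N := ∅) (fun _ _ h => h) (by simp) (by simp) (by simp) (by simp) (by simp) (by simp) hord]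
    simp only [hu]

/-- The gauge is `stepGauge`. Whether the limit `δ` of `1 / d n` is zero or positive decides between
an atomless gauge measure with a sum graph and counting measure with a Cayley graph. -/
theorem exists_euclidean_limit {V : ℕ → Type*} [∀ n, Fintype (V n)] [∀ n, Nonempty (V n)]
    {G : ∀ n, SimpleGraph (V n)} {d : ℕ → ℝ} {α : ℝ} (hα₀ : 0 ≤ α) (hα₁ : α ≤ 1)
    (hadm : ∀ n, IsAdmissible (G n) (d n)) (hreg : IsRegularSeq G d α)
    (hgirth : HasLargeEssentialGirth G d)
    (hv : ∀ n, Fintype.card (V n) < Fintype.card (V (n + 1))) (hd : ∀ n, d n ≤ d (n + 1)) :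
    ∃ (h : ℝ → ℝ) (W : Set.Icc (0 : ℝ) 1 → Set.Icc (0 : ℝ) 1 → ℝ≥0∞),
      IsHausdorffLimit G d (Set.Icc (0 : ℝ) 1) h W ∧ ∀ x y, W x y = 0 ∨ W x y = 1 := by
  classical
  let v : ℕ → ℕ := fun n => Fintype.card (V n)
  have hvm : StrictMono v := strictMono_nat_of_lt_succ hv
  have hv0 : 0 < v 0 := Fintype.card_pos
  have hd1 : ∀ n, 1 ≤ d n := fun n => (hadm n).1
  have hdm : Monotone d := monotone_nat_of_le_succ hd
  have hanti : Antitone fun n => 1 / d n := fun i j hij =>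
    one_div_le_one_div_of_le (by linarith [hd1 i]) (hdm hij)
  have hpos : ∀ n, 0 ≤ 1 / d n := fun n => one_div_nonneg.2 (by linarith [hd1 n])
  obtain ⟨δ, hδ⟩ : ∃ δ, Tendsto (fun n => 1 / d n) atTop (𝓝 δ) :=
    ⟨_, tendsto_atTop_ciInf hanti ⟨0, by rintro _ ⟨n, rfl⟩; exact hpos n⟩⟩
  have hδ0 : 0 ≤ δ := ge_of_tendsto' hδ hpos
  have hg : IsGauge (stepGauge v d) := isGauge_stepGauge hvm hv0 hd1
  have hh0 : stepGauge v d 0 = δ := stepGauge_zero hd1 hdm hδ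
  suffices ∃ R : Set.Icc (0 : ℝ) 1 → Set.Icc (0 : ℝ) 1 → Prop,
      IsHausdorffGraphoning (Set.Icc (0 : ℝ) 1) (stepGauge v d) (relKernel R) ∧
      ∀ (U : Type) [Fintype U] (F : SimpleGraph U), F.Connected →
        ∀ (m : ℕ) (φ : U ≃ Fin (m + 1)), IsAdmissibleLabelling F φ →
          Tendsto (fun n => ENNReal.ofReal (homDensity F (G n) (d n))) atTop
            (𝓝 (graphoningDensity (Measure.hausdorffMeasure 1)
              (gaugeMeasure (Set.Icc (0 : ℝ) 1) (stepGauge v d)) (relKernel R) F φ)) by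
    obtain ⟨R, hR, hlim⟩ := this
    refine ⟨stepGauge v d, relKernel R, ⟨hR, ?_, hlim⟩, relKernel_eq_zero_or_one R⟩
    have : (fun n => stepGauge v d (1 / (Fintype.card (V n) : ℝ))) = fun n => 1 / d n := by
      funext n
      exact stepGauge_one_div hvm hv0 hd1 hdm n
    rw [this]
  have hcard : ∀ (U : Type) [Fintype U] {m : ℕ}, U ≃ Fin (m + 1) → Fintype.card U - 1 = m := by
    intro U _ m φ
    rw [Fintype.card_congr φ, Fintype.card_fin, Nat.add_sub_cancel]
  rcases hδ0.eq_or_lt with rfl | hδpos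
  · obtain ⟨R, hR, hdens⟩ : ∃ R : Set.Icc (0 : ℝ) 1 → Set.Icc (0 : ℝ) 1 → Prop,
      IsHausdorffGraphoning (Set.Icc (0 : ℝ) 1) (stepGauge v d) (relKernel R) ∧
      ∀ (U : Type) (F : SimpleGraph U) (m : ℕ) (φ : U ≃ Fin (m + 1)), IsAdmissibleLabelling F φ →
        graphoningDensity (Measure.hausdorffMeasure 1)
          (gaugeMeasure (Set.Icc (0 : ℝ) 1) (stepGauge v d)) (relKernel R) F φ =
            if F.IsAcyclic then ENNReal.ofReal α ^ m else 0 := by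
      rcases hα₀.eq_or_lt with rfl | hαpos
      · simpa using exists_empty_graphoning hg hh0
      · exact exists_acyclic_graphoning hg hh0
          (mul_le_stepGauge hvm hv0 hd1 hdm (tendsto_div_card hadm hαpos hα₁ hreg hgirth hδ))
          hα₀ hα₁
    refine ⟨R, hR, fun U _ F hF m φ hφ => ?_⟩
    have h1 := ENNReal.tendsto_ofReal
      (tendsto_homDensity_of_tendsto_zero hadm hα₀ hα₁ hreg hgirth hδ hF)
    rw [hdens U F m φ hφ]
    convert h1 using 2
    split_ifs
    · rw [hcard U φ, ENNReal.ofReal_pow hα₀]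
    · simp
  · have hD : Tendsto d atTop (𝓝 (1 / δ)) := by
      simpa using hδ.inv₀ hδpos.ne'
    obtain ⟨k, hk⟩ := exists_natCast_eq_of_tendsto hadm hα₀ hreg hD
    have hαk : α = k * δ := by rw [← hk]; field_simp
    obtain ⟨R, hR, hdens⟩ := exists_regular_graphoning hg (by rwa [hh0])
      (k := k) (by rw [hh0, ← hαk]; exact hα₁)
    refine ⟨R, hR, fun U _ F hF m φ hφ => ?_⟩
    obtain ⟨c, hc, hlim⟩ := exists_card_rootedHom hadm hα₀ hα₁ hreg hgirth hδ hαk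
      (ballTree_isAcyclic k) (ballTree_regular k) hF (φ.symm 0)
    rw [hdens U F m φ hφ c hc, hh0]
    have h1 := ENNReal.tendsto_ofReal hlim
    rwa [hcard U φ, ENNReal.ofReal_mul (Nat.cast_nonneg _), ENNReal.ofReal_natCast,
      ENNReal.ofReal_pow hδpos.le] at h1

theorem mainTheorem5 {V : ℕ → Type*} [∀ n, Fintype (V n)] [∀ n, Nonempty (V n)]
    (G : ∀ n, SimpleGraph (V n)) (d : ℕ → ℝ) (α : ℝ) (hα₀ : 0 ≤ α) (hα₁ : α ≤ 1)
    (hadm : ∀ n, IsAdmissible (G n) (d n))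
    (hreg : IsRegularSeq G d α)
    (hgirth : HasLargeEssentialGirth G d)
    (hv : ∀ n, Fintype.card (V n) < Fintype.card (V (n + 1)))
    (hd : ∀ n, d n ≤ d (n + 1)) :
    (∃ (X : Type) (_ : MetricSpace X) (_ : MeasurableSpace X) (_ : BorelSpace X)
      (h : ℝ → ℝ) (W : X → X → ℝ≥0∞),
        IsHausdorffLimit G d X h W ∧ ∀ x y, W x y = 0 ∨ W x y = 1) ∧
    (ReciprocalConcave (fun n => (Fintype.card (V n) : ℝ)) d →
      ∃ (h : ℝ → ℝ) (W : Set.Icc (0 : ℝ) 1 → Set.Icc (0 : ℝ) 1 → ℝ≥0∞),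
        IsHausdorffLimit G d (Set.Icc (0 : ℝ) 1) h W ∧ ∀ x y, W x y = 0 ∨ W x y = 1) := by
  obtain ⟨h, W, hW⟩ := exists_euclidean_limit hα₀ hα₁ hadm hreg hgirth hv hd
  exact ⟨⟨Set.Icc (0 : ℝ) 1, inferInstance, inferInstance, inferInstance, h, W, hW⟩,
    fun _ => ⟨h, W, hW⟩⟩
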